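/- Let $k_1,k_2,\kappa_1,\kappa_2\in\mathbb R$ with $k_1,k_2\neq0$, and for $j=1,2$ put $w_j=-k_j(k_j^2-3\kappa_j^2)$, $\omega_j=-\kappa_j(3k_j^2-\kappa_j^2)$. Assume $$w_1/k_1\neq w_2/k_2,\qquad \kappa_1\neq0,\qquad \kappa_2\neq0 .$$ **The 2-soliton.** Put $z_j=k_j+i\kappa_j$, and for $A_1,A_2\in\mathbb C\setminus\{0\}$ put $E_j=A_j\exp(z_jx-z_j^3t)$. The harmonically modulated 2-soliton of the Sasa-Satsuma equation with amplitudes $A_1,A_2$ is $u=G/F$, where $G=g(z_1,z_2,E_1,E_2)+g(z_2,z_1,E_2,E_1)$, $F=1+d+h+\bar h$, and $$\begin{aligned} g={}&E_1+\tfrac{z_1-\bar z_1}{z_1(z_1+\bar z_1)^2}E_1^2\bar E_1+\tfrac{z_1-\bar z_2}{z_1(z_1+\bar z_2)^2}E_1^2\bar E_2\\ &+\tfrac{2\left((z_1+z_2)(z_1-z_2)^2+(z_1-\bar z_2)(z_1+\bar z_2)^2+(z_2-\bar z_2)(z_2+\bar z_2)^2\right)}{(z_1+z_2)(z_1+\bar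 z_2)^2(z_2+\bar z_2)^2}E_1E_2\bar E_2\\ &-\tfrac{(z_1-\bar z_1)(z_1-z_2)^2(z_2-\bar z_1)^2}{z_2\bar z_1(z_1+z_2)(z_1+\bar z_1)^2(z_2+\bar z_1)^4}E_1E_2^2\bar E_1^2 -\tfrac{(z_1-\bar z_2)(z_1-z_2)^2(z_2-\bar z_2)^2}{z_2\bar z_2(z_1+z_2)(z_1+\bar z_2)^2(z_2+\bar z_2)^4}E_1E_2^2\bar E_2^2\\ &-\tfrac{2(z_1-\bar z_1)(z_1-\bar z_2)(z_1-z_2)^2\left((z_2-\bar z_1)(z_2+\bar z_1)^2+(z_2-\bar z_2)(z_2+\bar z_2)^2-(\bar z_1+\bar z_2)(\bar z_1-\bar z_2)^2\right)}{z_1(z_1+z_2)(\bar z_1+\bar z_2)(z_1+\bar z_1)^2(z_1+\bar z_2)^2(z_2+\bar z_1)^2(z_2+\bar z_2)^2}E_1^2E_2\bar E_1\bar E_2\\ &+\tfrac{(z_1-\bar z_1)(z_2-\bar z_1)(z_1-\bar z_2)^2(z_2-\bar z_2)^2(\bar z_1-\bar z_2)^2(z_1-z_2)^4}{z_1z_2\bar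 z_2(\bar z_1+\bar z_2)(z_1+z_2)^2(z_1+\bar z_1)^2(z_2+\bar z_1)^2(z_1+\bar z_2)^4(z_2+\bar z_2)^4}E_1^2E_2^2\bar E_1\bar E_2^2, \end{aligned}$$ $$\begin{aligned} h={}&\tfrac{4}{(z_1+\bar z_2)^2}E_1\bar E_2-\tfrac{(z_1-\bar z_2)^2}{z_1\bar z_2(z_1+\bar z_2)^4}E_1^2\bar E_2^2\\ &-\tfrac{4(z_1-\bar z_1)(z_2-\bar z_1)}{\bar z_1(z_1+z_2)(z_1+\bar z_1)^2(z_2+\bar z_1)^2}E_1E_2\bar E_1^2 -\tfrac{4(z_1-\bar z_2)(z_2-\bar z_2)}{\bar z_2(z_1+z_2)(z_1+\bar z_2)^2(z_2+\bar z_2)^2}E_1E_2\bar E_2^2\\ &+\tfrac{4(z_1-\bar z_1)(z_2-\bar z_2)(z_1-z_2)^2(z_1-\bar z_2)^2(\bar z_1-\bar z_2)^2}{z_1\bar z_2(z_1+z_2)(\bar z_1+\bar z_2)(z_1+\bar z_1)^2(z_2+\bar z_1)^2(z_2+\bar z_2)^2(z_1+\bar z_2)^4}E_1^2E_2\bar E_1\bar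 E_2^2, \end{aligned}$$ $$\begin{aligned} d={}&\tfrac{4}{(z_1+\bar z_1)^2}|E_1|^2+\tfrac{4}{(z_2+\bar z_2)^2}|E_2|^2-\tfrac{(z_1-\bar z_1)^2}{|z_1|^2(z_1+\bar z_1)^4}|E_1|^4-\tfrac{(z_2-\bar z_2)^2}{|z_2|^2(z_2+\bar z_2)^4}|E_2|^4\\ &+\tfrac{8\left(|z_1+z_2|^2|z_1-z_2|^4-(z_1+\bar z_1)^2(z_1-\bar z_1)(z_2+\bar z_2)^2(z_2-\bar z_2)-(z_1+\bar z_2)^2(z_1-\bar z_2)(z_2+\bar z_1)^2(z_2-\bar z_1)\right)}{|z_1+z_2|^2(z_1+\bar z_1)^2(z_1+\bar z_2)^2(z_2+\bar z_1)^2(z_2+\bar z_2)^2}|E_1|^2|E_2|^2\\ &+\tfrac{4(z_1-\bar z_2)(z_2-\bar z_1)|z_1-z_2|^4(z_1-\bar z_1)^2}{|z_1|^2|z_1+z_2|^2(z_1+\bar z_2)^2(z_2+\bar z_1)^2(z_2+\bar z_2)^2(z_1+\bar z_1)^4}|E_1|^4|E_2|^2\\ &+\tfrac{4(z_1-\bar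 z_2)(z_2-\bar z_1)|z_1-z_2|^4(z_2-\bar z_2)^2}{|z_2|^2|z_1+z_2|^2(z_1+\bar z_1)^2(z_1+\bar z_2)^2(z_2+\bar z_1)^2(z_2+\bar z_2)^4}|E_1|^2|E_2|^4\\ &+\tfrac{(z_1-\bar z_1)^2(z_1-\bar z_2)^2(z_2-\bar z_1)^2(z_2-\bar z_2)^2|z_1-z_2|^8}{|z_1|^2|z_2|^2|z_1+z_2|^4(z_1+\bar z_1)^4(z_1+\bar z_2)^4(z_2+\bar z_1)^4(z_2+\bar z_2)^4}|E_1|^4|E_2|^4 . \end{aligned}$$ **The envelope functions.** Put $$\mu_1=\tfrac{w_2(\kappa_1-\kappa_2)-k_2(\omega_1-\omega_2)}{k_1w_2-k_2w_1},\qquad \mu_2=\tfrac{w_1(\kappa_1-\kappa_2)-k_1(\omega_1-\omega_2)}{k_1w_2-k_2w_1},$$ $$\Omega=\sqrt{((k_1+k_2)^2+(\kappa_1+\kappa_2)^2)((k_1-k_2)^2+(\kappa_1+\kappa_2)^2)},$$ $$\Upsilon=((k_1-k_2)^2+(\kappa_1-\kappa_2)^2)((k_1+k_2)^2+(\kappa_1-\kappa_2)^2),$$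 $$\Delta=\sqrt{\tfrac{(k_1-k_2)^2+(\kappa_1+\kappa_2)^2}{(k_1+k_2)^2+(\kappa_1+\kappa_2)^2}},\qquad \Gamma=\tfrac{(k_1-k_2)^2+(\kappa_1-\kappa_2)^2}{(k_1+k_2)^2+(\kappa_1-\kappa_2)^2},$$ and, with $\arg$ valued in $(-\pi,\pi]$, $$\gamma_1=\arg(k_1^2-k_2^2-(\kappa_1-\kappa_2)^2+2ik_1(\kappa_1-\kappa_2)),\quad \gamma_2=\arg(k_2^2-k_1^2-(\kappa_1-\kappa_2)^2-2ik_2(\kappa_1-\kappa_2)),$$ $$\delta_1=\arg(k_2^2-k_1^2+(\kappa_1+\kappa_2)^2+2ik_1(\kappa_1+\kappa_2)),\quad \delta_2=\arg(k_1^2-k_2^2+(\kappa_1+\kappa_2)^2+2ik_2(\kappa_1+\kappa_2)),$$ $$\lambda_j=\arg(\kappa_j(\kappa_j+ik_j)),\quad \alpha_1=\tfrac{\lambda_2+\delta_1}2,\ \alpha_2=\tfrac{\lambda_1+\delta_2}2,\ \upsilon_1=\tfrac{\lambda_2-\delta_1}2,\ \upsilon_2=\tfrac{\lambda_1-\delta_2}2,\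 \varpi_j=\tfrac{\lambda_j-\delta_j}2,$$ $$\rho_j=\arg\kappa_j,\qquad \rho=\tfrac{\delta_1+\delta_2}2-\arg\big(\kappa_1+\kappa_2+i(k_1+k_2)\big).$$ For $\phi_1,\phi_2\in\mathbb R$ define functions of $\theta_1,\theta_2\in\mathbb R$ by $$\begin{aligned}X_1={}&|k_1|(k_1^2+\kappa_1^2)^{1/4}|2\kappa_1|^{1/2}\Big(|\kappa_2|\big(\sqrt{\Delta\Gamma}\cosh(\theta_1+2\theta_2+i(\alpha_2+\gamma_2))+\tfrac1{\sqrt{\Delta\Gamma}}\cosh(\theta_1-2\theta_2+i(\upsilon_2-\gamma_2))\big)\\ &+(k_2^2+\kappa_2^2)^{1/2}\big(-8k_2^2|\kappa_2|\tfrac1{\sqrt{\Omega\Upsilon}}\cosh(\theta_1+i(\rho+\rho_2+\varpi_1+\gamma_1))+\tfrac{\sqrt\Gamma}{\sqrt\Delta}\cosh(\theta_1+i(\alpha_2-\gamma_2))+\tfrac{\sqrt\Delta}{\sqrt\Gamma}\cosh(\theta_1+i(\upsilon_2+\gamma_2))\big)\Big)\\ &-k_1^2|k_2|(k_2^2+\kappa_2^2)^{1/4}|8\kappa_2|^{1/2}\tfrac{\sqrt\Omega}{\sqrt\Upsilon}e^{i(\mu_1\theta_1-\mu_2\theta_2+\phi_1-\phi_2)}\cosh(\theta_2-i(\rho+\rho_1+\varpi_2-\gamma_2)),\end{aligned}$$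 $X_2$ by the same formula with the indices $1$ and $2$ exchanged throughout ($\theta,\phi,k,\kappa,\mu,\alpha,\upsilon,\varpi,\gamma,\rho_1,\rho_2$), and $$\begin{aligned}Y={}&(k_1^2+\kappa_1^2)^{1/2}(k_2^2+\kappa_2^2)^{1/2}\Big(\tfrac\Gamma\Delta+\tfrac\Delta\Gamma+\tfrac{64k_1^2k_2^2\kappa_1\kappa_2}{\Omega\Upsilon}\Big)+|\kappa_1\kappa_2|\Big(\Delta\Gamma\cosh(2(\theta_1+\theta_2))+\tfrac1{\Delta\Gamma}\cosh(2(\theta_1-\theta_2))\Big)\\ &+2|\kappa_2|(k_1^2+\kappa_1^2)^{1/2}\cosh2\theta_2+2|\kappa_1|(k_2^2+\kappa_2^2)^{1/2}\cosh2\theta_1\\ &+4k_1^2k_2^2\tfrac\Omega\Upsilon\cos(2(\mu_1\theta_1-\mu_2\theta_2)+2(\phi_1-\phi_2)+\rho_2-\rho_1)\\ &-16|k_1k_2||\kappa_1\kappa_2|^{1/2}(k_1^2+\kappa_1^2)^{1/4}(k_2^2+\kappa_2^2)^{1/4}\,\mathrm{Re}\Big(e^{i(\mu_1\theta_1-\mu_2\theta_2+\phi_1-\phi_2)}\\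 &\qquad\times\big(\tfrac{\sqrt\Gamma}{\sqrt\Upsilon}\cosh(\theta_1+\theta_2+i(\varpi_1-\varpi_2))+\tfrac1{\sqrt{\Gamma\Upsilon}}\cosh(\theta_1-\theta_2+i(\varpi_1+\varpi_2))\big)\Big).\end{aligned}$$ Put $f_j=X_j/Y$ and $$U_{\phi_1,\phi_2}(t,x)=e^{i\phi_1}e^{i(\kappa_1x+\omega_1t)}f_1(k_1x+w_1t,k_2x+w_2t)+e^{i\phi_2}e^{i(\kappa_2x+\omega_2t)}f_2(k_1x+w_1t,k_2x+w_2t).$$ **Proposition.** (a) For all $\phi_1,\phi_2\in\mathbb R$, $Y$ has no zero on $\mathbb R^2$, and $U_{\phi_1,\phi_2}$ is a smooth solution on $\mathbb R^2$ of the Sasa-Satsuma equation $u_t+6(u\bar u_x+3u_x\bar u)u+u_{xxx}=0$. (b) For all $A_1,A_2\neq0$, $F$ has no zero; with some auxiliary function $H(t,x)$ the functions $G,F$ satisfy the bilinear system $D_t(G,F)+D_x^3(G,F)=GH$, $D_x^2(F,F)=8G\bar G$, $6D_x(G,\bar G)=FH$, where $D(f,g)=gDf-fDg$, $D^2(f,g)=gD^2f+fD^2g-2(Df)(Dg)$,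 $D^3(f,g)=gD^3f-3(Dg)(D^2f)+3(Df)(D^2g)-fD^3g$; the 2-soliton $u=G/F$ is a smooth solution of the Sasa-Satsuma equation; and up to a space-time translation it has the rational cosh form: there are $t_0,x_0,\phi_1,\phi_2\in\mathbb R$ with $u(t,x)=U_{\phi_1,\phi_2}(t-t_0,x-x_0)$ for all $t,x$. (c) Conversely, for all $\phi_1,\phi_2\in\mathbb R$ there are $A_1,A_2\neq0$ such that $U_{\phi_1,\phi_2}$ is the 2-soliton with amplitudes $A_1,A_2$. -/

import Mathlib

noncomputable section

open scoped ComplexConjugate ContDiff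

/-! ## The Sasa-Satsuma equation and its bilinear form -/

/-- `u` is a smooth (everywhere defined) solution of
`u_t + 6 (u ū_x + 3 u_x ū) u + u_xxx = 0`; the arguments of `u` are `t`, `x` in this order. -/
def IsSasaSatsumaSolution (u : ℝ → ℝ → ℂ) : Prop :=
  ContDiff ℝ ∞ (fun z : ℝ × ℝ => u z.1 z.2) ∧
  ∀ t x : ℝ,
    deriv (fun s => u s x) t
      + 6 * (u t x * deriv (fun y => conj (u t y)) x
          + 3 * deriv (fun y => u t y) x * conj (u t x)) * u t x
      + iteratedDeriv 3 (fun y => u t y) x = 0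

/-- Hirota's operator `D (f, g) = g Df - f Dg` for one real variable. -/
def hirotaD (f g : ℝ → ℂ) (s : ℝ) : ℂ := g s * deriv f s - f s * deriv g s

/-- Hirota's operator `D² (f, g) = g D²f + f D²g - 2 (Df)(Dg)`. -/
def hirotaD2 (f g : ℝ → ℂ) (s : ℝ) : ℂ :=
  g s * iteratedDeriv 2 f s + f s * iteratedDeriv 2 g s - 2 * deriv f s * deriv g s

/-- Hirota's operator `D³ (f, g) = g D³f - 3 (Dg)(D²f) + 3 (Df)(D²g) - f D³g`. -/
def hirotaD3 (f g : ℝ → ℂ) (s : ℝ) : ℂ :=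
  g s * iteratedDeriv 3 f s - 3 * deriv g s * iteratedDeriv 2 f s
    + 3 * deriv f s * iteratedDeriv 2 g s - f s * iteratedDeriv 3 g s

/-- The bilinear form of the Sasa-Satsuma equation for `u = G / F`, with auxiliary function `H`:
`D_t(G,F) + D_x³(G,F) = G H`, `D_x²(F,F) = 8 G Ḡ`, `6 D_x(G,Ḡ) = F H`. -/
def IsSasaSatsumaBilinear (G F H : ℝ → ℝ → ℂ) : Prop :=
  ∀ t x : ℝ,
    hirotaD (fun s => G s x) (fun s => F s x) t + hirotaD3 (G t) (F t) x = G t x * H t x ∧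
    hirotaD2 (F t) (F t) x = 8 * (G t x * conj (G t x)) ∧
    6 * hirotaD (G t) (fun y => conj (G t y)) x = F t x * H t x

/-! ## The 2-soliton of the Hirota ansatz

Below `z₁`, `z₂` are the complex wave numbers, `A₁`, `A₂` the complex amplitudes, and
`Eᵢ = Aᵢ exp(Θᵢ)` with `Θᵢ = zᵢ x - zᵢ³ t`. The functions are `F = 1 + F⁽²⁾ + ... + F⁽⁸⁾`,
`G = G⁽¹⁾ + ... + G⁽⁷⁾` with `G⁽¹⁾ = E₁ + E₂`, polynomials in `E₁`, `E₂` and their conjugates. -/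

/-- `A exp(Θ)`, where `Θ = z x - z³ t`. -/
def hirotaExp (z A : ℂ) (t x : ℝ) : ℂ := A * Complex.exp (z * x - z ^ 3 * t)

/-- Half of the monomials of `G`; the other half results from exchanging the indices. -/
def ssHalfG (z₁ z₂ E₁ E₂ : ℂ) : ℂ :=
  E₁
  + (z₁ - conj z₁) / (z₁ * (z₁ + conj z₁) ^ 2) * (E₁ ^ 2 * conj E₁)
  + (z₁ - conj z₂) / (z₁ * (z₁ + conj z₂) ^ 2) * (E₁ ^ 2 * conj E₂)
  + 2 * ((z₁ + z₂) * (z₁ - z₂) ^ 2 + (z₁ - conj z₂) * (z₁ + conj z₂) ^ 2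
        + (z₂ - conj z₂) * (z₂ + conj z₂) ^ 2)
      / ((z₁ + z₂) * (z₁ + conj z₂) ^ 2 * (z₂ + conj z₂) ^ 2) * (E₁ * E₂ * conj E₂)
  - (z₁ - conj z₁) * (z₁ - z₂) ^ 2 * (z₂ - conj z₁) ^ 2
      / (z₂ * conj z₁ * (z₁ + z₂) * (z₁ + conj z₁) ^ 2 * (z₂ + conj z₁) ^ 4)
      * (E₁ * E₂ ^ 2 * conj E₁ ^ 2)
  - (z₁ - conj z₂) * (z₁ - z₂) ^ 2 * (z₂ - conj z₂) ^ 2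
      / (z₂ * conj z₂ * (z₁ + z₂) * (z₁ + conj z₂) ^ 2 * (z₂ + conj z₂) ^ 4)
      * (E₁ * E₂ ^ 2 * conj E₂ ^ 2)
  - 2 * (z₁ - conj z₁) * (z₁ - conj z₂) * (z₁ - z₂) ^ 2
      * ((z₂ - conj z₁) * (z₂ + conj z₁) ^ 2 + (z₂ - conj z₂) * (z₂ + conj z₂) ^ 2
          - (conj z₁ + conj z₂) * (conj z₁ - conj z₂) ^ 2)
      / (z₁ * (z₁ + z₂) * (conj z₁ + conj z₂) * (z₁ + conj z₁) ^ 2 * (z₁ + conj z₂) ^ 2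
          * (z₂ + conj z₁) ^ 2 * (z₂ + conj z₂) ^ 2)
      * (E₁ ^ 2 * E₂ * conj E₁ * conj E₂)
  + (z₁ - conj z₁) * (z₂ - conj z₁) * (z₁ - conj z₂) ^ 2 * (z₂ - conj z₂) ^ 2
      * (conj z₁ - conj z₂) ^ 2 * (z₁ - z₂) ^ 4
      / (z₁ * z₂ * conj z₂ * (conj z₁ + conj z₂) * (z₁ + z₂) ^ 2 * (z₁ + conj z₁) ^ 2
          * (z₂ + conj z₁) ^ 2 * (z₁ + conj z₂) ^ 4 * (z₂ + conj z₂) ^ 4)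
      * (E₁ ^ 2 * E₂ ^ 2 * conj E₁ * conj E₂ ^ 2)

/-- The numerator `G` of the 2-soliton. -/
def ssG (z₁ z₂ A₁ A₂ : ℂ) (t x : ℝ) : ℂ :=
  ssHalfG z₁ z₂ (hirotaExp z₁ A₁ t x) (hirotaExp z₂ A₂ t x)
    + ssHalfG z₂ z₁ (hirotaExp z₂ A₂ t x) (hirotaExp z₁ A₁ t x)

/-- Those monomials of `F` that come in pairs of complex conjugates (one of each pair). -/
def ssHalfF (z₁ z₂ E₁ E₂ : ℂ) : ℂ :=
  4 / (z₁ + conj z₂) ^ 2 * (E₁ * conj E₂)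
  - (z₁ - conj z₂) ^ 2 / (z₁ * conj z₂ * (z₁ + conj z₂) ^ 4) * (E₁ ^ 2 * conj E₂ ^ 2)
  - 4 * (z₁ - conj z₁) * (z₂ - conj z₁)
      / (conj z₁ * (z₁ + z₂) * (z₁ + conj z₁) ^ 2 * (z₂ + conj z₁) ^ 2)
      * (E₁ * E₂ * conj E₁ ^ 2)
  - 4 * (z₁ - conj z₂) * (z₂ - conj z₂)
      / (conj z₂ * (z₁ + z₂) * (z₁ + conj z₂) ^ 2 * (z₂ + conj z₂) ^ 2)
      * (E₁ * E₂ * conj E₂ ^ 2)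
  + 4 * (z₁ - conj z₁) * (z₂ - conj z₂) * (z₁ - z₂) ^ 2 * (z₁ - conj z₂) ^ 2
      * (conj z₁ - conj z₂) ^ 2
      / (z₁ * conj z₂ * (z₁ + z₂) * (conj z₁ + conj z₂) * (z₁ + conj z₁) ^ 2
          * (z₂ + conj z₁) ^ 2 * (z₂ + conj z₂) ^ 2 * (z₁ + conj z₂) ^ 4)
      * (E₁ ^ 2 * E₂ * conj E₁ * conj E₂ ^ 2)

/-- The self-conjugate monomials of `F`. -/
def ssDiagF (z₁ z₂ E₁ E₂ : ℂ) : ℂ :=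
  4 / (z₁ + conj z₁) ^ 2 * (E₁ * conj E₁)
  + 4 / (z₂ + conj z₂) ^ 2 * (E₂ * conj E₂)
  - (z₁ - conj z₁) ^ 2 / (z₁ * conj z₁ * (z₁ + conj z₁) ^ 4) * (E₁ ^ 2 * conj E₁ ^ 2)
  - (z₂ - conj z₂) ^ 2 / (z₂ * conj z₂ * (z₂ + conj z₂) ^ 4) * (E₂ ^ 2 * conj E₂ ^ 2)
  + 8 * ((z₁ + z₂) * (z₁ - z₂) ^ 2 * (conj z₁ + conj z₂) * (conj z₁ - conj z₂) ^ 2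
        - (z₁ + conj z₁) ^ 2 * (z₁ - conj z₁) * (z₂ + conj z₂) ^ 2 * (z₂ - conj z₂)
        - (z₁ + conj z₂) ^ 2 * (z₁ - conj z₂) * (z₂ + conj z₁) ^ 2 * (z₂ - conj z₁))
      / ((z₁ + z₂) * (conj z₁ + conj z₂) * (z₁ + conj z₁) ^ 2 * (z₁ + conj z₂) ^ 2
          * (z₂ + conj z₁) ^ 2 * (z₂ + conj z₂) ^ 2)
      * (E₁ * conj E₁ * E₂ * conj E₂)
  + 4 * (z₁ - conj z₂) * (z₂ - conj z₁) * (z₁ - z₂) ^ 2 * (z₁ - conj z₁) ^ 2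
      * (conj z₁ - conj z₂) ^ 2
      / (z₁ * conj z₁ * (z₁ + z₂) * (conj z₁ + conj z₂) * (z₁ + conj z₂) ^ 2
          * (z₂ + conj z₁) ^ 2 * (z₂ + conj z₂) ^ 2 * (z₁ + conj z₁) ^ 4)
      * (E₁ ^ 2 * E₂ * conj E₁ ^ 2 * conj E₂)
  + 4 * (z₁ - conj z₂) * (z₂ - conj z₁) * (z₁ - z₂) ^ 2 * (z₂ - conj z₂) ^ 2
      * (conj z₁ - conj z₂) ^ 2
      / (z₂ * conj z₂ * (z₁ + z₂) * (conj z₁ + conj z₂) * (z₁ + conj z₁) ^ 2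
          * (z₁ + conj z₂) ^ 2 * (z₂ + conj z₁) ^ 2 * (z₂ + conj z₂) ^ 4)
      * (E₁ * E₂ ^ 2 * conj E₁ * conj E₂ ^ 2)
  + (z₁ - conj z₁) ^ 2 * (z₁ - conj z₂) ^ 2 * (z₂ - conj z₁) ^ 2 * (z₂ - conj z₂) ^ 2
      * (z₁ - z₂) ^ 4 * (conj z₁ - conj z₂) ^ 4
      / (z₁ * z₂ * conj z₁ * conj z₂ * (z₁ + z₂) ^ 2 * (conj z₁ + conj z₂) ^ 2
          * (z₁ + conj z₁) ^ 4 * (z₁ + conj z₂) ^ 4 * (z₂ + conj z₁) ^ 4 * (z₂ + conj z₂) ^ 4)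
      * (E₁ ^ 2 * E₂ ^ 2 * conj E₁ ^ 2 * conj E₂ ^ 2)

/-- The denominator `F` of the 2-soliton. -/
def ssF (z₁ z₂ A₁ A₂ : ℂ) (t x : ℝ) : ℂ :=
  1 + ssDiagF z₁ z₂ (hirotaExp z₁ A₁ t x) (hirotaExp z₂ A₂ t x)
    + ssHalfF z₁ z₂ (hirotaExp z₁ A₁ t x) (hirotaExp z₂ A₂ t x)
    + conj (ssHalfF z₁ z₂ (hirotaExp z₁ A₁ t x) (hirotaExp z₂ A₂ t x))

/-- The 2-soliton `u = G / F`. -/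
def ssTwoSoliton (z₁ z₂ A₁ A₂ : ℂ) (t x : ℝ) : ℂ := ssG z₁ z₂ A₁ A₂ t x / ssF z₁ z₂ A₁ A₂ t x

/-! ## The rational cosh form -/

/-- The wave parameters `k₁, k₂, κ₁, κ₂` of a harmonically modulated 2-soliton. -/
structure ModParams where
  k₁ : ℝ
  k₂ : ℝ
  κ₁ : ℝ
  κ₂ : ℝ

namespace ModParams

variable (p : ModParams)

/-- The complex wave number `k₁ + i κ₁`. -/
def z₁ : ℂ := ⟨p.k₁, p.κ₁⟩
/-- The complex wave number `k₂ + i κ₂`. -/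
def z₂ : ℂ := ⟨p.k₂, p.κ₂⟩

def w₁ : ℝ := -p.k₁ * (p.k₁ ^ 2 - 3 * p.κ₁ ^ 2)
def w₂ : ℝ := -p.k₂ * (p.k₂ ^ 2 - 3 * p.κ₂ ^ 2)
def ω₁ : ℝ := -p.κ₁ * (3 * p.k₁ ^ 2 - p.κ₁ ^ 2)
def ω₂ : ℝ := -p.κ₂ * (3 * p.k₂ ^ 2 - p.κ₂ ^ 2)

def μ₁ : ℝ :=
  (p.w₂ * (p.κ₁ - p.κ₂) - p.k₂ * (p.ω₁ - p.ω₂)) / (p.k₁ * p.w₂ - p.k₂ * p.w₁)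
def μ₂ : ℝ :=
  (p.w₁ * (p.κ₁ - p.κ₂) - p.k₁ * (p.ω₁ - p.ω₂)) / (p.k₁ * p.w₂ - p.k₂ * p.w₁)

/-- The harmonically modulated form
`exp(iφ₁) exp(i(κ₁x+ω₁t)) f₁(k₁x+w₁t, k₂x+w₂t) + exp(iφ₂) exp(i(κ₂x+ω₂t)) f₂(k₁x+w₁t, k₂x+w₂t)`
with envelope functions `f₁`, `f₂`. -/
def modulated (φ₁ φ₂ : ℝ) (f₁ f₂ : ℝ → ℝ → ℂ) (t x : ℝ) : ℂ :=
  Complex.exp (φ₁ * Complex.I) * Complex.exp ((p.κ₁ * x + p.ω₁ * t) * Complex.I)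
      * f₁ (p.k₁ * x + p.w₁ * t) (p.k₂ * x + p.w₂ * t)
    + Complex.exp (φ₂ * Complex.I) * Complex.exp ((p.κ₂ * x + p.ω₂ * t) * Complex.I)
      * f₂ (p.k₁ * x + p.w₁ * t) (p.k₂ * x + p.w₂ * t)

def Ω : ℝ :=
  √(((p.k₁ + p.k₂) ^ 2 + (p.κ₁ + p.κ₂) ^ 2) * ((p.k₁ - p.k₂) ^ 2 + (p.κ₁ + p.κ₂) ^ 2))
def Υ : ℝ :=
  ((p.k₁ - p.k₂) ^ 2 + (p.κ₁ - p.κ₂) ^ 2) * ((p.k₁ + p.k₂) ^ 2 + (p.κ₁ - p.κ₂) ^ 2)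
def Δ : ℝ :=
  √(((p.k₁ - p.k₂) ^ 2 + (p.κ₁ + p.κ₂) ^ 2) / ((p.k₁ + p.k₂) ^ 2 + (p.κ₁ + p.κ₂) ^ 2))
def Γ : ℝ :=
  ((p.k₁ - p.k₂) ^ 2 + (p.κ₁ - p.κ₂) ^ 2) / ((p.k₁ + p.k₂) ^ 2 + (p.κ₁ - p.κ₂) ^ 2)

def γ₁ : ℝ :=
  Complex.arg ⟨p.k₁ ^ 2 - p.k₂ ^ 2 - (p.κ₁ - p.κ₂) ^ 2, 2 * p.k₁ * (p.κ₁ - p.κ₂)⟩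
def γ₂ : ℝ :=
  Complex.arg ⟨p.k₂ ^ 2 - p.k₁ ^ 2 - (p.κ₁ - p.κ₂) ^ 2, -2 * p.k₂ * (p.κ₁ - p.κ₂)⟩
def δ₁ : ℝ :=
  Complex.arg ⟨p.k₂ ^ 2 - p.k₁ ^ 2 + (p.κ₁ + p.κ₂) ^ 2, 2 * p.k₁ * (p.κ₁ + p.κ₂)⟩
def δ₂ : ℝ :=
  Complex.arg ⟨p.k₁ ^ 2 - p.k₂ ^ 2 + (p.κ₁ + p.κ₂) ^ 2, 2 * p.k₂ * (p.κ₁ + p.κ₂)⟩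
/-- The argument of `κ₁ (κ₁ + i k₁)`. -/
def lam₁ : ℝ := Complex.arg (p.κ₁ * (p.κ₁ + p.k₁ * Complex.I))
/-- The argument of `κ₂ (κ₂ + i k₂)`. -/
def lam₂ : ℝ := Complex.arg (p.κ₂ * (p.κ₂ + p.k₂ * Complex.I))

def α₁ : ℝ := (p.lam₂ + p.δ₁) / 2
def α₂ : ℝ := (p.lam₁ + p.δ₂) / 2
def υ₁ : ℝ := (p.lam₂ - p.δ₁) / 2
def υ₂ : ℝ := (p.lam₁ - p.δ₂) / 2
def ϖ₁ : ℝ := (p.lam₁ - p.δ₁) / 2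
def ϖ₂ : ℝ := (p.lam₂ - p.δ₂) / 2

/-- `exp(iρ₁) = sgn κ₁`. -/
def ρ₁ : ℝ := Complex.arg (p.κ₁ : ℂ)
/-- `exp(iρ₂) = sgn κ₂`. -/
def ρ₂ : ℝ := Complex.arg (p.κ₂ : ℂ)
/-- The sign angle `ρ`, given by `(δ₁ + δ₂)/2 = ρ + arg(κ₁ + κ₂ + i (k₁ + k₂))`. -/
def ρ : ℝ := (p.δ₁ + p.δ₂) / 2 - Complex.arg ⟨p.κ₁ + p.κ₂, p.k₁ + p.k₂⟩

/-- `cosh(a + i b)`. -/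
def coshI (a b : ℝ) : ℂ := Complex.cosh (a + b * Complex.I)

/-- The numerator `X₁(θ₁, θ₂)`. -/
def X₁ (φ₁ φ₂ θ₁ θ₂ : ℝ) : ℂ :=
  ((|p.k₁| * (p.k₁ ^ 2 + p.κ₁ ^ 2) ^ (1 / 4 : ℝ) * √|2 * p.κ₁| : ℝ) : ℂ) *
    ((|p.κ₂| : ℝ) *
        ((√(p.Δ * p.Γ) : ℝ) * coshI (θ₁ + 2 * θ₂) (p.α₂ + p.γ₂)
          + (1 / √(p.Δ * p.Γ) : ℝ) * coshI (θ₁ - 2 * θ₂) (p.υ₂ - p.γ₂))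
      + (√(p.k₂ ^ 2 + p.κ₂ ^ 2) : ℝ) *
        ((-8 * p.k₂ ^ 2 * |p.κ₂| * (1 / √(p.Ω * p.Υ)) : ℝ)
            * coshI θ₁ (p.ρ + p.ρ₂ + p.ϖ₁ + p.γ₁)
          + (√p.Γ / √p.Δ : ℝ) * coshI θ₁ (p.α₂ - p.γ₂)
          + (√p.Δ / √p.Γ : ℝ) * coshI θ₁ (p.υ₂ + p.γ₂)))
  - ((p.k₁ ^ 2 * |p.k₂| * (p.k₂ ^ 2 + p.κ₂ ^ 2) ^ (1 / 4 : ℝ) * √|8 * p.κ₂| : ℝ) : ℂ) *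
    ((√p.Ω / √p.Υ : ℝ)
      * Complex.exp ((p.μ₁ * θ₁ - p.μ₂ * θ₂ + φ₁ - φ₂ : ℝ) * Complex.I)
      * coshI θ₂ (-(p.ρ + p.ρ₁ + p.ϖ₂ - p.γ₂)))

/-- The numerator `X₂(θ₁, θ₂)`. -/
def X₂ (φ₁ φ₂ θ₁ θ₂ : ℝ) : ℂ :=
  ((|p.k₂| * (p.k₂ ^ 2 + p.κ₂ ^ 2) ^ (1 / 4 : ℝ) * √|2 * p.κ₂| : ℝ) : ℂ) *
    ((|p.κ₁| : ℝ) *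
        ((√(p.Δ * p.Γ) : ℝ) * coshI (θ₂ + 2 * θ₁) (p.α₁ + p.γ₁)
          + (1 / √(p.Δ * p.Γ) : ℝ) * coshI (θ₂ - 2 * θ₁) (p.υ₁ - p.γ₁))
      + (√(p.k₁ ^ 2 + p.κ₁ ^ 2) : ℝ) *
        ((-8 * p.k₁ ^ 2 * |p.κ₁| * (1 / √(p.Ω * p.Υ)) : ℝ)
            * coshI θ₂ (p.ρ + p.ρ₁ + p.ϖ₂ + p.γ₂)
          + (√p.Γ / √p.Δ : ℝ) * coshI θ₂ (p.α₁ - p.γ₁)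
          + (√p.Δ / √p.Γ : ℝ) * coshI θ₂ (p.υ₁ + p.γ₁)))
  - ((p.k₂ ^ 2 * |p.k₁| * (p.k₁ ^ 2 + p.κ₁ ^ 2) ^ (1 / 4 : ℝ) * √|8 * p.κ₁| : ℝ) : ℂ) *
    ((√p.Ω / √p.Υ : ℝ)
      * Complex.exp ((p.μ₂ * θ₂ - p.μ₁ * θ₁ + φ₂ - φ₁ : ℝ) * Complex.I)
      * coshI θ₁ (-(p.ρ + p.ρ₂ + p.ϖ₁ - p.γ₁)))

/-- The denominator `Y(θ₁, θ₂)`. -/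
def Y (φ₁ φ₂ θ₁ θ₂ : ℝ) : ℝ :=
  √(p.k₁ ^ 2 + p.κ₁ ^ 2) * √(p.k₂ ^ 2 + p.κ₂ ^ 2) *
      (p.Γ / p.Δ + p.Δ / p.Γ
        + 64 * p.k₁ ^ 2 * p.k₂ ^ 2 * p.κ₁ * p.κ₂ * (1 / (p.Ω * p.Υ)))
    + |p.κ₁ * p.κ₂| *
      (p.Δ * p.Γ * Real.cosh (2 * (θ₁ + θ₂)) + 1 / (p.Δ * p.Γ) * Real.cosh (2 * (θ₁ - θ₂)))
    + 2 * |p.κ₂| * √(p.k₁ ^ 2 + p.κ₁ ^ 2) * Real.cosh (2 * θ₂)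
    + 2 * |p.κ₁| * √(p.k₂ ^ 2 + p.κ₂ ^ 2) * Real.cosh (2 * θ₁)
    + 4 * p.k₁ ^ 2 * p.k₂ ^ 2 * (p.Ω / p.Υ)
        * Real.cos (2 * (p.μ₁ * θ₁ - p.μ₂ * θ₂) + 2 * (φ₁ - φ₂) + p.ρ₂ - p.ρ₁)
    - 16 * |p.k₁ * p.k₂| * √|p.κ₁ * p.κ₂|
        * (p.k₁ ^ 2 + p.κ₁ ^ 2) ^ (1 / 4 : ℝ) * (p.k₂ ^ 2 + p.κ₂ ^ 2) ^ (1 / 4 : ℝ)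
        * (Complex.exp ((p.μ₁ * θ₁ - p.μ₂ * θ₂ + φ₁ - φ₂ : ℝ) * Complex.I) *
            ((√p.Γ / √p.Υ : ℝ) * coshI (θ₁ + θ₂) (p.ϖ₁ - p.ϖ₂)
              + (1 / √(p.Γ * p.Υ) : ℝ) * coshI (θ₁ - θ₂) (p.ϖ₁ + p.ϖ₂))).re

/-- The envelope function `f₁ = X₁ / Y`. -/
def f₁ (φ₁ φ₂ θ₁ θ₂ : ℝ) : ℂ := p.X₁ φ₁ φ₂ θ₁ θ₂ / (p.Y φ₁ φ₂ θ₁ θ₂ : ℂ)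

/-- The envelope function `f₂ = X₂ / Y`. -/
def f₂ (φ₁ φ₂ θ₁ θ₂ : ℝ) : ℂ := p.X₂ φ₁ φ₂ θ₁ θ₂ / (p.Y φ₁ φ₂ θ₁ θ₂ : ℂ)

/-- The harmonically modulated function with the rational cosh envelopes. -/
def coshForm (φ₁ φ₂ : ℝ) : ℝ → ℝ → ℂ := p.modulated φ₁ φ₂ (p.f₁ φ₁ φ₂) (p.f₂ φ₁ φ₂)

end ModParams

end

/-! The 2-soliton is a dressed plane wave. Let L be the diagonal matrix of the wave numbers z₁, z₂,
z̄₁, z̄₂, put a = (E₁, E₂, 0, 0) and b = (0, 0, Ē₁, Ē₂), and let C, B solve the Sylvester equations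
LC + CL* = 2(aa* + bb*) and L*B + BL = 11ᵀ. With W = (1 + CB)⁻¹, mⱼ = 1ᵀLʲWa and sⱼ = 1ᵀLʲWC1, the
low rank of the two right-hand sides closes the x-derivatives: mⱼ' = mⱼ₊₁ - sⱼm₀, sⱼ' = 2(mⱼm̄₀ +
m̄ⱼm₀), and (log det(1 + CB))' = s₀. The time derivative of m₀ is likewise a polynomial in the mⱼ,
sⱼ and m̄₀. Complex conjugation exchanges a with b up to a permutation of the indices, so the sⱼ are
real and m̄ⱼ is the moment with b in place of a. The Sasa-Satsuma equation for u = m₀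
(`moment_sasaSatsuma`) and the bilinear system for det(1 + CB) and det(1 + CB)·u (`moment_bilinear`)
are then polynomial identities in these moments.

The explicit F and G are this pair. Cauchy-Binet expands the 4 × 4 determinant, the matrix
determinant lemma writes G as det(1 + CB + a1ᵀ) - det(1 + CB), and the coefficients factor because
most of the minors involved are Cauchy determinants (`det_flowTau_waveNumbers`,
`det_mul_moment_waveNumbers`).

F has no zero since it is real and (log F)'' = 4|u|² ≥ 0 in x: a function with nondecreasing
logarithmic derivative cannot come down from a positive value to zero. A positive value exists on
each line t = const: at a suitable end E₁ → 0, and there F is close to 1 or dominated by its |E₂|⁴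
term, whose coefficient is positive because κ₂ ≠ 0.

For the cosh form, all wave numbers and their sums and differences are written as monomials in
moduli and half-angle exponentials (`IsCoshParametrization`). For amplitudes of one specific modulus
and argument, the monomials of F and G, divided by the real exponential exp(2θ₁ + 2θ₂) and
multiplied by a constant, pair up as w and 1/w, that is, as cosh terms; this gives Y, X₁ and X₂.
Since the envelope speeds differ, (t, x) ↦ (θ₁, θ₂) is a linear bijection. Hence Y has no zero
either, and a translation brings arbitrary amplitudes to the required moduli; the phases φⱼ take
care of the arguments. -/

open scoped ComplexConjugate ContDiff

namespace SasaSatsuma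

noncomputable section

/-! ### Derivatives of matrix inverses and determinants -/

section MatrixCalculus

open Matrix

attribute [local instance] Matrix.linftyOpNormedRing Matrix.linftyOpNormedAlgebra

variable {n : Type*} [Fintype n] [DecidableEq n]

theorem hasDerivAt_entry {M : ℝ → Matrix n n ℂ} {M' : Matrix n n ℂ} {x : ℝ}
    (h : HasDerivAt M M' x) (i j : n) : HasDerivAt (fun y => M y i j) (M' i j) x :=
  (LinearMap.toContinuousLinearMap (Matrix.entryLinearMap ℝ ℂ i j)).hasFDerivAt.comp_hasDerivAt x h

theorem hasDerivAt_of_entries {M : ℝ → Matrix n n ℂ} {M' : Matrix n n ℂ} {x : ℝ}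
    (h : ∀ i j, HasDerivAt (fun y => M y i j) (M' i j) x) : HasDerivAt M M' x := by
  have key : HasDerivAt (fun y => ∑ i, ∑ j, M y i j • Matrix.single i j (1 : ℂ))
      (∑ i, ∑ j, M' i j • Matrix.single i j (1 : ℂ)) x :=
    HasDerivAt.fun_sum fun i _ => HasDerivAt.fun_sum fun j _ => (h i j).smul_const _
  have e (N : Matrix n n ℂ) : N = ∑ i, ∑ j, N i j • Matrix.single i j (1 : ℂ) := by
    conv_lhs => rw [Matrix.matrix_eq_sum_single N]
    simp [Matrix.smul_single]
  rw [e M']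
  exact key.congr_of_eventuallyEq (Filter.Eventually.of_forall fun y => e (M y))

theorem hasDerivAt_matrix_inv {M : ℝ → Matrix n n ℂ} {M' : Matrix n n ℂ} {x : ℝ}
    (h : HasDerivAt M M' x) (hu : IsUnit (M x)) :
    HasDerivAt (fun y => (M y)⁻¹) (-((M x)⁻¹ * M' * (M x)⁻¹)) x := by
  have : CompleteSpace (Matrix n n ℂ) := FiniteDimensional.complete ℝ _
  obtain ⟨u, hu⟩ := hu
  have h1 := hasFDerivAt_ringInverse (𝕜 := ℝ) u
  rw [hu] at h1
  have h2 := h1.comp_hasDerivAt x h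
  have e : (fun y => (M y)⁻¹) = Ring.inverse ∘ M := by
    funext y; simp [Matrix.nonsing_inv_eq_ringInverse]
  rw [e]
  have e' : Ring.inverse (M x) = (M x)⁻¹ := (Matrix.nonsing_inv_eq_ringInverse _).symm
  have e'' : (↑u⁻¹ : Matrix n n ℂ) = (M x)⁻¹ := by rw [← e', ← hu, Ring.inverse_unit]
  rw [e''] at h2
  exact h2

/-- Jacobi's formula. By Cramer's rule the trace is the sum of the determinants with one column
replaced by its derivative, which is what the product rule gives in the Leibniz expansion. -/
theorem hasDerivAt_det {M : ℝ → Matrix n n ℂ} {M' : Matrix n n ℂ} {x : ℝ}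
    (h : HasDerivAt M M' x) :
    HasDerivAt (fun y => (M y).det) (((M x).adjugate * M').trace) x := by
  have e : ((M x).adjugate * M').trace = ∑ i, ((M x).updateCol i (fun k => M' k i)).det := by
    unfold Matrix.trace
    refine Finset.sum_congr rfl fun i _ => ?_
    rw [← Matrix.cramer_apply, Matrix.cramer_eq_adjugate_mulVec]
    rfl
  rw [e]
  simp only [Matrix.det_apply]
  have h3 : ∀ σ : Equiv.Perm n, HasDerivAt (fun y => Equiv.Perm.sign σ • ∏ i, M y (σ i) i)
      (Equiv.Perm.sign σ • ∑ i, ∏ j, (M x).updateCol i (fun k => M' k i) (σ j) j) x := by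
    intro σ
    have h4 := HasDerivAt.fun_finsetProd (u := Finset.univ) (f := fun i y => M y (σ i) i)
      (f' := fun i => M' (σ i) i) (x := x) (fun i _ => hasDerivAt_entry h (σ i) i)
    have h5 := h4.const_smul (((Equiv.Perm.sign σ : ℤˣ) : ℤ) : ℂ)
    have e2 : ∀ c : ℂ, Equiv.Perm.sign σ • c = (((Equiv.Perm.sign σ : ℤˣ) : ℤ) : ℂ) • c := by
      intro c; rw [Units.smul_def, zsmul_eq_mul, smul_eq_mul]
    simp only [e2]
    refine h5.congr_deriv ?_
    refine congrArg _ (Finset.sum_congr rfl fun i _ => ?_)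
    rw [← Finset.prod_erase_mul _ _ (Finset.mem_univ i), smul_eq_mul]
    congr 1
    · refine Finset.prod_congr rfl fun j hj => ?_
      rw [Matrix.updateCol_ne (Finset.ne_of_mem_erase hj)]
    · simp
  have h6 := HasDerivAt.fun_sum (u := Finset.univ) (fun σ _ => h3 σ)
  refine h6.congr_deriv ?_
  simp only [Finset.smul_sum]
  exact Finset.sum_comm

end MatrixCalculus

/-! ### Noncommutative identities behind the dressing method -/

section DressingAlgebra

variable {R : Type*} [Ring R] {L C K J B W : R}

/-- Since W inverts 1 + CB, the commutator WP - PW equals W(PCB - CBP)W. For a flow a' = Pa, C' = PC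
+ CQ the left side is the operator giving (Wa)'; the right side shows that, apart from PW, only the
low-rank matrix QB + BP enters. -/
theorem dressing_commutator (h₁ : W * (1 + C * B) = 1) (h₂ : (1 + C * B) * W = 1) (P Q : R) :
    W * P - W * (P * C + C * Q) * B * W = P * W - W * C * (Q * B + B * P) * W := by
  have e₁ : W * P = W * P * ((1 + C * B) * W) := by rw [h₂, mul_one]
  have e₂ : P * W = (W * (1 + C * B)) * P * W := by rw [h₁, one_mul]
  rw [e₁, e₂]
  noncomm_ring

/-- The commutator identity with P = L, Q = K, multiplied by C on the right: the dressed matrix WC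
satisfies a quadratic Sylvester equation with low-rank data J and Q. -/
theorem dressing_sylvester (h₁ : W * (1 + C * B) = 1) (h₂ : (1 + C * B) * W = 1)
    (hJ : K * B + B * L = J) {Q : R} (hQ : L * C + C * K = Q) :
    W * C * K + L * (W * C) = W * C * J * (W * C) + W * Q * (1 - B * W * C) := by
  have h := dressing_commutator h₁ h₂ L K
  rw [hJ, hQ] at h
  have e : W * L * C = L * W * C - W * C * J * W * C + W * Q * B * W * C := by
    have := congrArg (· * C) h
    simp only [sub_mul] at this
    rw [← this]; noncomm_ring
  have e' : W * C * K = W * Q - W * L * C := by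
    rw [← hQ]; noncomm_ring
  rw [e', e]
  noncomm_ring

/-- The push-through identity. It is needed because the conjugate transpose turns 1 + CB into 1 +
BC. -/
theorem one_sub_mul_inverse (h₁ : W * (1 + C * B) = 1) :
    (1 - B * W * C) * (1 + B * C) = 1 := by
  have : (1 - B * W * C) * (1 + B * C) = 1 + B * C - B * (W * (1 + C * B)) * C := by noncomm_ring
  rw [this, h₁]; noncomm_ring

end DressingAlgebra

/-! ### Gram and Cauchy matrices, and the derivatives of the dressed quantities -/

section Dressing

open Matrix

attribute [local instance] Matrix.linftyOpNormedRing Matrix.linftyOpNormedAlgebra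

variable {n : Type*} [Fintype n] [DecidableEq n]

/-- The solution `C` of `L C + C Lᴴ = 2 (a aᴴ + b bᴴ)`, where `L = diagonal p`. -/
def gramMatrix (p a b : n → ℂ) : Matrix n n ℂ :=
  Matrix.of fun i j => 2 * (a i * conj (a j) + b i * conj (b j)) / (p i + conj (p j))

/-- The solution `B` of `Lᴴ B + B L = 1 1ᵀ`, where `L = diagonal p`. -/
def cauchyMatrix (p : n → ℂ) : Matrix n n ℂ := Matrix.of fun i j => 1 / (conj (p i) + p j)

/-- The matrix whose determinant is the tau function. -/
def tauMatrix (p a b : n → ℂ) : Matrix n n ℂ := 1 + gramMatrix p a b * cauchyMatrix p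

theorem gramMatrix_sylvester {p : n → ℂ} (hp : ∀ i j, p i + conj (p j) ≠ 0) (a b : n → ℂ) :
    diagonal p * gramMatrix p a b + gramMatrix p a b * diagonal (fun i => conj (p i))
      = (2 : ℂ) • (vecMulVec a (fun i => conj (a i)) + vecMulVec b (fun i => conj (b i))) := by
  ext i j
  have := hp i j
  simp [gramMatrix, diagonal_mul, mul_diagonal, vecMulVec_apply]
  field_simp

theorem cauchyMatrix_sylvester {p : n → ℂ} (hp : ∀ i j, p i + conj (p j) ≠ 0) :
    diagonal (fun i => conj (p i)) * cauchyMatrix p + cauchyMatrix p * diagonal p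
      = vecMulVec 1 1 := by
  ext i j
  have := hp j i
  rw [add_comm] at this
  simp [cauchyMatrix, diagonal_mul, mul_diagonal, vecMulVec_apply]
  field_simp

/-- Entrywise this is -(y³ + z³)/(y + z) = -y² + yz - z². The analogue for the time flow therefore
has rank at most three instead of one. -/
theorem cauchyMatrix_sylvester_cube {p : n → ℂ} (hp : ∀ i j, p i + conj (p j) ≠ 0) :
    diagonal (fun i => -conj (p i) ^ 3) * cauchyMatrix p
        + cauchyMatrix p * diagonal (fun i => -p i ^ 3)
      = -(vecMulVec (fun i => conj (p i) ^ 2) 1)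
        + vecMulVec (fun i => conj (p i)) p - vecMulVec 1 (fun i => p i ^ 2) := by
  ext i j
  have := hp j i
  rw [add_comm] at this
  simp [cauchyMatrix, diagonal_mul, mul_diagonal, vecMulVec_apply]
  field_simp
  ring

omit [Fintype n] [DecidableEq n] in
theorem gramMatrix_conjTranspose (p a b : n → ℂ) :
    (gramMatrix p a b)ᴴ = gramMatrix p a b := by
  ext i j
  simp [gramMatrix, conjTranspose_apply]
  ring

omit [Fintype n] [DecidableEq n] in
theorem cauchyMatrix_conjTranspose (p : n → ℂ) : (cauchyMatrix p)ᴴ = cauchyMatrix p := by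
  ext i j
  simp [cauchyMatrix, conjTranspose_apply]
  ring

theorem hasDerivAt_gramMatrix {p : n → ℂ} {a b : ℝ → n → ℂ} {q : n → ℂ} {x : ℝ}
    (ha : ∀ i, HasDerivAt (fun y => a y i) (q i * a x i) x)
    (hb : ∀ i, HasDerivAt (fun y => b y i) (q i * b x i) x) :
    HasDerivAt (fun y => gramMatrix p (a y) (b y))
      (diagonal q * gramMatrix p (a x) (b x)
        + gramMatrix p (a x) (b x) * diagonal (fun i => conj (q i))) x := by
  refine hasDerivAt_of_entries fun i j => ?_
  have hc : ∀ {f : ℝ → ℂ} {f' : ℂ}, HasDerivAt f f' x →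
      HasDerivAt (fun y => conj (f y)) (conj f') x := fun h =>
    Complex.conjCLE.hasFDerivAt.comp_hasDerivAt x h
  have h := ((((ha i).mul (hc (ha j))).add ((hb i).mul (hc (hb j)))).const_mul (2 : ℂ)).div_const
    (p i + conj (p j))
  refine h.congr_deriv ?_
  simp [gramMatrix, diagonal_mul, mul_diagonal]
  ring

/-- Differentiation of `W a`, where `W = (1 + C B)⁻¹`, for a flow under which `a` evolves
by `a' = Q a`. -/
theorem hasDerivAt_dressed {p : n → ℂ} {a b : ℝ → n → ℂ} {q : n → ℂ} {x : ℝ}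
    (ha : ∀ i, HasDerivAt (fun y => a y i) (q i * a x i) x)
    (hb : ∀ i, HasDerivAt (fun y => b y i) (q i * b x i) x)
    (hdet : IsUnit (tauMatrix p (a x) (b x))) (w : n → ℂ) :
    HasDerivAt (fun y => w ⬝ᵥ (tauMatrix p (a y) (b y))⁻¹ *ᵥ a y)
      (w ⬝ᵥ (diagonal q * (tauMatrix p (a x) (b x))⁻¹
        - (tauMatrix p (a x) (b x))⁻¹ * gramMatrix p (a x) (b x)
          * (diagonal (fun i => conj (q i)) * cauchyMatrix p + cauchyMatrix p * diagonal q)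
          * (tauMatrix p (a x) (b x))⁻¹) *ᵥ a x) x := by
  have h1 := hasDerivAt_gramMatrix (p := p) ha hb
  have h2 : HasDerivAt (fun y => tauMatrix p (a y) (b y)) _ x :=
    (h1.mul_const (cauchyMatrix p)).const_add 1
  have h3 := hasDerivAt_matrix_inv h2 hdet
  have hd := (Matrix.isUnit_iff_isUnit_det _).1 hdet
  rw [← dressing_commutator (Matrix.nonsing_inv_mul _ hd) (Matrix.mul_nonsing_inv _ hd)]
  have h4 : ∀ i j, HasDerivAt (fun y => (tauMatrix p (a y) (b y))⁻¹ i j * a y j)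
    _ x := fun i j => (hasDerivAt_entry h3 i j).mul (ha j)
  have h5 := HasDerivAt.fun_sum (u := Finset.univ) fun i _ =>
    (HasDerivAt.fun_sum (u := Finset.univ) fun j _ => h4 i j).const_mul (w i)
  refine h5.congr_deriv ?_
  simp only [dotProduct, Matrix.sub_mulVec, Pi.sub_apply]
  refine Finset.sum_congr rfl fun i _ => ?_
  congr 1
  rw [Finset.sum_add_distrib]
  simp only [mulVec, dotProduct, mul_diagonal, Matrix.neg_apply, neg_mul, Finset.sum_neg_distrib,
    mul_assoc]
  ring

/-- C and B are Hermitian, so W* inverts 1 + BC. -/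
theorem inv_tauMatrix_conjTranspose {p a b : n → ℂ} (hdet : IsUnit (tauMatrix p a b)) :
    ((tauMatrix p a b)⁻¹)ᴴ
      = 1 - cauchyMatrix p * (tauMatrix p a b)⁻¹ * gramMatrix p a b := by
  rw [Matrix.conjTranspose_nonsing_inv]
  refine Matrix.inv_eq_left_inv ?_
  have h : (tauMatrix p a b)ᴴ = 1 + cauchyMatrix p * gramMatrix p a b := by
    simp [tauMatrix, conjTranspose_mul, gramMatrix_conjTranspose, cauchyMatrix_conjTranspose]
  rw [h]
  exact one_sub_mul_inverse
    (Matrix.nonsing_inv_mul _ ((Matrix.isUnit_iff_isUnit_det _).1 hdet))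

omit [DecidableEq n] in
theorem dotProduct_rankTwo_mulVec (W : Matrix n n ℂ) (a b w v : n → ℂ) :
    w ⬝ᵥ (W * ((2 : ℂ) • (vecMulVec a (fun i => conj (a i)) + vecMulVec b (fun i => conj (b i))))
        * Wᴴ) *ᵥ v
      = 2 * ((w ⬝ᵥ W *ᵥ a) * conj (star v ⬝ᵥ W *ᵥ a)
          + (w ⬝ᵥ W *ᵥ b) * conj (star v ⬝ᵥ W *ᵥ b)) := by
  have h (a : n → ℂ) : w ⬝ᵥ (W * vecMulVec a (fun i => conj (a i)) * Wᴴ) *ᵥ v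
      = (w ⬝ᵥ W *ᵥ a) * conj (star v ⬝ᵥ W *ᵥ a) := by
    have e : (fun i => conj (a i)) = star a := rfl
    rw [e, Matrix.mul_vecMulVec, Matrix.vecMulVec_mul, ← Matrix.star_mulVec,
      Matrix.vecMulVec_mulVec]
    rw [Matrix.star_dotProduct, dotProduct_smul]
    rfl
  rw [Matrix.mul_smul, Matrix.smul_mul, Matrix.smul_mulVec, dotProduct_smul, Matrix.mul_add,
    Matrix.add_mul, Matrix.add_mulVec, dotProduct_add, h a, h b, smul_eq_mul]

/-- (WC)' = WC' - WC'BWC = WC'(1 - BWC) = WC'W*, and C' = 2(aa* + bb*) along the x-flow has rank at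
most two. -/
theorem hasDerivAt_dressed_gram {p : n → ℂ} {a b : ℝ → n → ℂ} {x : ℝ}
    (ha : ∀ i, HasDerivAt (fun y => a y i) (p i * a x i) x)
    (hb : ∀ i, HasDerivAt (fun y => b y i) (p i * b x i) x)
    (hp : ∀ i j, p i + conj (p j) ≠ 0)
    (hdet : IsUnit (tauMatrix p (a x) (b x))) (w v : n → ℂ) :
    HasDerivAt (fun y => w ⬝ᵥ ((tauMatrix p (a y) (b y))⁻¹ * gramMatrix p (a y) (b y)) *ᵥ v)
      (2 * ((w ⬝ᵥ (tauMatrix p (a x) (b x))⁻¹ *ᵥ a x)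
            * conj (star v ⬝ᵥ (tauMatrix p (a x) (b x))⁻¹ *ᵥ a x)
          + (w ⬝ᵥ (tauMatrix p (a x) (b x))⁻¹ *ᵥ b x)
            * conj (star v ⬝ᵥ (tauMatrix p (a x) (b x))⁻¹ *ᵥ b x))) x := by
  have h1 := hasDerivAt_gramMatrix (p := p) ha hb
  rw [gramMatrix_sylvester hp] at h1
  have h2 : HasDerivAt (fun y => tauMatrix p (a y) (b y)) _ x :=
    (h1.mul_const (cauchyMatrix p)).const_add 1
  have h3 := hasDerivAt_matrix_inv h2 hdet
  have h4 := h3.mul h1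
  have h5 := HasDerivAt.fun_sum (u := Finset.univ) fun i _ =>
    (HasDerivAt.fun_sum (u := Finset.univ) fun j _ =>
      (hasDerivAt_entry h4 i j).mul_const (v j)).const_mul (w i)
  refine h5.congr_deriv ?_
  rw [← dotProduct_rankTwo_mulVec, inv_tauMatrix_conjTranspose hdet]
  simp only [dotProduct, mulVec]
  refine Finset.sum_congr rfl fun i _ => ?_
  congr 1
  refine Finset.sum_congr rfl fun j _ => ?_
  congr 1
  refine congrFun (congrFun ?_ i) j
  -- Only the noncommutative ring structure matters from here on.
  generalize (2 : ℂ) • (_ : Matrix n n ℂ) = Q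
  noncomm_ring

/-- The Sylvester equation of `W C` in weak form. -/
theorem dressed_gram_sylvester {p a b : n → ℂ} (hp : ∀ i j, p i + conj (p j) ≠ 0)
    (hdet : IsUnit (tauMatrix p a b)) (w v : n → ℂ) :
    w ⬝ᵥ ((tauMatrix p a b)⁻¹ * gramMatrix p a b) *ᵥ (fun i => conj (p i) * v i)
      + (fun i => w i * p i) ⬝ᵥ ((tauMatrix p a b)⁻¹ * gramMatrix p a b) *ᵥ v
      = (w ⬝ᵥ ((tauMatrix p a b)⁻¹ * gramMatrix p a b) *ᵥ 1)
          * (1 ⬝ᵥ ((tauMatrix p a b)⁻¹ * gramMatrix p a b) *ᵥ v)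
        + 2 * ((w ⬝ᵥ (tauMatrix p a b)⁻¹ *ᵥ a) * conj (star v ⬝ᵥ (tauMatrix p a b)⁻¹ *ᵥ a)
          + (w ⬝ᵥ (tauMatrix p a b)⁻¹ *ᵥ b) * conj (star v ⬝ᵥ (tauMatrix p a b)⁻¹ *ᵥ b)) := by
  have hd := (Matrix.isUnit_iff_isUnit_det _).1 hdet
  have h := dressing_sylvester (Matrix.nonsing_inv_mul _ hd) (Matrix.mul_nonsing_inv _ hd)
    (cauchyMatrix_sylvester hp) (gramMatrix_sylvester hp a b)
  rw [← dotProduct_rankTwo_mulVec, inv_tauMatrix_conjTranspose hdet]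
  have h' := congrArg (fun N => w ⬝ᵥ N *ᵥ v) h
  simp only [Matrix.add_mulVec, dotProduct_add] at h'
  have e1 : (fun i => conj (p i) * v i) = diagonal (fun i => conj (p i)) *ᵥ v := by
    ext i; simp [Matrix.mulVec_diagonal]
  have e2 : (fun i => w i * p i) = w ᵥ* diagonal p := by
    ext i; simp [Matrix.vecMul_diagonal]
  rw [e1, e2, ← Matrix.dotProduct_mulVec, Matrix.mulVec_mulVec, Matrix.mulVec_mulVec]
  refine h'.trans ?_
  congr 1
  rw [← Matrix.mulVec_mulVec, Matrix.mul_vecMulVec, Matrix.vecMulVec_mulVec]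
  simp [dotProduct_smul, mul_comm]

/-- The logarithmic derivative is tr(WC'B) with C' = LC + CL*. Moving L* past B by L*B = 11ᵀ - BL
leaves tr(WC·11ᵀ); the other two terms cancel by cyclicity of the trace, because W commutes with CB.
-/
theorem hasDerivAt_det_tauMatrix {p : n → ℂ} {a b : ℝ → n → ℂ} {x : ℝ}
    (ha : ∀ i, HasDerivAt (fun y => a y i) (p i * a x i) x)
    (hb : ∀ i, HasDerivAt (fun y => b y i) (p i * b x i) x)
    (hp : ∀ i j, p i + conj (p j) ≠ 0)
    (hdet : IsUnit (tauMatrix p (a x) (b x))) :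
    HasDerivAt (fun y => (tauMatrix p (a y) (b y)).det)
      ((1 ⬝ᵥ ((tauMatrix p (a x) (b x))⁻¹ * gramMatrix p (a x) (b x)) *ᵥ 1)
        * (tauMatrix p (a x) (b x)).det) x := by
  have h1 := hasDerivAt_gramMatrix (p := p) ha hb
  have h2 : HasDerivAt (fun y => tauMatrix p (a y) (b y)) _ x :=
    (h1.mul_const (cauchyMatrix p)).const_add 1
  refine (hasDerivAt_det h2).congr_deriv ?_
  have hd := (Matrix.isUnit_iff_isUnit_det _).1 hdet
  set W := (tauMatrix p (a x) (b x))⁻¹ with hW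
  set C := gramMatrix p (a x) (b x)
  set B := cauchyMatrix p
  have hadj : (tauMatrix p (a x) (b x)).adjugate = (tauMatrix p (a x) (b x)).det • W := by
    rw [hW, Matrix.inv_def, smul_smul, Ring.mul_inverse_cancel _ hd, one_smul]
  have hcomm : W * (C * B) = C * B * W := by
    have e1 : W * (1 + C * B) = 1 := Matrix.nonsing_inv_mul _ hd
    have e2 : (1 + C * B) * W = 1 := Matrix.mul_nonsing_inv _ hd
    have e3 := e1.trans e2.symm
    rw [mul_add, add_mul, mul_one, one_mul] at e3
    exact add_left_cancel e3
  have hR : diagonal (fun i => conj (p i)) * B = vecMulVec 1 1 - B * diagonal p :=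
    eq_sub_of_add_eq (cauchyMatrix_sylvester hp)
  rw [hadj, Matrix.smul_mul, Matrix.trace_smul, smul_eq_mul, mul_comm]
  congr 1
  have e4 : W * ((diagonal p * C + C * diagonal fun i => conj (p i)) * B)
      = W * diagonal p * (C * B) + W * C * vecMulVec 1 1 - W * (C * B) * diagonal p := by
    rw [add_mul, Matrix.mul_assoc C, hR]
    noncomm_ring
  have e5 : (W * diagonal p * (C * B)).trace = (W * (C * B) * diagonal p).trace := by
    rw [Matrix.trace_mul_comm, ← Matrix.mul_assoc, ← hcomm]
  rw [e4, Matrix.trace_sub, Matrix.trace_add, e5, add_sub_cancel_left, Matrix.mul_vecMulVec,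
    Matrix.trace_vecMulVec, dotProduct_comm]

end Dressing

theorem hasDerivAt_conj {f : ℝ → ℂ} {f' : ℂ} {x : ℝ} (h : HasDerivAt f f' x) :
    HasDerivAt (fun y => conj (f y)) (conj f') x :=
  Complex.conjCLE.hasFDerivAt.comp_hasDerivAt x h

theorem hasDerivAt_hirotaExp_x (z A : ℂ) (t x : ℝ) :
    HasDerivAt (fun y => hirotaExp z A t y) (z * hirotaExp z A t x) x := by
  have h : HasDerivAt (fun y : ℝ => z * (y : ℂ) - z ^ 3 * (t : ℂ)) z x := by
    simpa using ((Complex.ofRealCLM.hasDerivAt (x := x)).const_mul z).sub_const (z ^ 3 * (t : ℂ))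
  refine (h.cexp.const_mul A).congr_deriv ?_
  simp only [hirotaExp]; ring

theorem hasDerivAt_hirotaExp_t (z A : ℂ) (t x : ℝ) :
    HasDerivAt (fun s => hirotaExp z A s x) (-z ^ 3 * hirotaExp z A t x) t := by
  have h : HasDerivAt (fun s : ℝ => z * (x : ℂ) - z ^ 3 * (s : ℂ)) (-z ^ 3) t := by
    simpa using ((Complex.ofRealCLM.hasDerivAt (x := t)).const_mul (z ^ 3)).const_sub (z * (x : ℂ))
  refine (h.cexp.const_mul A).congr_deriv ?_
  simp only [hirotaExp]; ring

/-! ### The moments and their closed system of derivatives -/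

section Flow

open Matrix

variable {n : Type*} [Fintype n] [DecidableEq n]

/-- The vector of exponentials with wave numbers `p` and amplitudes `α`. -/
def expVec (p α : n → ℂ) (t x : ℝ) : n → ℂ := fun i => hirotaExp (p i) (α i) t x

/-- The complex conjugate of `expVec`, with the indices permuted by `σ`. -/
def conjExpVec (p α : n → ℂ) (σ : Equiv.Perm n) (t x : ℝ) : n → ℂ :=
  fun i => conj (expVec p α t x (σ i))

/-- The tau matrix along the flow. -/
def flowTau (p α : n → ℂ) (σ : Equiv.Perm n) (t x : ℝ) : Matrix n n ℂ :=
  tauMatrix p (expVec p α t x) (conjExpVec p α σ t x)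

/-- `W C` along the flow, where `W` is the inverse of the tau matrix. -/
def flowGram (p α : n → ℂ) (σ : Equiv.Perm n) (t x : ℝ) : Matrix n n ℂ :=
  (flowTau p α σ t x)⁻¹ * gramMatrix p (expVec p α t x) (conjExpVec p α σ t x)

/-- The moments `1ᵀ Lʲ W a`. -/
def moment (p α : n → ℂ) (σ : Equiv.Perm n) (j : ℕ) (t x : ℝ) : ℂ :=
  (fun i => p i ^ j) ⬝ᵥ (flowTau p α σ t x)⁻¹ *ᵥ expVec p α t x

/-- The moments `1ᵀ Lʲ W C 1`. -/
def gramMoment (p α : n → ℂ) (σ : Equiv.Perm n) (j : ℕ) (t x : ℝ) : ℂ :=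
  (fun i => p i ^ j) ⬝ᵥ flowGram p α σ t x *ᵥ 1

variable {p α : n → ℂ} {σ : Equiv.Perm n} {t x : ℝ}

omit [Fintype n] [DecidableEq n] in
-- The reality condition. Conjugation exchanges the roles of a and b, up to the index permutation,
-- and C is symmetric in the two.
theorem map_conj_gramMatrix (hσ : ∀ i, σ (σ i) = i) (hpσ : ∀ i, p (σ i) = conj (p i)) :
    (gramMatrix p (expVec p α t x) (conjExpVec p α σ t x)).map conj
      = (gramMatrix p (expVec p α t x) (conjExpVec p α σ t x)).submatrix σ σ := by
  ext i j
  simp [gramMatrix, conjExpVec, hσ, hpσ, map_ofNat]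
  ring

theorem map_conj_flowTau (hσ : ∀ i, σ (σ i) = i) (hpσ : ∀ i, p (σ i) = conj (p i)) :
    (flowTau p α σ t x).map conj = (flowTau p α σ t x).submatrix σ σ := by
  have hB : (cauchyMatrix p).map conj = (cauchyMatrix p).submatrix σ σ := by
    ext i j
    simp [cauchyMatrix, hpσ]
  rw [flowTau, tauMatrix, Matrix.map_add _ (map_add _), Matrix.map_mul, hB,
    map_conj_gramMatrix hσ hpσ, Matrix.submatrix_add, Pi.add_apply, Matrix.submatrix_mul_equiv]
  simp

theorem map_conj_inv_flowTau (hσ : ∀ i, σ (σ i) = i) (hpσ : ∀ i, p (σ i) = conj (p i)) :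
    (flowTau p α σ t x)⁻¹.map conj = (flowTau p α σ t x)⁻¹.submatrix σ σ := by
  rw [← Matrix.inv_submatrix_equiv, ← map_conj_flowTau hσ hpσ]
  have hdet : ((flowTau p α σ t x).map conj).det = conj (flowTau p α σ t x).det :=
    (RingHom.map_det _ _).symm
  have hadj : ((flowTau p α σ t x).map conj).adjugate = (flowTau p α σ t x).adjugate.map conj :=
    (RingHom.map_adjugate _ _).symm
  rw [Matrix.inv_def, Matrix.inv_def, hdet, hadj]
  ext i j
  simp

/-- This is how ū enters: it is the second component of a dressed two-component field (a, b) with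
the conjugation symmetry. -/
theorem conj_moment (hσ : ∀ i, σ (σ i) = i) (hpσ : ∀ i, p (σ i) = conj (p i)) (j : ℕ) :
    conj (moment p α σ j t x)
      = (fun i => p i ^ j) ⬝ᵥ (flowTau p α σ t x)⁻¹ *ᵥ conjExpVec p α σ t x := by
  have h := map_conj_inv_flowTau (α := α) (t := t) (x := x) hσ hpσ
  simp only [moment, dotProduct, mulVec, map_sum, map_mul, map_pow]
  rw [← Equiv.sum_comp σ]
  refine Finset.sum_congr rfl fun i _ => ?_
  rw [hpσ, Complex.conj_conj]
  congr 1
  rw [← Equiv.sum_comp σ]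
  refine Finset.sum_congr rfl fun k _ => ?_
  have := congrFun (congrFun h (σ i)) (σ k)
  simp only [Matrix.map_apply, Matrix.submatrix_apply, hσ] at this
  rw [this]; rfl

theorem conj_gramMoment (hσ : ∀ i, σ (σ i) = i) (hpσ : ∀ i, p (σ i) = conj (p i)) (j : ℕ) :
    conj (gramMoment p α σ j t x) = gramMoment p α σ j t x := by
  have h : (flowGram p α σ t x).map conj = (flowGram p α σ t x).submatrix σ σ := by
    rw [flowGram, Matrix.map_mul, map_conj_inv_flowTau hσ hpσ, map_conj_gramMatrix hσ hpσ,
      Matrix.submatrix_mul_equiv]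
  simp only [gramMoment, dotProduct, mulVec, map_sum, map_mul, map_pow, Pi.one_apply,
    mul_one]
  rw [← Equiv.sum_comp σ]
  refine Finset.sum_congr rfl fun i _ => ?_
  rw [hpσ, Complex.conj_conj]
  congr 1
  rw [← Equiv.sum_comp σ]
  refine Finset.sum_congr rfl fun k _ => ?_
  have := congrFun (congrFun h (σ i)) (σ k)
  simpa only [Matrix.map_apply, Matrix.submatrix_apply, hσ] using this

omit [Fintype n] [DecidableEq n] in
theorem hasDerivAt_conjExpVec_x (hpσ : ∀ i, p (σ i) = conj (p i)) (i : n) :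
    HasDerivAt (fun y => conjExpVec p α σ t y i) (p i * conjExpVec p α σ t x i) x := by
  refine (hasDerivAt_conj (hasDerivAt_hirotaExp_x (p (σ i)) (α (σ i)) t x)).congr_deriv ?_
  simp [conjExpVec, expVec, hpσ]

omit [Fintype n] [DecidableEq n] in
theorem hasDerivAt_conjExpVec_t (hpσ : ∀ i, p (σ i) = conj (p i)) (i : n) :
    HasDerivAt (fun s => conjExpVec p α σ s x i) (-p i ^ 3 * conjExpVec p α σ t x i) t := by
  refine (hasDerivAt_conj (hasDerivAt_hirotaExp_t (p (σ i)) (α (σ i)) t x)).congr_deriv ?_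
  simp [conjExpVec, expVec, hpσ]

theorem isUnit_flowTau (hdet : (flowTau p α σ t x).det ≠ 0) : IsUnit (flowTau p α σ t x) :=
  (Matrix.isUnit_iff_isUnit_det _).2 hdet.isUnit

/-- For the x-flow the matrix L*B + BL in `hasDerivAt_dressed` is 11ᵀ, so the correction term splits
into a product of two moments. -/
theorem hasDerivAt_moment (hpσ : ∀ i, p (σ i) = conj (p i))
    (hp : ∀ i j, p i + conj (p j) ≠ 0) (hdet : (flowTau p α σ t x).det ≠ 0) (j : ℕ) :
    HasDerivAt (fun y => moment p α σ j t y)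
      (moment p α σ (j + 1) t x - gramMoment p α σ j t x * moment p α σ 0 t x) x := by
  have h := hasDerivAt_dressed (p := p) (a := fun y => expVec p α t y)
    (b := fun y => conjExpVec p α σ t y) (q := p) (x := x)
    (fun i => hasDerivAt_hirotaExp_x _ _ _ _) (hasDerivAt_conjExpVec_x hpσ)
    (isUnit_flowTau hdet) (fun i => p i ^ j)
  rw [cauchyMatrix_sylvester hp] at h
  refine h.congr_deriv ?_
  rw [Matrix.sub_mulVec, dotProduct_sub]
  congr 1
  · simp only [moment, flowTau, ← Matrix.mulVec_mulVec, dotProduct, Matrix.mulVec_diagonal]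
    refine Finset.sum_congr rfl fun i _ => ?_
    ring
  · rw [← Matrix.mulVec_mulVec, Matrix.mul_vecMulVec, Matrix.vecMulVec_mulVec]
    simp [dotProduct_smul, gramMoment, moment, flowGram, flowTau]
    exact mul_comm _ _

/-- The rank-two formula for (WC)' with test vector 1. The contributions of a and b are conjugate to
each other in the sense of `conj_moment`. -/
theorem hasDerivAt_gramMoment (hσ : ∀ i, σ (σ i) = i) (hpσ : ∀ i, p (σ i) = conj (p i))
    (hp : ∀ i j, p i + conj (p j) ≠ 0) (hdet : (flowTau p α σ t x).det ≠ 0) (j : ℕ) :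
    HasDerivAt (fun y => gramMoment p α σ j t y)
      (2 * (moment p α σ j t x * conj (moment p α σ 0 t x)
        + conj (moment p α σ j t x) * moment p α σ 0 t x)) x := by
  have h := hasDerivAt_dressed_gram (p := p) (a := fun y => expVec p α t y)
    (b := fun y => conjExpVec p α σ t y) (x := x)
    (fun i => hasDerivAt_hirotaExp_x _ _ _ _) (hasDerivAt_conjExpVec_x hpσ) hp
    (isUnit_flowTau hdet) (fun i => p i ^ j) 1
  refine h.congr_deriv ?_
  have e0 := conj_moment (α := α) (t := t) (x := x) hσ hpσ 0
  have ej := conj_moment (α := α) (t := t) (x := x) hσ hpσ j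
  simp only [pow_zero] at e0
  have e1 : (fun _ : n => (1 : ℂ)) = 1 := rfl
  rw [e1] at e0
  rw [star_one, ← flowTau, ← ej, ← e0, Complex.conj_conj]
  simp only [moment, pow_zero, e1]

theorem hasDerivAt_det_flowTau (hpσ : ∀ i, p (σ i) = conj (p i))
    (hp : ∀ i j, p i + conj (p j) ≠ 0) (hdet : (flowTau p α σ t x).det ≠ 0) :
    HasDerivAt (fun y => (flowTau p α σ t y).det)
      (gramMoment p α σ 0 t x * (flowTau p α σ t x).det) x := by
  have h := hasDerivAt_det_tauMatrix (p := p) (a := fun y => expVec p α t y)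
    (b := fun y => conjExpVec p α σ t y) (x := x)
    (fun i => hasDerivAt_hirotaExp_x _ _ _ _) (hasDerivAt_conjExpVec_x hpσ) hp
    (isUnit_flowTau hdet)
  refine h.congr_deriv ?_
  simp only [gramMoment, pow_zero]; rfl

/-- The rank-three form of the cubic commutator produces 1ᵀWC(p̄)² and 1ᵀWCp̄, which are not gram
moments. The weak Sylvester equation turns them into moments; `σ₁` is the value of 1ᵀWCp̄. -/
theorem hasDerivAt_moment_t (hσ : ∀ i, σ (σ i) = i) (hpσ : ∀ i, p (σ i) = conj (p i))
    (hp : ∀ i j, p i + conj (p j) ≠ 0) (hdet : (flowTau p α σ t x).det ≠ 0) {u s σ₁ : ℂ}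
    (hu : u = moment p α σ 0 t x) (hs : s = gramMoment p α σ 0 t x)
    (hσ₁ : σ₁ = -gramMoment p α σ 1 t x + s ^ 2 + 4 * u * conj u) :
    HasDerivAt (fun r => moment p α σ 0 r x)
      (-moment p α σ 3 t x
        + (gramMoment p α σ 2 t x - gramMoment p α σ 1 t x * s + s * σ₁) * u
        - σ₁ * moment p α σ 1 t x + s * moment p α σ 2 t x) t := by
  have h := hasDerivAt_dressed (p := p) (a := fun r => expVec p α r x)
    (b := fun r => conjExpVec p α σ r x) (q := fun i => -p i ^ 3) (x := t)
    (fun i => hasDerivAt_hirotaExp_t _ _ _ _) (hasDerivAt_conjExpVec_t hpσ)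
    (isUnit_flowTau hdet) (fun i => p i ^ 0)
  simp only [map_neg, map_pow] at h
  rw [cauchyMatrix_sylvester_cube hp] at h
  refine h.congr_deriv ?_
  have one_eq : (fun _ : n => (1 : ℂ)) = 1 := rfl
  have syl := dressed_gram_sylvester hp (isUnit_flowTau (α := α) hdet)
  rw [← flowTau, ← flowGram] at syl
  have m0 : moment p α σ 0 t x = 1 ⬝ᵥ (flowTau p α σ t x)⁻¹ *ᵥ expVec p α t x := by
    simp only [moment, pow_zero, one_eq]
  have m1 : moment p α σ 1 t x = p ⬝ᵥ (flowTau p α σ t x)⁻¹ *ᵥ expVec p α t x := by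
    simp only [moment, pow_one]
  have c0 : conj (moment p α σ 0 t x)
      = 1 ⬝ᵥ (flowTau p α σ t x)⁻¹ *ᵥ conjExpVec p α σ t x := by
    rw [conj_moment hσ hpσ]; simp only [pow_zero, one_eq]
  have c1 : conj (moment p α σ 1 t x)
      = p ⬝ᵥ (flowTau p α σ t x)⁻¹ *ᵥ conjExpVec p α σ t x := by
    rw [conj_moment hσ hpσ]; simp only [pow_one]
  have s0 : gramMoment p α σ 0 t x = 1 ⬝ᵥ flowGram p α σ t x *ᵥ 1 := by
    simp only [gramMoment, pow_zero, one_eq]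
  have s1 : gramMoment p α σ 1 t x = p ⬝ᵥ flowGram p α σ t x *ᵥ 1 := by
    simp only [gramMoment, pow_one]
  have s2 : gramMoment p α σ 2 t x = (fun i => p i ^ 2) ⬝ᵥ flowGram p α σ t x *ᵥ 1 := rfl
  -- The Sylvester equation is tested on the pairs (1, 1), (1, p̄) and (p, 1).
  have star_p : star (fun i => conj (p i)) = p := by ext i; simp
  have e11 := syl 1 1
  have e1p := syl 1 (fun i => conj (p i))
  have ep1 := syl p 1
  simp only [star_one, star_p, Pi.one_apply, one_mul, mul_one, ← m0, ← m1, ← c0, ← c1, ← s0, ← s1,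
    ← s2, Complex.conj_conj, ← sq] at e11 e1p ep1
  have m2 : moment p α σ 2 t x
      = (fun i => p i ^ 2) ⬝ᵥ (flowTau p α σ t x)⁻¹ *ᵥ expVec p α t x := rfl
  have m3 : (1 : n → ℂ) ⬝ᵥ (diagonal (fun i => -p i ^ 3) * (flowTau p α σ t x)⁻¹)
      *ᵥ expVec p α t x = -moment p α σ 3 t x := by
    simp only [moment, ← Matrix.mulVec_mulVec, dotProduct, Matrix.mulVec_diagonal,
      ← Finset.sum_neg_distrib, Pi.one_apply]
    refine Finset.sum_congr rfl fun i _ => ?_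
    ring
  have e (v w : n → ℂ) : (1 : n → ℂ) ⬝ᵥ (flowGram p α σ t x * vecMulVec v w
      * (flowTau p α σ t x)⁻¹) *ᵥ expVec p α t x
      = (1 ⬝ᵥ flowGram p α σ t x *ᵥ v)
        * (w ⬝ᵥ (flowTau p α σ t x)⁻¹ *ᵥ expVec p α t x) := by
    rw [← Matrix.mulVec_mulVec, Matrix.mul_vecMulVec, Matrix.vecMulVec_mulVec, dotProduct_smul]
    rfl
  simp only [pow_zero, one_eq]
  rw [← flowTau, ← flowGram, Matrix.sub_mulVec, dotProduct_sub, m3, Matrix.mul_sub, Matrix.mul_add, Matrix.mul_neg,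
    Matrix.sub_mul, Matrix.add_mul, Matrix.neg_mul, Matrix.sub_mulVec, Matrix.add_mulVec,
    Matrix.neg_mulVec, dotProduct_sub, dotProduct_add, dotProduct_neg, e, e, e, ← m0, ← m1, ← m2,
    ← s0]
  simp only [← hu, ← hs] at e11 e1p ep1 ⊢
  have e_p : (fun i => p i) = p := rfl
  rw [e_p] at e1p
  -- The difference of `e1p` and `ep1` eliminates pᵀWCp̄ together with all quadratic terms in m₀, m₁
  -- and their conjugates; `e11` supplies 1ᵀWCp̄ = σ₁.
  linear_combination u * e1p - u * ep1 + (s * u - moment p α σ 1 t x) * e11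
    + (moment p α σ 1 t x - s * u) * hσ₁

end Flow

/-! ### Log-convex functions stay positive -/

section LogConvex

/-- A function with nondecreasing logarithmic derivative cannot reach zero to the right of a
point where it is positive. -/
theorem pos_right_of_monotone_logDeriv {f s s' : ℝ → ℝ} (hf : Continuous f)
    (hfs : ∀ x, f x ≠ 0 → HasDerivAt f (s x * f x) x)
    (hs : ∀ x, f x ≠ 0 → HasDerivAt s (s' x) x) (hs' : ∀ x, 0 ≤ s' x)
    {x₁ x : ℝ} (hx : x₁ ≤ x) (h₁ : 0 < f x₁) : 0 < f x := by
  by_contra! hneg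
  obtain ⟨z, hz, hz0⟩ : (0 : ℝ) ∈ f '' Set.Icc x₁ x :=
    intermediate_value_Icc' hx hf.continuousOn ⟨hneg, h₁.le⟩
  -- x₀ is the first zero to the right of x₁; f is positive before it, so s is nondecreasing there.
  have hcomp : IsCompact (Set.Icc x₁ x ∩ f ⁻¹' {0}) :=
    isCompact_Icc.inter_right (isClosed_singleton.preimage hf)
  obtain ⟨x₀, ⟨hx₀, hf₀⟩, hleast⟩ := hcomp.exists_isLeast ⟨z, hz, hz0⟩
  have hne : ∀ y ∈ Set.Ico x₁ x₀, f y ≠ 0 := fun y hy h0 =>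
    (hleast ⟨⟨hy.1, hy.2.le.trans hx₀.2⟩, h0⟩).not_gt hy.2
  have hpos : ∀ y ∈ Set.Ico x₁ x₀, 0 < f y := by
    intro y hy
    by_contra! hy0
    obtain ⟨w, hw, hw0⟩ : (0 : ℝ) ∈ f '' Set.Icc x₁ y :=
      intermediate_value_Icc' hy.1 hf.continuousOn ⟨hy0, h₁.le⟩
    exact hne w ⟨hw.1, hw.2.trans_lt hy.2⟩ hw0
  have hmono : MonotoneOn s (Set.Ico x₁ x₀) := by
    refine monotoneOn_of_deriv_nonneg (convex_Ico _ _)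
      (fun y hy => (hs y (hne y hy)).continuousAt.continuousWithinAt)
      (fun y hy => (hs y (hne y (interior_subset hy))).differentiableAt.differentiableWithinAt)
      fun y hy => ?_
    rw [(hs y (hne y (interior_subset hy))).deriv]
    exact hs' y
  -- Up to x₀ one has s ≥ s(x₁), so f dominates the exponential with constant rate s(x₁): the
  -- quotient g is nondecreasing and positive at x₁, which contradicts g(x₀) = 0.
  set g : ℝ → ℝ := fun y => f y * Real.exp (-(s x₁ * y)) with hg
  have hgd : ∀ y ∈ Set.Ico x₁ x₀,
      HasDerivAt g ((s y - s x₁) * (f y * Real.exp (-(s x₁ * y)))) y := by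
    intro y hy
    have h1 : HasDerivAt (fun y : ℝ => -(s x₁ * y)) (-(s x₁)) y := by
      simpa using ((hasDerivAt_id y).const_mul (s x₁)).fun_neg
    refine ((hfs y (hne y hy)).mul h1.exp).congr_deriv ?_
    ring
  have hgm : MonotoneOn g (Set.Icc x₁ x₀) := by
    refine monotoneOn_of_deriv_nonneg (convex_Icc _ _)
      (Continuous.continuousOn (by fun_prop)) ?_ ?_
    · intro y hy
      rw [interior_Icc] at hy
      exact (hgd y (Set.Ioo_subset_Ico_self hy)).differentiableAt.differentiableWithinAt
    · intro y hy
      rw [interior_Icc] at hy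
      have hy' := Set.Ioo_subset_Ico_self hy
      rw [(hgd y hy').deriv]
      have h2 := hmono ⟨le_rfl, hy.1.trans hy.2⟩ hy' hy.1.le
      exact mul_nonneg (sub_nonneg.2 h2) (mul_nonneg (hpos y hy').le (Real.exp_pos _).le)
  have h3 := hgm ⟨le_rfl, hx₀.1⟩ ⟨hx₀.1, le_rfl⟩ hx₀.1
  have h4 : f x₀ = 0 := hf₀
  have h5 : 0 < g x₁ := mul_pos h₁ (Real.exp_pos _)
  simp only [hg, h4, zero_mul] at h3 h5
  linarith

theorem pos_of_monotone_logDeriv {f s s' : ℝ → ℝ} (hf : Continuous f)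
    (hfs : ∀ x, f x ≠ 0 → HasDerivAt f (s x * f x) x)
    (hs : ∀ x, f x ≠ 0 → HasDerivAt s (s' x) x) (hs' : ∀ x, 0 ≤ s' x)
    {x₁ : ℝ} (h₁ : 0 < f x₁) (x : ℝ) : 0 < f x := by
  rcases le_total x₁ x with hx | hx
  · exact pos_right_of_monotone_logDeriv hf hfs hs hs' hx h₁
  -- Reflection x ↦ -x preserves the hypotheses: s changes its sign and s' does not.
  · have h := pos_right_of_monotone_logDeriv (f := fun y => f (-y)) (s := fun y => -s (-y))
      (s' := fun y => s' (-y)) (x₁ := -x₁) (x := -x) (by fun_prop)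
      (fun y hy => by
        refine ((hfs (-y) hy).comp y (hasDerivAt_neg y)).congr_deriv ?_
        ring)
      (fun y hy => by
        refine ((hs (-y) hy).comp y (hasDerivAt_neg y)).neg.congr_deriv ?_
        ring)
      (fun y => hs' _) (neg_le_neg hx) (by simpa using h₁)
    simpa using h

end LogConvex

/-! ### Nonvanishing of the tau function; the Sasa-Satsuma equation and its bilinear form -/

section Flow

open Matrix

variable {n : Type*} [Fintype n] [DecidableEq n] {p α : n → ℂ} {σ : Equiv.Perm n} {t x : ℝ}

theorem conj_det_flowTau (hσ : ∀ i, σ (σ i) = i) (hpσ : ∀ i, p (σ i) = conj (p i)) :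
    conj (flowTau p α σ t x).det = (flowTau p α σ t x).det := by
  have h : ((flowTau p α σ t x).map conj).det = conj (flowTau p α σ t x).det :=
    (RingHom.map_det _ _).symm
  rw [← h, map_conj_flowTau hσ hpσ, Matrix.det_submatrix_equiv_self]

theorem continuous_det_flowTau : Continuous fun y => (flowTau p α σ t y).det := by
  refine Continuous.matrix_det ?_
  refine continuous_const.add (Continuous.matrix_mul ?_ continuous_const)
  refine continuous_matrix fun i j => ?_
  have h (z A : ℂ) : Continuous fun y : ℝ => hirotaExp z A t y :=
    continuous_iff_continuousAt.2 fun y => (hasDerivAt_hirotaExp_x z A t y).continuousAt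
  have h1 := fun i => h (p i) (α i)
  have h2 := fun i => Complex.continuous_conj.comp (h1 i)
  simp only [gramMatrix, Matrix.of_apply, conjExpVec, expVec, Complex.conj_conj]
  exact ((continuous_const.mul (((h1 i).mul (h2 j)).add ((h2 _).mul (h1 _))))).div_const _

/-- The tau function is positive as soon as it is positive somewhere on each line `t = const`. -/
theorem det_flowTau_ne_zero (hσ : ∀ i, σ (σ i) = i) (hpσ : ∀ i, p (σ i) = conj (p i))
    (hp : ∀ i j, p i + conj (p j) ≠ 0) {t x₁ : ℝ} (h₁ : 0 < (flowTau p α σ t x₁).det.re) (x : ℝ) :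
    (flowTau p α σ t x).det ≠ 0 := by
  have him : ∀ y, (flowTau p α σ t y).det.im = 0 := fun y =>
    Complex.conj_eq_iff_im.1 (conj_det_flowTau hσ hpσ)
  have hne : ∀ y, (flowTau p α σ t y).det.re ≠ 0 → (flowTau p α σ t y).det ≠ 0 := by
    intro y hy h
    rw [h] at hy
    exact hy rfl
  have hre : ∀ {f : ℝ → ℂ} {f' : ℂ} {y : ℝ}, HasDerivAt f f' y →
      HasDerivAt (fun y => (f y).re) f'.re y := fun h =>
    Complex.reCLM.hasFDerivAt.comp_hasDerivAt _ h
  -- Here s is s₀ and s' is 4|m₀|², so the tau function is log-convex in x wherever it is nonzero.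
  have key := pos_of_monotone_logDeriv (f := fun y => (flowTau p α σ t y).det.re)
    (s := fun y => (gramMoment p α σ 0 t y).re)
    (s' := fun y => 4 * Complex.normSq (moment p α σ 0 t y))
    (Complex.continuous_re.comp continuous_det_flowTau)
    (fun y hy => by
      refine (hre (hasDerivAt_det_flowTau hpσ hp (hne y hy))).congr_deriv ?_
      rw [Complex.mul_re, him y]; ring)
    (fun y hy => by
      refine (hre (hasDerivAt_gramMoment hσ hpσ hp (hne y hy) 0)).congr_deriv ?_
      rw [mul_comm (conj _), Complex.mul_conj, ← two_mul, ← mul_assoc]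
      norm_num [Complex.mul_re])
    (fun y => by positivity [Complex.normSq_nonneg (moment p α σ 0 t y)]) h₁ x
  exact hne x key.ne'

theorem hasDerivAt_conj_moment (hσ : ∀ i, σ (σ i) = i) (hpσ : ∀ i, p (σ i) = conj (p i))
    (hp : ∀ i j, p i + conj (p j) ≠ 0) (hdet : (flowTau p α σ t x).det ≠ 0) (j : ℕ) :
    HasDerivAt (fun y => conj (moment p α σ j t y))
      (conj (moment p α σ (j + 1) t x)
        - gramMoment p α σ j t x * conj (moment p α σ 0 t x)) x := by
  have h := hasDerivAt_conj (hasDerivAt_moment hpσ hp hdet j)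
  rwa [map_sub, map_mul, conj_gramMoment hσ hpσ] at h

/-- Existence suffices, without a formula: in D_t(Fu, F) = F²u_t the derivative of F cancels. -/
theorem differentiableAt_det_flowTau_t :
    DifferentiableAt ℝ (fun r => (flowTau p α σ r x).det) t := by
  have h : ∀ i j, DifferentiableAt ℝ (fun r => flowTau p α σ r x i j) t := by
    intro i j
    have h1 (i : n) : DifferentiableAt ℝ (fun r => expVec p α r x i) t :=
      (hasDerivAt_hirotaExp_t (p i) (α i) t x).differentiableAt
    have h2 (i : n) : DifferentiableAt ℝ (fun r => conj (expVec p α r x i)) t :=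
      (hasDerivAt_conj (hasDerivAt_hirotaExp_t (p i) (α i) t x)).differentiableAt
    have h3 (i j : n) : DifferentiableAt ℝ
        (fun r => gramMatrix p (expVec p α r x) (conjExpVec p α σ r x) i j) t := by
      simp only [gramMatrix, Matrix.of_apply, conjExpVec, Complex.conj_conj, div_eq_mul_inv]
      exact ((((h1 i).mul (h2 j)).add ((h2 _).mul (h1 _))).const_mul _).mul_const _
    simp only [flowTau, tauMatrix, Matrix.add_apply, Matrix.mul_apply]
    exact (DifferentiableAt.fun_sum fun k _ => (h3 i k).mul_const _).const_add _
  simp only [Matrix.det_apply]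
  refine DifferentiableAt.fun_sum fun τ _ => ?_
  simp only [Units.smul_def, zsmul_eq_mul]
  exact (DifferentiableAt.fun_finsetProd fun i _ => h _ _).const_mul _

theorem iteratedDeriv_two_eq {f f₁ f₂ : ℝ → ℂ} (h₁ : ∀ x, HasDerivAt f (f₁ x) x)
    (h₂ : ∀ x, HasDerivAt f₁ (f₂ x) x) : iteratedDeriv 2 f = f₂ := by
  have e₁ : deriv f = f₁ := funext fun x => (h₁ x).deriv
  have e₂ : deriv f₁ = f₂ := funext fun x => (h₂ x).deriv
  rw [iteratedDeriv_succ, iteratedDeriv_one, e₁, e₂]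

theorem iteratedDeriv_three_eq {f f₁ f₂ f₃ : ℝ → ℂ} (h₁ : ∀ x, HasDerivAt f (f₁ x) x)
    (h₂ : ∀ x, HasDerivAt f₁ (f₂ x) x) (h₃ : ∀ x, HasDerivAt f₂ (f₃ x) x) :
    iteratedDeriv 3 f = f₃ := by
  have e₃ : deriv f₂ = f₃ := funext fun x => (h₃ x).deriv
  rw [iteratedDeriv_succ, iteratedDeriv_two_eq h₁ h₂, e₃]

/-- This is the second x-derivative of u = m₀, since u_x = m₁ - s₀m₀. -/
theorem hasDerivAt_moment_sub (hσ : ∀ i, σ (σ i) = i) (hpσ : ∀ i, p (σ i) = conj (p i))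
    (hp : ∀ i j, p i + conj (p j) ≠ 0) (hdet : ∀ t x, (flowTau p α σ t x).det ≠ 0) (t x : ℝ) :
    HasDerivAt (fun y => moment p α σ 1 t y - gramMoment p α σ 0 t y * moment p α σ 0 t y)
      (moment p α σ 2 t x - gramMoment p α σ 1 t x * moment p α σ 0 t x
        - 4 * moment p α σ 0 t x ^ 2 * conj (moment p α σ 0 t x)
        - gramMoment p α σ 0 t x
          * (moment p α σ 1 t x - gramMoment p α σ 0 t x * moment p α σ 0 t x)) x := by
  refine ((hasDerivAt_moment hpσ hp (hdet t x) 1).sub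
    ((hasDerivAt_gramMoment hσ hpσ hp (hdet t x) 0).mul
      (hasDerivAt_moment hpσ hp (hdet t x) 0))).congr_deriv ?_
  ring

/-- Once u_t, ū_x and the three x-derivatives of u are polynomials in m₀, …, m₃, s₀, s₁, s₂ and the
conjugates of m₀, m₁, the equation holds identically in these variables. -/
theorem moment_sasaSatsuma (hσ : ∀ i, σ (σ i) = i) (hpσ : ∀ i, p (σ i) = conj (p i))
    (hp : ∀ i j, p i + conj (p j) ≠ 0) (hdet : ∀ t x, (flowTau p α σ t x).det ≠ 0) (t x : ℝ) :
    deriv (fun r => moment p α σ 0 r x) t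
      + 6 * (moment p α σ 0 t x * deriv (fun y => conj (moment p α σ 0 t y)) x
          + 3 * deriv (fun y => moment p α σ 0 t y) x * conj (moment p α σ 0 t x))
        * moment p α σ 0 t x
      + iteratedDeriv 3 (fun y => moment p α σ 0 t y) x = 0 := by
  have hm := fun (j : ℕ) (y : ℝ) => hasDerivAt_moment hpσ hp (hdet t y) j
  have hc := fun (j : ℕ) (y : ℝ) => hasDerivAt_conj_moment hσ hpσ hp (hdet t y) j
  have hs := fun (j : ℕ) (y : ℝ) => hasDerivAt_gramMoment hσ hpσ hp (hdet t y) j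
  have h₃ := fun y : ℝ =>
    (((hm 2 y).sub ((hs 1 y).mul (hm 0 y))).sub
      ((((hm 0 y).pow 2).const_mul 4).mul (hc 0 y))).sub
      ((hs 0 y).mul (hasDerivAt_moment_sub hσ hpσ hp hdet t y))
  rw [(hasDerivAt_moment_t hσ hpσ hp (hdet t x) rfl rfl rfl).deriv, (hc 0 x).deriv,
    (hm 0 x).deriv, iteratedDeriv_three_eq (hm 0) (hasDerivAt_moment_sub hσ hpσ hp hdet t) h₃]
  simp only [Pi.pow_apply]
  push_cast
  ring

/-- With G = Fu one has F_x = s₀F and G_x = Fm₁. The second equation is then (log F)'' = 4|u|², and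
the third one dictates the choice of H. -/
theorem moment_bilinear (hσ : ∀ i, σ (σ i) = i) (hpσ : ∀ i, p (σ i) = conj (p i))
    (hp : ∀ i j, p i + conj (p j) ≠ 0) (hdet : ∀ t x, (flowTau p α σ t x).det ≠ 0) :
    IsSasaSatsumaBilinear (fun t x => (flowTau p α σ t x).det * moment p α σ 0 t x)
      (fun t x => (flowTau p α σ t x).det)
      (fun t x => 6 * (flowTau p α σ t x).det
        * (conj (moment p α σ 0 t x) * moment p α σ 1 t x
          - moment p α σ 0 t x * conj (moment p α σ 1 t x))) := by
  intro t x
  have hm := fun (j : ℕ) (y : ℝ) => hasDerivAt_moment hpσ hp (hdet t y) j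
  have hc := fun (j : ℕ) (y : ℝ) => hasDerivAt_conj_moment hσ hpσ hp (hdet t y) j
  have hs := fun (j : ℕ) (y : ℝ) => hasDerivAt_gramMoment hσ hpσ hp (hdet t y) j
  have hF := fun y : ℝ => hasDerivAt_det_flowTau hpσ hp (hdet t y)
  have hF₂ : ∀ y, HasDerivAt (fun y => gramMoment p α σ 0 t y * (flowTau p α σ t y).det)
      ((4 * (moment p α σ 0 t y * conj (moment p α σ 0 t y)) + gramMoment p α σ 0 t y ^ 2)
        * (flowTau p α σ t y).det) y := fun y => by
    refine ((hs 0 y).mul (hF y)).congr_deriv ?_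
    ring
  have hF₃ := fun y : ℝ =>
    ((((hm 0 y).mul (hc 0 y)).const_mul 4).add ((hs 0 y).pow 2)).mul (hF y)
  have hG₁ : ∀ y, HasDerivAt (fun y => (flowTau p α σ t y).det * moment p α σ 0 t y)
      ((flowTau p α σ t y).det * moment p α σ 1 t y) y := fun y => by
    -- The terms with s₀m₀ cancel, which makes G_x as simple as G.
    refine ((hF y).mul (hm 0 y)).congr_deriv ?_
    ring
  have hG₂ : ∀ y, HasDerivAt (fun y => (flowTau p α σ t y).det * moment p α σ 1 t y)
      ((flowTau p α σ t y).det * (moment p α σ 2 t y - gramMoment p α σ 1 t y * moment p α σ 0 t y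
        + gramMoment p α σ 0 t y * moment p α σ 1 t y)) y := fun y => by
    refine ((hF y).mul (hm 1 y)).congr_deriv ?_
    ring
  have hG₃ := fun y : ℝ => (hF y).mul
    (((hm 2 y).sub ((hs 1 y).mul (hm 0 y))).add ((hs 0 y).mul (hm 1 y)))
  have hGc : HasDerivAt (fun y => conj ((flowTau p α σ t y).det * moment p α σ 0 t y))
      ((flowTau p α σ t x).det * conj (moment p α σ 1 t x)) x := by
    refine (hasDerivAt_conj (hG₁ x)).congr_deriv ?_
    rw [map_mul, conj_det_flowTau hσ hpσ]
  have hFt := (differentiableAt_det_flowTau_t (p := p) (α := α) (σ := σ) (t := t)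
    (x := x)).hasDerivAt
  have hGt := hFt.fun_mul (hasDerivAt_moment_t hσ hpσ hp (hdet t x) rfl rfl rfl)
  refine ⟨?_, ?_, ?_⟩
  · simp only [hirotaD, hirotaD3]
    rw [hGt.deriv, (hF x).deriv, (hG₁ x).deriv, iteratedDeriv_two_eq hG₁ hG₂,
      iteratedDeriv_two_eq hF hF₂, iteratedDeriv_three_eq hF hF₂ hF₃,
      iteratedDeriv_three_eq hG₁ hG₂ hG₃]
    simp only [Pi.pow_apply, Pi.mul_apply, Pi.sub_apply, Pi.add_apply]
    push_cast
    ring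
  · simp only [hirotaD2]
    rw [(hF x).deriv, iteratedDeriv_two_eq hF hF₂, map_mul, conj_det_flowTau hσ hpσ]
    ring
  · simp only [hirotaD]
    rw [hGc.deriv, (hG₁ x).deriv, map_mul, conj_det_flowTau hσ hpσ]
    ring

end Flow

/-! ### Cauchy-Binet expansion of the 4 × 4 determinants -/

section DeterminantExpansion

variable {R : Type*} [CommRing R]

/-- The determinant of a `3 × 3` matrix given by its rows. -/
def det₃ (a₁ a₂ a₃ b₁ b₂ b₃ c₁ c₂ c₃ : R) : R :=
  a₁ * (b₂ * c₃ - b₃ * c₂) - a₂ * (b₁ * c₃ - b₃ * c₁) + a₃ * (b₁ * c₂ - b₂ * c₁)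

/-- The determinant of a `4 × 4` matrix given by its rows. -/
def det₄ (a₁ a₂ a₃ a₄ b₁ b₂ b₃ b₄ c₁ c₂ c₃ c₄ d₁ d₂ d₃ d₄ : R) : R :=
  a₁ * det₃ b₂ b₃ b₄ c₂ c₃ c₄ d₂ d₃ d₄ - a₂ * det₃ b₁ b₃ b₄ c₁ c₃ c₄ d₁ d₃ d₄
    + a₃ * det₃ b₁ b₂ b₄ c₁ c₂ c₄ d₁ d₂ d₄ - a₄ * det₃ b₁ b₂ b₃ c₁ c₂ c₃ d₁ d₂ d₃

theorem det_eq_det₄ (M : Matrix (Fin 4) (Fin 4) R) :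
    M.det = det₄ (M 0 0) (M 0 1) (M 0 2) (M 0 3) (M 1 0) (M 1 1) (M 1 2) (M 1 3)
      (M 2 0) (M 2 1) (M 2 2) (M 2 3) (M 3 0) (M 3 1) (M 3 2) (M 3 3) := by
  simp [Matrix.det_succ_row_zero, Fin.sum_univ_succ, Fin.succAbove, det₄, det₃]
  ring

theorem det₄_laplace (a₁ a₂ a₃ a₄ b₁ b₂ b₃ b₄ c₁ c₂ c₃ c₄ d₁ d₂ d₃ d₄ : R) :
    det₄ a₁ a₂ a₃ a₄ b₁ b₂ b₃ b₄ c₁ c₂ c₃ c₄ d₁ d₂ d₃ d₄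
      = (a₁ * b₂ - a₂ * b₁) * (c₃ * d₄ - c₄ * d₃) - (a₁ * b₃ - a₃ * b₁) * (c₂ * d₄ - c₄ * d₂)
        + (a₁ * b₄ - a₄ * b₁) * (c₂ * d₃ - c₃ * d₂) + (a₂ * b₃ - a₃ * b₂) * (c₁ * d₄ - c₄ * d₁)
        - (a₂ * b₄ - a₄ * b₂) * (c₁ * d₃ - c₃ * d₁)
        + (a₃ * b₄ - a₄ * b₃) * (c₁ * d₂ - c₂ * d₁) := by
  simp only [det₄, det₃]
  ring

/-- The minors of two rows which are linear combinations of two rows. -/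
theorem minor_combination (c₀₀ c₀₁ c₁₀ c₁₁ x y x' y' m n m' n' : R) :
    (m + (c₀₀ * x + c₀₁ * y)) * (n' + (c₁₀ * x' + c₁₁ * y'))
      - (n + (c₀₀ * x' + c₀₁ * y')) * (m' + (c₁₀ * x + c₁₁ * y))
      = m * n' - n * m' + (m * (c₁₀ * x' + c₁₁ * y') - n * (c₁₀ * x + c₁₁ * y))
        + (n' * (c₀₀ * x + c₀₁ * y) - m' * (c₀₀ * x' + c₀₁ * y'))
        + (c₀₀ * c₁₁ - c₀₁ * c₁₀) * (x * y' - x' * y) := by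
  ring

variable (E₁ E₂ e₁ e₂ p₁₁ p₁₂ p₂₁ p₂₂ s₁₁ s₁₂ s₂₂ t₁₁ t₁₂ t₂₂ : R)

/-- The block diagonal Gram matrix of two exponentials and their conjugates. -/
def blockGram : Matrix (Fin 4) (Fin 4) R :=
  !![2 * (E₁ * e₁) * p₁₁, 2 * (E₁ * e₂) * p₁₂, 0, 0;
    2 * (E₂ * e₁) * p₂₁, 2 * (E₂ * e₂) * p₂₂, 0, 0;
    0, 0, 2 * (e₁ * E₁) * p₁₁, 2 * (e₁ * E₂) * p₂₁;
    0, 0, 2 * (e₂ * E₁) * p₁₂, 2 * (e₂ * E₂) * p₂₂]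

/-- A matrix with the symmetries of the Cauchy matrix of two wave numbers and their
conjugates. -/
def blockCauchy : Matrix (Fin 4) (Fin 4) R :=
  !![p₁₁, p₂₁, t₁₁, t₁₂; p₁₂, p₂₂, t₁₂, t₂₂; s₁₁, s₁₂, p₁₁, p₁₂; s₁₂, s₂₂, p₂₁, p₂₂]

/-- The Cauchy-Binet expansion of the tau function. -/
def tauExpansion : R :=
  1 + 4 * p₁₁ ^ 2 * (E₁ * e₁) + 4 * p₂₂ ^ 2 * (E₂ * e₂)
  + 4 * p₁₂ ^ 2 * (E₁ * e₂) + 4 * p₂₁ ^ 2 * (E₂ * e₁)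
  + 4 * p₁₁ ^ 2 * (p₁₁ ^ 2 - s₁₁ * t₁₁) * (E₁ ^ 2 * e₁ ^ 2)
  + 4 * p₂₂ ^ 2 * (p₂₂ ^ 2 - s₂₂ * t₂₂) * (E₂ ^ 2 * e₂ ^ 2)
  + 4 * p₁₂ ^ 2 * (p₁₂ ^ 2 - s₁₁ * t₂₂) * (E₁ ^ 2 * e₂ ^ 2)
  + 4 * p₂₁ ^ 2 * (p₂₁ ^ 2 - s₂₂ * t₁₁) * (E₂ ^ 2 * e₁ ^ 2)
  + 8 * (p₁₁ * p₁₂) * (p₁₁ * p₁₂ - s₁₁ * t₁₂) * (E₁ ^ 2 * e₁ * e₂)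
  + 8 * (p₂₁ * p₂₂) * (p₂₁ * p₂₂ - s₂₂ * t₁₂) * (E₂ ^ 2 * e₁ * e₂)
  + 8 * (p₁₁ * p₂₁) * (p₁₁ * p₂₁ - s₁₂ * t₁₁) * (E₁ * E₂ * e₁ ^ 2)
  + 8 * (p₁₂ * p₂₂) * (p₁₂ * p₂₂ - s₁₂ * t₂₂) * (E₁ * E₂ * e₂ ^ 2)
  + 8 * ((p₁₁ * p₂₂ - p₁₂ * p₂₁) ^ 2 + p₁₁ * p₂₂ * (p₁₁ * p₂₂ - s₁₂ * t₁₂)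
      + p₁₂ * p₂₁ * (p₁₂ * p₂₁ - s₁₂ * t₁₂)) * (E₁ * e₁ * E₂ * e₂)
  + 16 * (p₁₁ * p₂₂ - p₁₂ * p₂₁) * p₁₁ * det₃ p₁₁ p₂₁ t₁₁ p₁₂ p₂₂ t₁₂ s₁₁ s₁₂ p₁₁
      * (E₁ ^ 2 * E₂ * e₁ ^ 2 * e₂)
  + 16 * (p₁₁ * p₂₂ - p₁₂ * p₂₁) * p₂₂ * det₃ p₁₁ p₂₁ t₁₂ p₁₂ p₂₂ t₂₂ s₁₂ s₂₂ p₂₂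
      * (E₁ * E₂ ^ 2 * e₁ * e₂ ^ 2)
  + 16 * (p₁₁ * p₂₂ - p₁₂ * p₂₁) * p₁₂ * det₃ p₁₁ p₂₁ t₁₂ p₁₂ p₂₂ t₂₂ s₁₁ s₁₂ p₁₂
      * (E₁ ^ 2 * E₂ * e₁ * e₂ ^ 2)
  + 16 * (p₁₁ * p₂₂ - p₁₂ * p₂₁) * p₂₁ * det₃ p₁₁ p₂₁ t₁₁ p₁₂ p₂₂ t₁₂ s₁₂ s₂₂ p₂₁
      * (E₁ * E₂ ^ 2 * e₁ ^ 2 * e₂)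
  + 16 * (p₁₁ * p₂₂ - p₁₂ * p₂₁) ^ 2
      * det₄ p₁₁ p₂₁ t₁₁ t₁₂ p₁₂ p₂₂ t₁₂ t₂₂ s₁₁ s₁₂ p₁₁ p₁₂ s₁₂ s₂₂ p₂₁ p₂₂
      * (E₁ ^ 2 * E₂ ^ 2 * e₁ ^ 2 * e₂ ^ 2)

/-- Laplace expansion along the first two rows. The Gram matrix is block diagonal, so rows 1, 2 and
rows 3, 4 of 1 + CB are each a unit row plus a combination of only two rows of the Cauchy matrix,
and their 2 × 2 minors are linear in the 2 × 2 minors of that matrix. -/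
theorem det₄_eq_tauExpansion :
    det₄
        (1 + (2 * (E₁ * e₁) * p₁₁ * p₁₁ + 2 * (E₁ * e₂) * p₁₂ * p₁₂))
        (0 + (2 * (E₁ * e₁) * p₁₁ * p₂₁ + 2 * (E₁ * e₂) * p₁₂ * p₂₂))
        (0 + (2 * (E₁ * e₁) * p₁₁ * t₁₁ + 2 * (E₁ * e₂) * p₁₂ * t₁₂))
        (0 + (2 * (E₁ * e₁) * p₁₁ * t₁₂ + 2 * (E₁ * e₂) * p₁₂ * t₂₂))
        (0 + (2 * (E₂ * e₁) * p₂₁ * p₁₁ + 2 * (E₂ * e₂) * p₂₂ * p₁₂))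
        (1 + (2 * (E₂ * e₁) * p₂₁ * p₂₁ + 2 * (E₂ * e₂) * p₂₂ * p₂₂))
        (0 + (2 * (E₂ * e₁) * p₂₁ * t₁₁ + 2 * (E₂ * e₂) * p₂₂ * t₁₂))
        (0 + (2 * (E₂ * e₁) * p₂₁ * t₁₂ + 2 * (E₂ * e₂) * p₂₂ * t₂₂))
        (0 + (2 * (e₁ * E₁) * p₁₁ * s₁₁ + 2 * (e₁ * E₂) * p₂₁ * s₁₂))
        (0 + (2 * (e₁ * E₁) * p₁₁ * s₁₂ + 2 * (e₁ * E₂) * p₂₁ * s₂₂))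
        (1 + (2 * (e₁ * E₁) * p₁₁ * p₁₁ + 2 * (e₁ * E₂) * p₂₁ * p₂₁))
        (0 + (2 * (e₁ * E₁) * p₁₁ * p₁₂ + 2 * (e₁ * E₂) * p₂₁ * p₂₂))
        (0 + (2 * (e₂ * E₁) * p₁₂ * s₁₁ + 2 * (e₂ * E₂) * p₂₂ * s₁₂))
        (0 + (2 * (e₂ * E₁) * p₁₂ * s₁₂ + 2 * (e₂ * E₂) * p₂₂ * s₂₂))
        (0 + (2 * (e₂ * E₁) * p₁₂ * p₁₁ + 2 * (e₂ * E₂) * p₂₂ * p₂₁))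
        (1 + (2 * (e₂ * E₁) * p₁₂ * p₁₂ + 2 * (e₂ * E₂) * p₂₂ * p₂₂))
      = tauExpansion E₁ E₂ e₁ e₂ p₁₁ p₁₂ p₂₁ p₂₂ s₁₁ s₁₂ s₂₂ t₁₁ t₁₂ t₂₂ := by
  -- The 2 × 2 minors become atoms, so that the final polynomial identity remains small.
  obtain ⟨D, hD⟩ : ∃ D, D = p₁₁ * p₂₂ - p₁₂ * p₂₁ := ⟨_, rfl⟩
  obtain ⟨b₀₂, hb₀₂⟩ : ∃ b, b = p₁₁ * t₁₂ - t₁₁ * p₁₂ := ⟨_, rfl⟩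
  obtain ⟨b₀₃, hb₀₃⟩ : ∃ b, b = p₁₁ * t₂₂ - t₁₂ * p₁₂ := ⟨_, rfl⟩
  obtain ⟨b₁₂, hb₁₂⟩ : ∃ b, b = p₂₁ * t₁₂ - t₁₁ * p₂₂ := ⟨_, rfl⟩
  obtain ⟨b₁₃, hb₁₃⟩ : ∃ b, b = p₂₁ * t₂₂ - t₁₂ * p₂₂ := ⟨_, rfl⟩
  obtain ⟨b₂₃, hb₂₃⟩ : ∃ b, b = t₁₁ * t₂₂ - t₁₂ * t₁₂ := ⟨_, rfl⟩
  obtain ⟨c₀₁, hc₀₁⟩ : ∃ c, c = s₁₁ * s₂₂ - s₁₂ * s₁₂ := ⟨_, rfl⟩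
  obtain ⟨c₀₂, hc₀₂⟩ : ∃ c, c = s₁₁ * p₂₁ - p₁₁ * s₁₂ := ⟨_, rfl⟩
  obtain ⟨c₀₃, hc₀₃⟩ : ∃ c, c = s₁₁ * p₂₂ - p₁₂ * s₁₂ := ⟨_, rfl⟩
  obtain ⟨c₁₂, hc₁₂⟩ : ∃ c, c = s₁₂ * p₂₁ - p₁₁ * s₂₂ := ⟨_, rfl⟩
  obtain ⟨c₁₃, hc₁₃⟩ : ∃ c, c = s₁₂ * p₂₂ - p₁₂ * s₂₂ := ⟨_, rfl⟩
  have hD' : p₁₁ * p₂₂ - p₂₁ * p₁₂ = D := by rw [hD]; ring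
  have hP : 2 * (E₁ * e₁) * p₁₁ * (2 * (E₂ * e₂) * p₂₂) - 2 * (E₁ * e₂) * p₁₂ * (2 * (E₂ * e₁) * p₂₁)
      = 4 * (E₁ * E₂ * e₁ * e₂) * D := by rw [hD]; ring
  have hQ : 2 * (e₁ * E₁) * p₁₁ * (2 * (e₂ * E₂) * p₂₂) - 2 * (e₁ * E₂) * p₂₁ * (2 * (e₂ * E₁) * p₁₂)
      = 4 * (E₁ * E₂ * e₁ * e₂) * D := by rw [hD]; ring
  -- Each 3 × 3 minor is needed in two forms, expanded along its last row and along its last column.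
  obtain ⟨q₁₁, hq₁₁⟩ : ∃ q, q = det₃ p₁₁ p₂₁ t₁₁ p₁₂ p₂₂ t₁₂ s₁₁ s₁₂ p₁₁ := ⟨_, rfl⟩
  have hq₁₁a : q₁₁ = s₁₁ * b₁₂ - s₁₂ * b₀₂ + p₁₁ * D := by
    rw [hq₁₁, hD, hb₀₂, hb₁₂]; simp only [det₃]; ring
  have hq₁₁b : q₁₁ = p₁₁ * D - t₁₁ * c₀₃ + t₁₂ * c₀₂ := by
    rw [hq₁₁, hD, hc₀₂, hc₀₃]; simp only [det₃]; ring
  obtain ⟨q₁₂, hq₁₂⟩ : ∃ q, q = det₃ p₁₁ p₂₁ t₁₂ p₁₂ p₂₂ t₂₂ s₁₁ s₁₂ p₁₂ := ⟨_, rfl⟩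
  have hq₁₂a : q₁₂ = s₁₁ * b₁₃ - s₁₂ * b₀₃ + p₁₂ * D := by
    rw [hq₁₂, hD, hb₀₃, hb₁₃]; simp only [det₃]; ring
  have hq₁₂b : q₁₂ = p₁₂ * D - t₁₂ * c₀₃ + t₂₂ * c₀₂ := by
    rw [hq₁₂, hD, hc₀₂, hc₀₃]; simp only [det₃]; ring
  obtain ⟨q₂₁, hq₂₁⟩ : ∃ q, q = det₃ p₁₁ p₂₁ t₁₁ p₁₂ p₂₂ t₁₂ s₁₂ s₂₂ p₂₁ := ⟨_, rfl⟩
  have hq₂₁a : q₂₁ = s₁₂ * b₁₂ - s₂₂ * b₀₂ + p₂₁ * D := by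
    rw [hq₂₁, hD, hb₀₂, hb₁₂]; simp only [det₃]; ring
  have hq₂₁b : q₂₁ = p₂₁ * D - t₁₁ * c₁₃ + t₁₂ * c₁₂ := by
    rw [hq₂₁, hD, hc₁₂, hc₁₃]; simp only [det₃]; ring
  obtain ⟨q₂₂, hq₂₂⟩ : ∃ q, q = det₃ p₁₁ p₂₁ t₁₂ p₁₂ p₂₂ t₂₂ s₁₂ s₂₂ p₂₂ := ⟨_, rfl⟩
  have hq₂₂a : q₂₂ = s₁₂ * b₁₃ - s₂₂ * b₀₃ + p₂₂ * D := by
    rw [hq₂₂, hD, hb₀₃, hb₁₃]; simp only [det₃]; ring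
  have hq₂₂b : q₂₂ = p₂₂ * D - t₁₂ * c₁₃ + t₂₂ * c₁₂ := by
    rw [hq₂₂, hD, hc₁₂, hc₁₃]; simp only [det₃]; ring
  obtain ⟨q, hq⟩ : ∃ q, q = det₄ p₁₁ p₂₁ t₁₁ t₁₂ p₁₂ p₂₂ t₁₂ t₂₂ s₁₁ s₁₂ p₁₁ p₁₂ s₁₂ s₂₂ p₂₁ p₂₂ :=
    ⟨_, rfl⟩
  have hqa : q = D * D - b₀₂ * c₁₃ + b₀₃ * c₁₂ + b₁₂ * c₀₃ - b₁₃ * c₀₂ + b₂₃ * c₀₁ := by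
    rw [hq, det₄_laplace, hD', ← hD, ← hb₀₂, ← hb₀₃, ← hb₁₂, ← hb₁₃, ← hb₂₃, ← hc₀₁, ← hc₀₂, ← hc₀₃, ← hc₁₂, ← hc₁₃]
  rw [det₄_laplace]
  simp only [minor_combination]
  simp only [mul_zero, zero_mul, one_mul, mul_one, sub_zero, zero_sub, zero_add, add_zero]
  rw [hP, hQ]
  simp only [tauExpansion, hD', ← hD, ← hb₀₂, ← hb₀₃, ← hb₁₂, ← hb₁₃, ← hb₂₃, ← hc₀₁, ← hc₀₂, ← hc₀₃, ← hc₁₂, ← hc₁₃,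
    ← hq₁₁, ← hq₁₂, ← hq₂₁, ← hq₂₂, ← hq]
  -- A 3 × 3 minor arises once from its last-row form and once from its last-column form. Each form
  -- contributes half of the coefficient 16.
  linear_combination - 8 * D * p₁₁ * (E₁ ^ 2 * E₂ * e₁ ^ 2 * e₂) * (hq₁₁a + hq₁₁b) - 8 * D * p₁₂ * (E₁ ^ 2 * E₂ * e₁ * e₂ ^ 2) * (hq₁₂a + hq₁₂b) - 8 * D * p₂₁ * (E₁ * E₂ ^ 2 * e₁ ^ 2 * e₂) * (hq₂₁a + hq₂₁b) - 8 * D * p₂₂ * (E₁ * E₂ ^ 2 * e₁ * e₂ ^ 2) * (hq₂₂a + hq₂₂b) - 16 * D ^ 2 * (E₁ ^ 2 * E₂ ^ 2 * e₁ ^ 2 * e₂ ^ 2) * hqa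

theorem det₄_congr {a₀ a₁ a₂ a₃ b₀ b₁ b₂ b₃ c₀ c₁ c₂ c₃ d₀ d₁ d₂ d₃
      a₀' a₁' a₂' a₃' b₀' b₁' b₂' b₃' c₀' c₁' c₂' c₃' d₀' d₁' d₂' d₃' : R}
    (ha₀ : a₀ = a₀') (ha₁ : a₁ = a₁') (ha₂ : a₂ = a₂') (ha₃ : a₃ = a₃')
    (hb₀ : b₀ = b₀') (hb₁ : b₁ = b₁') (hb₂ : b₂ = b₂') (hb₃ : b₃ = b₃')
    (hc₀ : c₀ = c₀') (hc₁ : c₁ = c₁') (hc₂ : c₂ = c₂') (hc₃ : c₃ = c₃')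
    (hd₀ : d₀ = d₀') (hd₁ : d₁ = d₁') (hd₂ : d₂ = d₂') (hd₃ : d₃ = d₃') :
    det₄ a₀ a₁ a₂ a₃ b₀ b₁ b₂ b₃ c₀ c₁ c₂ c₃ d₀ d₁ d₂ d₃
      = det₄ a₀' a₁' a₂' a₃' b₀' b₁' b₂' b₃' c₀' c₁' c₂' c₃' d₀' d₁' d₂' d₃' := by
  rw [ha₀, ha₁, ha₂, ha₃, hb₀, hb₁, hb₂, hb₃, hc₀, hc₁, hc₂, hc₃, hd₀, hd₁, hd₂, hd₃]

theorem det_one_add_blockGram :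
    (1 + blockGram E₁ E₂ e₁ e₂ p₁₁ p₁₂ p₂₁ p₂₂
        * blockCauchy p₁₁ p₁₂ p₂₁ p₂₂ s₁₁ s₁₂ s₂₂ t₁₁ t₁₂ t₂₂).det
      = tauExpansion E₁ E₂ e₁ e₂ p₁₁ p₁₂ p₂₁ p₂₂ s₁₁ s₁₂ s₂₂ t₁₁ t₁₂ t₂₂ := by
  rw [det_eq_det₄, ← det₄_eq_tauExpansion]
  apply det₄_congr <;> simp [blockGram, blockCauchy]

/-- The Cauchy-Binet expansion of the numerator of the 2-soliton. -/
def numeratorExpansion : R :=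
  E₁ + E₂
  + 2 * p₁₁ * (p₁₁ - s₁₁) * (E₁ ^ 2 * e₁) + 2 * p₁₂ * (p₁₂ - s₁₁) * (E₁ ^ 2 * e₂)
  + 2 * p₂₁ * (p₂₁ - s₂₂) * (E₂ ^ 2 * e₁) + 2 * p₂₂ * (p₂₂ - s₂₂) * (E₂ ^ 2 * e₂)
  + 2 * (p₂₁ * (p₂₁ - s₁₂) + p₁₁ * (p₁₁ - s₁₂) + (p₁₁ - p₂₁) ^ 2) * (E₁ * E₂ * e₁)
  + 2 * (p₂₂ * (p₂₂ - s₁₂) + p₁₂ * (p₁₂ - s₁₂) + (p₁₂ - p₂₂) ^ 2) * (E₁ * E₂ * e₂)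
  + 4 * (p₁₁ - p₂₁) * p₂₁ * det₃ p₁₁ p₂₁ t₁₁ 1 1 1 s₁₂ s₂₂ p₂₁ * (E₁ * E₂ ^ 2 * e₁ ^ 2)
  + 4 * (p₁₂ - p₂₂) * p₂₂ * det₃ p₁₂ p₂₂ t₂₂ 1 1 1 s₁₂ s₂₂ p₂₂ * (E₁ * E₂ ^ 2 * e₂ ^ 2)
  + 4 * (p₁₁ - p₂₁) * p₁₁ * det₃ p₁₁ p₂₁ t₁₁ 1 1 1 s₁₁ s₁₂ p₁₁ * (E₁ ^ 2 * E₂ * e₁ ^ 2)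
  + 4 * (p₁₂ - p₂₂) * p₁₂ * det₃ p₁₂ p₂₂ t₂₂ 1 1 1 s₁₁ s₁₂ p₁₂ * (E₁ ^ 2 * E₂ * e₂ ^ 2)
  + 4 * ((p₁₁ * p₂₂ - p₁₂ * p₂₁) * det₃ 1 1 1 s₁₁ p₁₁ p₁₂ s₁₂ p₂₁ p₂₂
      + (p₁₁ - p₂₁) * p₁₂ * det₃ p₁₁ p₂₁ t₁₂ 1 1 1 s₁₁ s₁₂ p₁₂
      + (p₁₂ - p₂₂) * p₁₁ * det₃ p₁₂ p₂₂ t₁₂ 1 1 1 s₁₁ s₁₂ p₁₁) * (E₁ ^ 2 * E₂ * e₁ * e₂)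
  + 4 * ((p₁₁ * p₂₂ - p₁₂ * p₂₁) * det₃ 1 1 1 s₁₂ p₁₁ p₁₂ s₂₂ p₂₁ p₂₂
      + (p₁₁ - p₂₁) * p₂₂ * det₃ p₁₁ p₂₁ t₁₂ 1 1 1 s₁₂ s₂₂ p₂₂
      + (p₁₂ - p₂₂) * p₂₁ * det₃ p₁₂ p₂₂ t₁₂ 1 1 1 s₁₂ s₂₂ p₂₁) * (E₁ * E₂ ^ 2 * e₁ * e₂)
  + 8 * (p₁₁ * p₂₂ - p₁₂ * p₂₁) * (p₁₁ - p₂₁)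
      * det₄ p₁₁ p₂₁ t₁₁ t₁₂ 1 1 1 1 s₁₁ s₁₂ p₁₁ p₁₂ s₁₂ s₂₂ p₂₁ p₂₂
      * (E₁ ^ 2 * E₂ ^ 2 * e₁ ^ 2 * e₂)
  + 8 * (p₁₁ * p₂₂ - p₁₂ * p₂₁) * (p₁₂ - p₂₂)
      * det₄ p₁₂ p₂₂ t₁₂ t₂₂ 1 1 1 1 s₁₁ s₁₂ p₁₁ p₁₂ s₁₂ s₂₂ p₂₁ p₂₂
      * (E₁ ^ 2 * E₂ ^ 2 * e₁ * e₂ ^ 2)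

theorem minor_change_combination (c₀₀ c₀₁ c₁₀ c₁₁ a b x y x' y' m n m' n' : R) :
    b * ((m + (c₀₀ * x + c₀₁ * y)) - (n + (c₀₀ * x' + c₀₁ * y')))
      + a * ((n' + (c₁₀ * x' + c₁₁ * y')) - (m' + (c₁₀ * x + c₁₁ * y)))
      = b * (m - n) + a * (n' - m') + (c₀₀ * b - c₁₀ * a) * (x - x')
        + (c₀₁ * b - c₁₁ * a) * (y - y') := by
  ring

theorem det₄_add_const (a b x₀ x₁ x₂ x₃ y₀ y₁ y₂ y₃ z₀ z₁ z₂ z₃ w₀ w₁ w₂ w₃ : R) :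
    det₄ (x₀ + a) (x₁ + a) (x₂ + a) (x₃ + a) (y₀ + b) (y₁ + b) (y₂ + b) (y₃ + b)
        z₀ z₁ z₂ z₃ w₀ w₁ w₂ w₃
      = det₄ x₀ x₁ x₂ x₃ y₀ y₁ y₂ y₃ z₀ z₁ z₂ z₃ w₀ w₁ w₂ w₃
        + ((b * (x₀ - x₁) + a * (y₁ - y₀)) * (z₂ * w₃ - z₃ * w₂)
          - (b * (x₀ - x₂) + a * (y₂ - y₀)) * (z₁ * w₃ - z₃ * w₁)
          + (b * (x₀ - x₃) + a * (y₃ - y₀)) * (z₁ * w₂ - z₂ * w₁)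
          + (b * (x₁ - x₂) + a * (y₂ - y₁)) * (z₀ * w₃ - z₃ * w₀)
          - (b * (x₁ - x₃) + a * (y₃ - y₁)) * (z₀ * w₂ - z₂ * w₀)
          + (b * (x₂ - x₃) + a * (y₃ - y₂)) * (z₀ * w₁ - z₁ * w₀)) := by
  simp only [det₄_laplace]
  ring

/-- The added rank-one matrix changes only the first two rows, by constants a and b. The determinant
is affine in (a, b) because the ab terms cancel in each 2 × 2 minor. -/
theorem det_add_vecMulVec_one (M : Matrix (Fin 4) (Fin 4) R) (a b : R) :
    (M + Matrix.vecMulVec ![a, b, 0, 0] 1).det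
      = M.det
        + ((b * (M 0 0 - M 0 1) + a * (M 1 1 - M 1 0)) * (M 2 2 * M 3 3 - M 2 3 * M 3 2)
          - (b * (M 0 0 - M 0 2) + a * (M 1 2 - M 1 0)) * (M 2 1 * M 3 3 - M 2 3 * M 3 1)
          + (b * (M 0 0 - M 0 3) + a * (M 1 3 - M 1 0)) * (M 2 1 * M 3 2 - M 2 2 * M 3 1)
          + (b * (M 0 1 - M 0 2) + a * (M 1 2 - M 1 1)) * (M 2 0 * M 3 3 - M 2 3 * M 3 0)
          - (b * (M 0 1 - M 0 3) + a * (M 1 3 - M 1 1)) * (M 2 0 * M 3 2 - M 2 2 * M 3 0)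
          + (b * (M 0 2 - M 0 3) + a * (M 1 3 - M 1 2)) * (M 2 0 * M 3 1 - M 2 1 * M 3 0)) := by
  have e₀ (j : Fin 4) : (M + Matrix.vecMulVec ![a, b, 0, 0] 1 : Matrix (Fin 4) (Fin 4) R) 0 j = M 0 j + a := by
    change M 0 j + a * 1 = _
    rw [mul_one]
  have e₁ (j : Fin 4) : (M + Matrix.vecMulVec ![a, b, 0, 0] 1 : Matrix (Fin 4) (Fin 4) R) 1 j = M 1 j + b := by
    change M 1 j + b * 1 = _
    rw [mul_one]
  have e₂ (j : Fin 4) : (M + Matrix.vecMulVec ![a, b, 0, 0] 1 : Matrix (Fin 4) (Fin 4) R) 2 j = M 2 j := by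
    change M 2 j + 0 * 1 = _
    rw [zero_mul, add_zero]
  have e₃ (j : Fin 4) : (M + Matrix.vecMulVec ![a, b, 0, 0] 1 : Matrix (Fin 4) (Fin 4) R) 3 j = M 3 j := by
    change M 3 j + 0 * 1 = _
    rw [zero_mul, add_zero]
  rw [det_eq_det₄, det_eq_det₄ M]
  simp only [e₀, e₁, e₂, e₃]
  exact det₄_add_const _ _ _ _ _ _ _ _ _ _ _ _ _ _ _ _ _ _

theorem laplace_eq_numeratorExpansion :
    (E₂ * ((1 + (2 * (E₁ * e₁) * p₁₁ * p₁₁ + 2 * (E₁ * e₂) * p₁₂ * p₁₂)) - (0 + (2 * (E₁ * e₁) * p₁₁ * p₂₁ + 2 * (E₁ * e₂) * p₁₂ * p₂₂))) + E₁ * ((1 + (2 * (E₂ * e₁) * p₂₁ * p₂₁ + 2 * (E₂ * e₂) * p₂₂ * p₂₂)) - (0 + (2 * (E₂ * e₁) * p₂₁ * p₁₁ + 2 * (E₂ * e₂) * p₂₂ * p₁₂))))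
        * ((1 + (2 * (e₁ * E₁) * p₁₁ * p₁₁ + 2 * (e₁ * E₂) * p₂₁ * p₂₁)) * (1 + (2 * (e₂ * E₁) * p₁₂ * p₁₂ + 2 * (e₂ * E₂) * p₂₂ * p₂₂)) - (0 + (2 * (e₁ * E₁) * p₁₁ * p₁₂ + 2 * (e₁ * E₂) * p₂₁ * p₂₂)) * (0 + (2 * (e₂ * E₁) * p₁₂ * p₁₁ + 2 * (e₂ * E₂) * p₂₂ * p₂₁)))
      - (E₂ * ((1 + (2 * (E₁ * e₁) * p₁₁ * p₁₁ + 2 * (E₁ * e₂) * p₁₂ * p₁₂)) - (0 + (2 * (E₁ * e₁) * p₁₁ * t₁₁ + 2 * (E₁ * e₂) * p₁₂ * t₁₂))) + E₁ * ((0 + (2 * (E₂ * e₁) * p₂₁ * t₁₁ + 2 * (E₂ * e₂) * p₂₂ * t₁₂)) - (0 + (2 * (E₂ * e₁) * p₂₁ * p₁₁ + 2 * (E₂ * e₂) * p₂₂ * p₁₂))))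
        * ((0 + (2 * (e₁ * E₁) * p₁₁ * s₁₂ + 2 * (e₁ * E₂) * p₂₁ * s₂₂)) * (1 + (2 * (e₂ * E₁) * p₁₂ * p₁₂ + 2 * (e₂ * E₂) * p₂₂ * p₂₂)) - (0 + (2 * (e₁ * E₁) * p₁₁ * p₁₂ + 2 * (e₁ * E₂) * p₂₁ * p₂₂)) * (0 + (2 * (e₂ * E₁) * p₁₂ * s₁₂ + 2 * (e₂ * E₂) * p₂₂ * s₂₂)))
      + (E₂ * ((1 + (2 * (E₁ * e₁) * p₁₁ * p₁₁ + 2 * (E₁ * e₂) * p₁₂ * p₁₂)) - (0 + (2 * (E₁ * e₁) * p₁₁ * t₁₂ + 2 * (E₁ * e₂) * p₁₂ * t₂₂))) + E₁ * ((0 + (2 * (E₂ * e₁) * p₂₁ * t₁₂ + 2 * (E₂ * e₂) * p₂₂ * t₂₂)) - (0 + (2 * (E₂ * e₁) * p₂₁ * p₁₁ + 2 * (E₂ * e₂) * p₂₂ * p₁₂))))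
        * ((0 + (2 * (e₁ * E₁) * p₁₁ * s₁₂ + 2 * (e₁ * E₂) * p₂₁ * s₂₂)) * (0 + (2 * (e₂ * E₁) * p₁₂ * p₁₁ + 2 * (e₂ * E₂) * p₂₂ * p₂₁)) - (1 + (2 * (e₁ * E₁) * p₁₁ * p₁₁ + 2 * (e₁ * E₂) * p₂₁ * p₂₁)) * (0 + (2 * (e₂ * E₁) * p₁₂ * s₁₂ + 2 * (e₂ * E₂) * p₂₂ * s₂₂)))
      + (E₂ * ((0 + (2 * (E₁ * e₁) * p₁₁ * p₂₁ + 2 * (E₁ * e₂) * p₁₂ * p₂₂)) - (0 + (2 * (E₁ * e₁) * p₁₁ * t₁₁ + 2 * (E₁ * e₂) * p₁₂ * t₁₂))) + E₁ * ((0 + (2 * (E₂ * e₁) * p₂₁ * t₁₁ + 2 * (E₂ * e₂) * p₂₂ * t₁₂)) - (1 + (2 * (E₂ * e₁) * p₂₁ * p₂₁ + 2 * (E₂ * e₂) * p₂₂ * p₂₂))))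
        * ((0 + (2 * (e₁ * E₁) * p₁₁ * s₁₁ + 2 * (e₁ * E₂) * p₂₁ * s₁₂)) * (1 + (2 * (e₂ * E₁) * p₁₂ * p₁₂ + 2 * (e₂ * E₂) * p₂₂ * p₂₂)) - (0 + (2 * (e₁ * E₁) * p₁₁ * p₁₂ + 2 * (e₁ * E₂) * p₂₁ * p₂₂)) * (0 + (2 * (e₂ * E₁) * p₁₂ * s₁₁ + 2 * (e₂ * E₂) * p₂₂ * s₁₂)))
      - (E₂ * ((0 + (2 * (E₁ * e₁) * p₁₁ * p₂₁ + 2 * (E₁ * e₂) * p₁₂ * p₂₂)) - (0 + (2 * (E₁ * e₁) * p₁₁ * t₁₂ + 2 * (E₁ * e₂) * p₁₂ * t₂₂))) + E₁ * ((0 + (2 * (E₂ * e₁) * p₂₁ * t₁₂ + 2 * (E₂ * e₂) * p₂₂ * t₂₂)) - (1 + (2 * (E₂ * e₁) * p₂₁ * p₂₁ + 2 * (E₂ * e₂) * p₂₂ * p₂₂))))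
        * ((0 + (2 * (e₁ * E₁) * p₁₁ * s₁₁ + 2 * (e₁ * E₂) * p₂₁ * s₁₂)) * (0 + (2 * (e₂ * E₁) * p₁₂ * p₁₁ + 2 * (e₂ * E₂) * p₂₂ * p₂₁)) - (1 + (2 * (e₁ * E₁) * p₁₁ * p₁₁ + 2 * (e₁ * E₂) * p₂₁ * p₂₁)) * (0 + (2 * (e₂ * E₁) * p₁₂ * s₁₁ + 2 * (e₂ * E₂) * p₂₂ * s₁₂)))
      + (E₂ * ((0 + (2 * (E₁ * e₁) * p₁₁ * t₁₁ + 2 * (E₁ * e₂) * p₁₂ * t₁₂)) - (0 + (2 * (E₁ * e₁) * p₁₁ * t₁₂ + 2 * (E₁ * e₂) * p₁₂ * t₂₂))) + E₁ * ((0 + (2 * (E₂ * e₁) * p₂₁ * t₁₂ + 2 * (E₂ * e₂) * p₂₂ * t₂₂)) - (0 + (2 * (E₂ * e₁) * p₂₁ * t₁₁ + 2 * (E₂ * e₂) * p₂₂ * t₁₂))))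
        * ((0 + (2 * (e₁ * E₁) * p₁₁ * s₁₁ + 2 * (e₁ * E₂) * p₂₁ * s₁₂)) * (0 + (2 * (e₂ * E₁) * p₁₂ * s₁₂ + 2 * (e₂ * E₂) * p₂₂ * s₂₂)) - (0 + (2 * (e₁ * E₁) * p₁₁ * s₁₂ + 2 * (e₁ * E₂) * p₂₁ * s₂₂)) * (0 + (2 * (e₂ * E₁) * p₁₂ * s₁₁ + 2 * (e₂ * E₂) * p₂₂ * s₁₂)))
      = numeratorExpansion E₁ E₂ e₁ e₂ p₁₁ p₁₂ p₂₁ p₂₂ s₁₁ s₁₂ s₂₂ t₁₁ t₁₂ t₂₂ := by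
  obtain ⟨D, hD⟩ : ∃ D, D = p₁₁ * p₂₂ - p₁₂ * p₂₁ := ⟨_, rfl⟩
  obtain ⟨c₀₁, hc₀₁⟩ : ∃ c, c = s₁₁ * s₂₂ - s₁₂ * s₁₂ := ⟨_, rfl⟩
  obtain ⟨c₀₂, hc₀₂⟩ : ∃ c, c = s₁₁ * p₂₁ - p₁₁ * s₁₂ := ⟨_, rfl⟩
  obtain ⟨c₀₃, hc₀₃⟩ : ∃ c, c = s₁₁ * p₂₂ - p₁₂ * s₁₂ := ⟨_, rfl⟩
  obtain ⟨c₁₂, hc₁₂⟩ : ∃ c, c = s₁₂ * p₂₁ - p₁₁ * s₂₂ := ⟨_, rfl⟩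
  obtain ⟨c₁₃, hc₁₃⟩ : ∃ c, c = s₁₂ * p₂₂ - p₁₂ * s₂₂ := ⟨_, rfl⟩
  have hQ : 2 * (e₁ * E₁) * p₁₁ * (2 * (e₂ * E₂) * p₂₂) - 2 * (e₁ * E₂) * p₂₁ * (2 * (e₂ * E₁) * p₁₂)
      = 4 * (E₁ * E₂ * e₁ * e₂) * D := by rw [hD]; ring
  -- Eliminating a between the first two rows leaves these multiples of p₁₁ - p₂₁ and p₁₂ - p₂₂, the
  -- 2 × 2 minors of the Gram columns bordered by a.
  have hV₁ : 2 * (E₁ * e₁) * p₁₁ * E₂ - 2 * (E₂ * e₁) * p₂₁ * E₁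
      = 2 * (E₁ * E₂ * e₁) * (p₁₁ - p₂₁) := by ring
  have hV₂ : 2 * (E₁ * e₂) * p₁₂ * E₂ - 2 * (E₂ * e₂) * p₂₂ * E₁
      = 2 * (E₁ * E₂ * e₂) * (p₁₂ - p₂₂) := by ring
  obtain ⟨r₁, hr₁⟩ : ∃ q, q = det₃ 1 1 1 s₁₁ p₁₁ p₁₂ s₁₂ p₂₁ p₂₂ := ⟨_, rfl⟩
  have hr₁a : r₁ = D - c₀₃ + c₀₂ := by
    rw [hr₁, hD, hc₀₂, hc₀₃]; simp only [det₃]; ring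
  obtain ⟨r₂, hr₂⟩ : ∃ q, q = det₃ 1 1 1 s₁₂ p₁₁ p₁₂ s₂₂ p₂₁ p₂₂ := ⟨_, rfl⟩
  have hr₂a : r₂ = D - c₁₃ + c₁₂ := by
    rw [hr₂, hD, hc₁₂, hc₁₃]; simp only [det₃]; ring
  obtain ⟨q₁, hq₁⟩ : ∃ q, q = det₄ p₁₁ p₂₁ t₁₁ t₁₂ 1 1 1 1 s₁₁ s₁₂ p₁₁ p₁₂ s₁₂ s₂₂ p₂₁ p₂₂ := ⟨_, rfl⟩
  have hq₁a : q₁ = (p₁₁ - p₂₁) * D - (p₁₁ - t₁₁) * c₁₃ + (p₁₁ - t₁₂) * c₁₂ + (p₂₁ - t₁₁) * c₀₃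
      - (p₂₁ - t₁₂) * c₀₂ + (t₁₁ - t₁₂) * c₀₁ := by
    rw [hq₁, det₄_laplace, hc₀₁, hc₀₂, hc₀₃, hc₁₂, hc₁₃, hD]; ring
  obtain ⟨q₂, hq₂⟩ : ∃ q, q = det₄ p₁₂ p₂₂ t₁₂ t₂₂ 1 1 1 1 s₁₁ s₁₂ p₁₁ p₁₂ s₁₂ s₂₂ p₂₁ p₂₂ := ⟨_, rfl⟩
  have hq₂a : q₂ = (p₁₂ - p₂₂) * D - (p₁₂ - t₁₂) * c₁₃ + (p₁₂ - t₂₂) * c₁₂ + (p₂₂ - t₁₂) * c₀₃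
      - (p₂₂ - t₂₂) * c₀₂ + (t₁₂ - t₂₂) * c₀₁ := by
    rw [hq₂, det₄_laplace, hc₀₁, hc₀₂, hc₀₃, hc₁₂, hc₁₃, hD]; ring
  simp only [minor_combination, minor_change_combination]
  simp only [mul_zero, zero_mul, one_mul, mul_one, sub_zero, zero_sub, zero_add, add_zero, sub_self]
  rw [hQ, hV₁, hV₂]
  simp only [numeratorExpansion, ← hD, ← hc₀₁, ← hc₀₂, ← hc₀₃, ← hc₁₂, ← hc₁₃, ← hr₁, ← hr₂, ← hq₁, ← hq₂]
  simp only [det₃]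
  linear_combination - 4 * D * (E₁ ^ 2 * E₂ * e₁ * e₂) * hr₁a - 4 * D * (E₁ * E₂ ^ 2 * e₁ * e₂) * hr₂a - 8 * D * (p₁₁ - p₂₁) * (E₁ ^ 2 * E₂ ^ 2 * e₁ ^ 2 * e₂) * hq₁a - 8 * D * (p₁₂ - p₂₂) * (E₁ ^ 2 * E₂ ^ 2 * e₁ * e₂ ^ 2) * hq₂a

theorem det_one_add_blockGram_add :
    (1 + blockGram E₁ E₂ e₁ e₂ p₁₁ p₁₂ p₂₁ p₂₂
        * blockCauchy p₁₁ p₁₂ p₂₁ p₂₂ s₁₁ s₁₂ s₂₂ t₁₁ t₁₂ t₂₂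
        + Matrix.vecMulVec ![E₁, E₂, 0, 0] 1).det
      = tauExpansion E₁ E₂ e₁ e₂ p₁₁ p₁₂ p₂₁ p₂₂ s₁₁ s₁₂ s₂₂ t₁₁ t₁₂ t₂₂
        + numeratorExpansion E₁ E₂ e₁ e₂ p₁₁ p₁₂ p₂₁ p₂₂ s₁₁ s₁₂ s₂₂ t₁₁ t₁₂ t₂₂ := by
  rw [det_add_vecMulVec_one, det_one_add_blockGram, ← laplace_eq_numeratorExpansion]
  obtain ⟨M, hM⟩ : ∃ M, M = 1 + blockGram E₁ E₂ e₁ e₂ p₁₁ p₁₂ p₂₁ p₂₂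
        * blockCauchy p₁₁ p₁₂ p₂₁ p₂₂ s₁₁ s₁₂ s₂₂ t₁₁ t₁₂ t₂₂ := ⟨_, rfl⟩
  have h00 : M 0 0 = (1 + (2 * (E₁ * e₁) * p₁₁ * p₁₁ + 2 * (E₁ * e₂) * p₁₂ * p₁₂)) := by
    rw [hM]; simp [blockGram, blockCauchy]
  have h01 : M 0 1 = (0 + (2 * (E₁ * e₁) * p₁₁ * p₂₁ + 2 * (E₁ * e₂) * p₁₂ * p₂₂)) := by
    rw [hM]; simp [blockGram, blockCauchy]
  have h02 : M 0 2 = (0 + (2 * (E₁ * e₁) * p₁₁ * t₁₁ + 2 * (E₁ * e₂) * p₁₂ * t₁₂)) := by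
    rw [hM]; simp [blockGram, blockCauchy]
  have h03 : M 0 3 = (0 + (2 * (E₁ * e₁) * p₁₁ * t₁₂ + 2 * (E₁ * e₂) * p₁₂ * t₂₂)) := by
    rw [hM]; simp [blockGram, blockCauchy]
  have h10 : M 1 0 = (0 + (2 * (E₂ * e₁) * p₂₁ * p₁₁ + 2 * (E₂ * e₂) * p₂₂ * p₁₂)) := by
    rw [hM]; simp [blockGram, blockCauchy]
  have h11 : M 1 1 = (1 + (2 * (E₂ * e₁) * p₂₁ * p₂₁ + 2 * (E₂ * e₂) * p₂₂ * p₂₂)) := by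
    rw [hM]; simp [blockGram, blockCauchy]
  have h12 : M 1 2 = (0 + (2 * (E₂ * e₁) * p₂₁ * t₁₁ + 2 * (E₂ * e₂) * p₂₂ * t₁₂)) := by
    rw [hM]; simp [blockGram, blockCauchy]
  have h13 : M 1 3 = (0 + (2 * (E₂ * e₁) * p₂₁ * t₁₂ + 2 * (E₂ * e₂) * p₂₂ * t₂₂)) := by
    rw [hM]; simp [blockGram, blockCauchy]
  have h20 : M 2 0 = (0 + (2 * (e₁ * E₁) * p₁₁ * s₁₁ + 2 * (e₁ * E₂) * p₂₁ * s₁₂)) := by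
    rw [hM]; simp [blockGram, blockCauchy]
  have h21 : M 2 1 = (0 + (2 * (e₁ * E₁) * p₁₁ * s₁₂ + 2 * (e₁ * E₂) * p₂₁ * s₂₂)) := by
    rw [hM]; simp [blockGram, blockCauchy]
  have h22 : M 2 2 = (1 + (2 * (e₁ * E₁) * p₁₁ * p₁₁ + 2 * (e₁ * E₂) * p₂₁ * p₂₁)) := by
    rw [hM]; simp [blockGram, blockCauchy]
  have h23 : M 2 3 = (0 + (2 * (e₁ * E₁) * p₁₁ * p₁₂ + 2 * (e₁ * E₂) * p₂₁ * p₂₂)) := by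
    rw [hM]; simp [blockGram, blockCauchy]
  have h30 : M 3 0 = (0 + (2 * (e₂ * E₁) * p₁₂ * s₁₁ + 2 * (e₂ * E₂) * p₂₂ * s₁₂)) := by
    rw [hM]; simp [blockGram, blockCauchy]
  have h31 : M 3 1 = (0 + (2 * (e₂ * E₁) * p₁₂ * s₁₂ + 2 * (e₂ * E₂) * p₂₂ * s₂₂)) := by
    rw [hM]; simp [blockGram, blockCauchy]
  have h32 : M 3 2 = (0 + (2 * (e₂ * E₁) * p₁₂ * p₁₁ + 2 * (e₂ * E₂) * p₂₂ * p₂₁)) := by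
    rw [hM]; simp [blockGram, blockCauchy]
  have h33 : M 3 3 = (1 + (2 * (e₂ * E₁) * p₁₂ * p₁₂ + 2 * (e₂ * E₂) * p₂₂ * p₂₂)) := by
    rw [hM]; simp [blockGram, blockCauchy]
  rw [← hM, h00, h01, h02, h03, h10, h11, h12, h13, h20, h21, h22, h23, h30, h31, h32, h33]

end DeterminantExpansion

/-! ### Closed forms of the coefficients -/

section Coefficients

variable {z z₁ z₂ y y₁ y₂ : ℂ}

/-- The 2 × 2 Cauchy determinant. Throughout, y stands for z̄ as an independent variable, so one
identity serves all exchanges of indices and of z with y. -/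
theorem cauchy_two (h₁₁ : z₁ + y₁ ≠ 0) (h₁₂ : z₁ + y₂ ≠ 0) (h₂₁ : z₂ + y₁ ≠ 0)
    (h₂₂ : z₂ + y₂ ≠ 0) :
    (1 / (z₁ + y₁)) * (1 / (z₂ + y₂)) - (1 / (z₁ + y₂)) * (1 / (z₂ + y₁))
      = (z₁ - z₂) * (y₁ - y₂) / ((z₁ + y₁) * (z₁ + y₂) * (z₂ + y₁) * (z₂ + y₂)) := by
  field_simp
  ring

theorem tauCoeff_quartic (hz : z ≠ 0) (hy : y ≠ 0) (h : z + y ≠ 0) :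
    4 * (1 / (z + y)) ^ 2 * ((1 / (z + y)) ^ 2 - 1 / (2 * z) * (1 / (2 * y)))
      = -((z - y) ^ 2 / (z * y * (z + y) ^ 4)) := by
  field_simp
  ring

theorem tauCoeff_mixed (hy : y ≠ 0) (h₁₂ : z₁ + z₂ ≠ 0) (h₁ : z₁ + y ≠ 0) (h₂ : z₂ + y ≠ 0) :
    8 * (1 / (z₁ + y) * (1 / (z₂ + y)))
        * (1 / (z₁ + y) * (1 / (z₂ + y)) - 1 / (z₁ + z₂) * (1 / (2 * y)))
      = -(4 * (z₁ - y) * (z₂ - y) / (y * (z₁ + z₂) * (z₁ + y) ^ 2 * (z₂ + y) ^ 2)) := by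
  field_simp
  ring

theorem tauCoeff_middle (h₁₁ : z₁ + y₁ ≠ 0) (h₁₂ : z₁ + y₂ ≠ 0) (h₂₁ : z₂ + y₁ ≠ 0)
    (h₂₂ : z₂ + y₂ ≠ 0) (hz : z₁ + z₂ ≠ 0) (hy : y₁ + y₂ ≠ 0) :
    8 * ((1 / (z₁ + y₁) * (1 / (z₂ + y₂)) - 1 / (z₁ + y₂) * (1 / (z₂ + y₁))) ^ 2
        + 1 / (z₁ + y₁) * (1 / (z₂ + y₂))
          * (1 / (z₁ + y₁) * (1 / (z₂ + y₂)) - 1 / (z₁ + z₂) * (1 / (y₁ + y₂)))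
        + 1 / (z₁ + y₂) * (1 / (z₂ + y₁))
          * (1 / (z₁ + y₂) * (1 / (z₂ + y₁)) - 1 / (z₁ + z₂) * (1 / (y₁ + y₂))))
      = 8 * ((z₁ + z₂) * (z₁ - z₂) ^ 2 * (y₁ + y₂) * (y₁ - y₂) ^ 2
          - (z₁ + y₁) ^ 2 * (z₁ - y₁) * (z₂ + y₂) ^ 2 * (z₂ - y₂)
          - (z₁ + y₂) ^ 2 * (z₁ - y₂) * (z₂ + y₁) ^ 2 * (z₂ - y₁))
        / ((z₁ + z₂) * (y₁ + y₂) * (z₁ + y₁) ^ 2 * (z₁ + y₂) ^ 2 * (z₂ + y₁) ^ 2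
          * (z₂ + y₂) ^ 2) := by
  rw [cauchy_two h₁₁ h₁₂ h₂₁ h₂₂]
  field_simp
  ring

theorem tauCoeff_sextic (hz₁ : z₁ ≠ 0) (hy₁ : y₁ ≠ 0) (h₁₁ : z₁ + y₁ ≠ 0) (h₁₂ : z₁ + y₂ ≠ 0)
    (h₂₁ : z₂ + y₁ ≠ 0) (h₂₂ : z₂ + y₂ ≠ 0) (hz : z₁ + z₂ ≠ 0) (hy : y₁ + y₂ ≠ 0) :
    16 * (1 / (z₁ + y₁) * (1 / (z₂ + y₂)) - 1 / (z₁ + y₂) * (1 / (z₂ + y₁))) * (1 / (z₁ + y₁))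
        * det₃ (1 / (z₁ + y₁)) (1 / (z₂ + y₁)) (1 / (2 * y₁)) (1 / (z₁ + y₂)) (1 / (z₂ + y₂))
          (1 / (y₁ + y₂)) (1 / (2 * z₁)) (1 / (z₁ + z₂)) (1 / (z₁ + y₁))
      = 4 * (z₁ - y₂) * (z₂ - y₁) * (z₁ - z₂) ^ 2 * (z₁ - y₁) ^ 2 * (y₁ - y₂) ^ 2
        / (z₁ * y₁ * (z₁ + z₂) * (y₁ + y₂) * (z₁ + y₂) ^ 2 * (z₂ + y₁) ^ 2 * (z₂ + y₂) ^ 2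
          * (z₁ + y₁) ^ 4) := by
  -- A 3 × 3 Cauchy determinant with row nodes y₁, y₂, z₁ and column nodes z₁, z₂, y₁; hence it
  -- factors completely.
  have h : det₃ (1 / (z₁ + y₁)) (1 / (z₂ + y₁)) (1 / (2 * y₁)) (1 / (z₁ + y₂)) (1 / (z₂ + y₂))
          (1 / (y₁ + y₂)) (1 / (2 * z₁)) (1 / (z₁ + z₂)) (1 / (z₁ + y₁))
      = (z₁ - y₂) * (z₂ - y₁) * (z₁ - z₂) * (z₁ - y₁) ^ 2 * (y₁ - y₂)
        / (4 * z₁ * y₁ * (z₁ + z₂) * (y₁ + y₂) * (z₁ + y₂) * (z₂ + y₁) * (z₂ + y₂)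
          * (z₁ + y₁) ^ 2) := by
    simp only [det₃]
    field_simp
    ring
  rw [cauchy_two h₁₁ h₁₂ h₂₁ h₂₂, h]
  field_simp
  ring

theorem tauCoeff_octic (hz₁ : z₁ ≠ 0) (hz₂ : z₂ ≠ 0) (hy₁ : y₁ ≠ 0) (hy₂ : y₂ ≠ 0)
    (h₁₁ : z₁ + y₁ ≠ 0) (h₁₂ : z₁ + y₂ ≠ 0)
    (h₂₁ : z₂ + y₁ ≠ 0) (h₂₂ : z₂ + y₂ ≠ 0) (hz : z₁ + z₂ ≠ 0) (hy : y₁ + y₂ ≠ 0) :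
    16 * (1 / (z₁ + y₁) * (1 / (z₂ + y₂)) - 1 / (z₁ + y₂) * (1 / (z₂ + y₁))) ^ 2
        * det₄ (1 / (z₁ + y₁)) (1 / (z₂ + y₁)) (1 / (2 * y₁)) (1 / (y₁ + y₂))
          (1 / (z₁ + y₂)) (1 / (z₂ + y₂)) (1 / (y₁ + y₂)) (1 / (2 * y₂))
          (1 / (2 * z₁)) (1 / (z₁ + z₂)) (1 / (z₁ + y₁)) (1 / (z₁ + y₂))
          (1 / (z₁ + z₂)) (1 / (2 * z₂)) (1 / (z₂ + y₁)) (1 / (z₂ + y₂))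
      = (z₁ - y₁) ^ 2 * (z₁ - y₂) ^ 2 * (z₂ - y₁) ^ 2 * (z₂ - y₂) ^ 2
          * (z₁ - z₂) ^ 4 * (y₁ - y₂) ^ 4
        / (z₁ * z₂ * y₁ * y₂ * (z₁ + z₂) ^ 2 * (y₁ + y₂) ^ 2 * (z₁ + y₁) ^ 4
          * (z₁ + y₂) ^ 4 * (z₂ + y₁) ^ 4 * (z₂ + y₂) ^ 4) := by
  -- The 4 × 4 Cauchy determinant with row nodes y₁, y₂, z₁, z₂ and column nodes z₁, z₂, y₁, y₂.
  have h : det₄ (1 / (z₁ + y₁)) (1 / (z₂ + y₁)) (1 / (2 * y₁)) (1 / (y₁ + y₂))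
          (1 / (z₁ + y₂)) (1 / (z₂ + y₂)) (1 / (y₁ + y₂)) (1 / (2 * y₂))
          (1 / (2 * z₁)) (1 / (z₁ + z₂)) (1 / (z₁ + y₁)) (1 / (z₁ + y₂))
          (1 / (z₁ + z₂)) (1 / (2 * z₂)) (1 / (z₂ + y₁)) (1 / (z₂ + y₂))
      = (z₁ - y₁) ^ 2 * (z₁ - y₂) ^ 2 * (z₂ - y₁) ^ 2 * (z₂ - y₂) ^ 2
          * (z₁ - z₂) ^ 2 * (y₁ - y₂) ^ 2
        / (16 * (z₁ * z₂ * y₁ * y₂) * (z₁ + z₂) ^ 2 * (y₁ + y₂) ^ 2 * (z₁ + y₁) ^ 2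
          * (z₁ + y₂) ^ 2 * (z₂ + y₁) ^ 2 * (z₂ + y₂) ^ 2) := by
    simp only [det₄, det₃]
    field_simp
    ring
  rw [cauchy_two h₁₁ h₁₂ h₂₁ h₂₂, h]
  field_simp

theorem numCoeff_cubic (hz : z ≠ 0) (h : z + y ≠ 0) :
    2 * (1 / (z + y)) * (1 / (z + y) - 1 / (2 * z)) = (z - y) / (z * (z + y) ^ 2) := by
  field_simp
  ring

theorem numCoeff_mixed (hz : z₁ + z₂ ≠ 0) (h₁ : z₁ + y ≠ 0) (h₂ : z₂ + y ≠ 0) :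
    2 * (1 / (z₂ + y) * (1 / (z₂ + y) - 1 / (z₁ + z₂))
        + 1 / (z₁ + y) * (1 / (z₁ + y) - 1 / (z₁ + z₂)) + (1 / (z₁ + y) - 1 / (z₂ + y)) ^ 2)
      = 2 * ((z₁ + z₂) * (z₁ - z₂) ^ 2 + (z₁ - y) * (z₁ + y) ^ 2 + (z₂ - y) * (z₂ + y) ^ 2)
        / ((z₁ + z₂) * (z₁ + y) ^ 2 * (z₂ + y) ^ 2) := by
  field_simp
  ring

theorem numCoeff_quintic (hz₂ : z₂ ≠ 0) (hy : y ≠ 0) (hz : z₁ + z₂ ≠ 0) (h₁ : z₁ + y ≠ 0)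
    (h₂ : z₂ + y ≠ 0) :
    4 * (1 / (z₁ + y) - 1 / (z₂ + y)) * (1 / (z₂ + y))
        * det₃ (1 / (z₁ + y)) (1 / (z₂ + y)) (1 / (2 * y)) 1 1 1
          (1 / (z₁ + z₂)) (1 / (2 * z₂)) (1 / (z₂ + y))
      = -((z₁ - y) * (z₁ - z₂) ^ 2 * (z₂ - y) ^ 2
        / (z₂ * y * (z₁ + z₂) * (z₁ + y) ^ 2 * (z₂ + y) ^ 4)) := by
  simp only [det₃]
  field_simp
  ring

theorem numCoeff_quintic_mixed (hz₁ : z₁ ≠ 0) (h₁₁ : z₁ + y₁ ≠ 0) (h₁₂ : z₁ + y₂ ≠ 0)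
    (h₂₁ : z₂ + y₁ ≠ 0) (h₂₂ : z₂ + y₂ ≠ 0) (hz : z₁ + z₂ ≠ 0) (hy : y₁ + y₂ ≠ 0) :
    4 * ((1 / (z₁ + y₁) * (1 / (z₂ + y₂)) - 1 / (z₁ + y₂) * (1 / (z₂ + y₁)))
          * det₃ 1 1 1 (1 / (2 * z₁)) (1 / (z₁ + y₁)) (1 / (z₁ + y₂))
            (1 / (z₁ + z₂)) (1 / (z₂ + y₁)) (1 / (z₂ + y₂))
        + (1 / (z₁ + y₁) - 1 / (z₂ + y₁)) * (1 / (z₁ + y₂))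
          * det₃ (1 / (z₁ + y₁)) (1 / (z₂ + y₁)) (1 / (y₁ + y₂)) 1 1 1
            (1 / (2 * z₁)) (1 / (z₁ + z₂)) (1 / (z₁ + y₂))
        + (1 / (z₁ + y₂) - 1 / (z₂ + y₂)) * (1 / (z₁ + y₁))
          * det₃ (1 / (z₁ + y₂)) (1 / (z₂ + y₂)) (1 / (y₁ + y₂)) 1 1 1
            (1 / (2 * z₁)) (1 / (z₁ + z₂)) (1 / (z₁ + y₁)))
      = -(2 * (z₁ - y₁) * (z₁ - y₂) * (z₁ - z₂) ^ 2
          * ((z₂ - y₁) * (z₂ + y₁) ^ 2 + (z₂ - y₂) * (z₂ + y₂) ^ 2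
            - (y₁ + y₂) * (y₁ - y₂) ^ 2)
        / (z₁ * (z₁ + z₂) * (y₁ + y₂) * (z₁ + y₁) ^ 2 * (z₁ + y₂) ^ 2
          * (z₂ + y₁) ^ 2 * (z₂ + y₂) ^ 2)) := by
  rw [cauchy_two h₁₁ h₁₂ h₂₁ h₂₂]
  simp only [det₃]
  field_simp
  ring

theorem numCoeff_septic (hz₁ : z₁ ≠ 0) (hz₂ : z₂ ≠ 0) (hy₂ : y₂ ≠ 0)
    (h₁₁ : z₁ + y₁ ≠ 0) (h₁₂ : z₁ + y₂ ≠ 0)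
    (h₂₁ : z₂ + y₁ ≠ 0) (h₂₂ : z₂ + y₂ ≠ 0) (hz : z₁ + z₂ ≠ 0) (hy : y₁ + y₂ ≠ 0) :
    8 * (1 / (z₁ + y₁) * (1 / (z₂ + y₂)) - 1 / (z₁ + y₂) * (1 / (z₂ + y₁)))
        * (1 / (z₁ + y₂) - 1 / (z₂ + y₂))
        * det₄ (1 / (z₁ + y₂)) (1 / (z₂ + y₂)) (1 / (y₁ + y₂)) (1 / (2 * y₂)) 1 1 1 1
          (1 / (2 * z₁)) (1 / (z₁ + z₂)) (1 / (z₁ + y₁)) (1 / (z₁ + y₂))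
          (1 / (z₁ + z₂)) (1 / (2 * z₂)) (1 / (z₂ + y₁)) (1 / (z₂ + y₂))
      = (z₁ - y₁) * (z₂ - y₁) * (z₁ - y₂) ^ 2 * (z₂ - y₂) ^ 2
          * (y₁ - y₂) ^ 2 * (z₁ - z₂) ^ 4
        / (z₁ * z₂ * y₂ * (y₁ + y₂) * (z₁ + z₂) ^ 2 * (z₁ + y₁) ^ 2
          * (z₂ + y₁) ^ 2 * (z₁ + y₂) ^ 4 * (z₂ + y₂) ^ 4) := by
  -- A bordered Cauchy determinant: the row of ones is the limit of a row, rescaled, whose node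
  -- tends to infinity.
  have h : det₄ (1 / (z₁ + y₂)) (1 / (z₂ + y₂)) (1 / (y₁ + y₂)) (1 / (2 * y₂)) 1 1 1 1
          (1 / (2 * z₁)) (1 / (z₁ + z₂)) (1 / (z₁ + y₁)) (1 / (z₁ + y₂))
          (1 / (z₁ + z₂)) (1 / (2 * z₂)) (1 / (z₂ + y₁)) (1 / (z₂ + y₂))
      = -((z₁ - y₁) * (z₂ - y₁) * (z₁ - y₂) ^ 2 * (z₂ - y₂) ^ 2
          * (y₁ - y₂) * (z₁ - z₂) ^ 2
        / (8 * (z₁ * z₂ * y₂) * (y₁ + y₂) * (z₁ + z₂) ^ 2 * (z₁ + y₁)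
          * (z₂ + y₁) * (z₁ + y₂) ^ 2 * (z₂ + y₂) ^ 2)) := by
    simp only [det₄, det₃]
    field_simp
    ring
  rw [cauchy_two h₁₁ h₁₂ h₂₁ h₂₂, h]
  field_simp
  ring

end Coefficients

/-! ### Specialization to two wave numbers and their conjugates -/

section TwoSoliton

open Matrix

/-- The matrix determinant lemma. It makes G = det(1 + CB)·1ᵀWa a difference of two determinants,
free of inverses. -/
theorem det_mul_dotProduct_inv {n : Type*} [Fintype n] [DecidableEq n] (M : Matrix n n ℂ)
    (h : M.det ≠ 0) (a w : n → ℂ) :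
    M.det * (w ⬝ᵥ M⁻¹ *ᵥ a) = (M + vecMulVec a w).det - M.det := by
  have e := Matrix.det_add_replicateCol_mul_replicateRow (ι := Unit) h.isUnit a w
  have e' : (1 + replicateRow Unit w * M⁻¹ * replicateCol Unit a).det = 1 + w ⬝ᵥ M⁻¹ *ᵥ a := by
    rw [Matrix.det_unique, Matrix.mul_assoc, ← Matrix.replicateCol_mulVec]
    simp [Matrix.mul_apply, dotProduct]
  rw [← Matrix.vecMulVec_eq, e'] at e
  rw [e]
  ring

/-- The wave numbers of the 2-soliton and their conjugates. -/
def waveNumbers (z₁ z₂ : ℂ) : Fin 4 → ℂ := ![z₁, z₂, conj z₁, conj z₂]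

/-- The amplitudes of the 2-soliton. -/
def amplitudes (A₁ A₂ : ℂ) : Fin 4 → ℂ := ![A₁, A₂, 0, 0]

/-- The permutation of the indices which corresponds to complex conjugation. -/
def conjPerm : Equiv.Perm (Fin 4) := Equiv.swap 0 2 * Equiv.swap 1 3

theorem conjPerm_zero : conjPerm 0 = 2 := by decide
theorem conjPerm_one : conjPerm 1 = 3 := by decide
theorem conjPerm_two : conjPerm 2 = 0 := by decide
theorem conjPerm_three : conjPerm 3 = 1 := by decide

theorem conjPerm_conjPerm (i : Fin 4) : conjPerm (conjPerm i) = i := by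
  revert i; decide

theorem waveNumbers_conjPerm (z₁ z₂ : ℂ) (i : Fin 4) :
    waveNumbers z₁ z₂ (conjPerm i) = conj (waveNumbers z₁ z₂ i) := by
  fin_cases i
  · exact congrArg (waveNumbers z₁ z₂) conjPerm_zero
  · exact congrArg (waveNumbers z₁ z₂) conjPerm_one
  · exact (congrArg (waveNumbers z₁ z₂) conjPerm_two).trans (Complex.conj_conj z₁).symm
  · exact (congrArg (waveNumbers z₁ z₂) conjPerm_three).trans (Complex.conj_conj z₂).symm

theorem expVec_amplitudes (z₁ z₂ A₁ A₂ : ℂ) (t x : ℝ) :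
    expVec (waveNumbers z₁ z₂) (amplitudes A₁ A₂) t x
      = ![hirotaExp z₁ A₁ t x, hirotaExp z₂ A₂ t x, 0, 0] := by
  ext i
  fin_cases i
  · rfl
  · rfl
  · exact zero_mul _
  · exact zero_mul _

theorem conjExpVec_amplitudes (z₁ z₂ A₁ A₂ : ℂ) (t x : ℝ) :
    conjExpVec (waveNumbers z₁ z₂) (amplitudes A₁ A₂) conjPerm t x
      = ![0, 0, conj (hirotaExp z₁ A₁ t x), conj (hirotaExp z₂ A₂ t x)] := by
  ext i
  simp only [conjExpVec, expVec_amplitudes]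
  fin_cases i
  · exact (congrArg (fun k => conj (![hirotaExp z₁ A₁ t x, hirotaExp z₂ A₂ t x, 0, 0] k))
      conjPerm_zero).trans (map_zero _)
  · exact (congrArg (fun k => conj (![hirotaExp z₁ A₁ t x, hirotaExp z₂ A₂ t x, 0, 0] k))
      conjPerm_one).trans (map_zero _)
  · exact congrArg (fun k => conj (![hirotaExp z₁ A₁ t x, hirotaExp z₂ A₂ t x, 0, 0] k))
      conjPerm_two
  · exact congrArg (fun k => conj (![hirotaExp z₁ A₁ t x, hirotaExp z₂ A₂ t x, 0, 0] k))
      conjPerm_three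

/-- The amplitudes at the conjugate wave numbers are zero, so a and b have disjoint supports and the
off-diagonal blocks vanish. -/
theorem gramMatrix_waveNumbers (z₁ z₂ E₁ E₂ : ℂ) :
    gramMatrix (waveNumbers z₁ z₂) ![E₁, E₂, 0, 0] ![0, 0, conj E₁, conj E₂]
      = blockGram E₁ E₂ (conj E₁) (conj E₂) (1 / (z₁ + conj z₁)) (1 / (z₁ + conj z₂))
          (1 / (z₂ + conj z₁)) (1 / (z₂ + conj z₂)) := by
  ext i j
  fin_cases i <;> fin_cases j <;> simp [gramMatrix, blockGram, waveNumbers] <;> ring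

theorem cauchyMatrix_waveNumbers (z₁ z₂ : ℂ) :
    cauchyMatrix (waveNumbers z₁ z₂)
      = blockCauchy (1 / (z₁ + conj z₁)) (1 / (z₁ + conj z₂))
          (1 / (z₂ + conj z₁)) (1 / (z₂ + conj z₂)) (1 / (2 * z₁)) (1 / (z₁ + z₂)) (1 / (2 * z₂))
          (1 / (2 * conj z₁)) (1 / (conj z₁ + conj z₂)) (1 / (2 * conj z₂)) := by
  ext i j
  fin_cases i <;> fin_cases j <;> simp [cauchyMatrix, blockCauchy, waveNumbers] <;> ring

end TwoSoliton

/-! ### The explicit F and G as tau function and numerator -/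

section Expansion

variable {z₁ z₂ : ℂ} {A₁ A₂ : ℂ}

theorem flowTau_waveNumbers (z₁ z₂ A₁ A₂ : ℂ) (t x : ℝ) :
    flowTau (waveNumbers z₁ z₂) (amplitudes A₁ A₂) conjPerm t x
      = 1 + blockGram (hirotaExp z₁ A₁ t x) (hirotaExp z₂ A₂ t x)
          (conj (hirotaExp z₁ A₁ t x)) (conj (hirotaExp z₂ A₂ t x))
          (1 / (z₁ + conj z₁)) (1 / (z₁ + conj z₂)) (1 / (z₂ + conj z₁)) (1 / (z₂ + conj z₂))
        * blockCauchy (1 / (z₁ + conj z₁)) (1 / (z₁ + conj z₂))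
          (1 / (z₂ + conj z₁)) (1 / (z₂ + conj z₂)) (1 / (2 * z₁)) (1 / (z₁ + z₂)) (1 / (2 * z₂))
          (1 / (2 * conj z₁)) (1 / (conj z₁ + conj z₂)) (1 / (2 * conj z₂)) := by
  rw [flowTau, tauMatrix, expVec_amplitudes, conjExpVec_amplitudes, gramMatrix_waveNumbers,
    cauchyMatrix_waveNumbers]

/-- The coefficients are stated as the closed-form lemmas deliver them after exchanging indices; the
determinants then have permuted rows and columns, and only those permutations have to be undone. -/
theorem tauExpansion_of_coefficients {E₁ E₂ e₁ e₂ p₁₁ p₁₂ p₂₁ p₂₂ s₁₁ s₁₂ s₂₂ t₁₁ t₁₂ t₂₂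
      a₁ a₂ a₃ a₄ b₁ b₂ b₃ b₄ c d₁ d₂ d₃ d₄ f : ℂ}
    (q₁ : 4 * p₁₁ ^ 2 * (p₁₁ ^ 2 - s₁₁ * t₁₁) = a₁) (q₂ : 4 * p₂₂ ^ 2 * (p₂₂ ^ 2 - s₂₂ * t₂₂) = a₂)
    (q₃ : 4 * p₁₂ ^ 2 * (p₁₂ ^ 2 - s₁₁ * t₂₂) = a₃) (q₄ : 4 * p₂₁ ^ 2 * (p₂₁ ^ 2 - t₁₁ * s₂₂) = a₄)
    (m₁ : 8 * (p₁₁ * p₂₁) * (p₁₁ * p₂₁ - s₁₂ * t₁₁) = b₁)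
    (m₂ : 8 * (p₁₂ * p₂₂) * (p₁₂ * p₂₂ - s₁₂ * t₂₂) = b₂)
    (m₃ : 8 * (p₁₁ * p₁₂) * (p₁₁ * p₁₂ - t₁₂ * s₁₁) = b₃)
    (m₄ : 8 * (p₂₁ * p₂₂) * (p₂₁ * p₂₂ - t₁₂ * s₂₂) = b₄)
    (k : 8 * ((p₁₁ * p₂₂ - p₁₂ * p₂₁) ^ 2 + p₁₁ * p₂₂ * (p₁₁ * p₂₂ - s₁₂ * t₁₂)
      + p₁₂ * p₂₁ * (p₁₂ * p₂₁ - s₁₂ * t₁₂)) = c)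
    (r₁ : 16 * (p₁₁ * p₂₂ - p₁₂ * p₂₁) * p₁₁ * det₃ p₁₁ p₂₁ t₁₁ p₁₂ p₂₂ t₁₂ s₁₁ s₁₂ p₁₁ = d₁)
    (r₂ : 16 * (p₂₂ * p₁₁ - p₂₁ * p₁₂) * p₂₂ * det₃ p₂₂ p₁₂ t₂₂ p₂₁ p₁₁ t₁₂ s₂₂ s₁₂ p₂₂ = d₂)
    (r₃ : 16 * (p₁₂ * p₂₁ - p₁₁ * p₂₂) * p₁₂ * det₃ p₁₂ p₂₂ t₂₂ p₁₁ p₂₁ t₁₂ s₁₁ s₁₂ p₁₂ = d₃)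
    (r₄ : 16 * (p₂₁ * p₁₂ - p₂₂ * p₁₁) * p₂₁ * det₃ p₂₁ p₁₁ t₁₁ p₂₂ p₁₂ t₁₂ s₂₂ s₁₂ p₂₁ = d₄)
    (o : 16 * (p₁₁ * p₂₂ - p₁₂ * p₂₁) ^ 2
      * det₄ p₁₁ p₂₁ t₁₁ t₁₂ p₁₂ p₂₂ t₁₂ t₂₂ s₁₁ s₁₂ p₁₁ p₁₂ s₁₂ s₂₂ p₂₁ p₂₂ = f) :
    tauExpansion E₁ E₂ e₁ e₂ p₁₁ p₁₂ p₂₁ p₂₂ s₁₁ s₁₂ s₂₂ t₁₁ t₁₂ t₂₂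
      = 1 + 4 * p₁₁ ^ 2 * (E₁ * e₁) + 4 * p₂₂ ^ 2 * (E₂ * e₂)
        + 4 * p₁₂ ^ 2 * (E₁ * e₂) + 4 * p₂₁ ^ 2 * (E₂ * e₁)
        + a₁ * (E₁ ^ 2 * e₁ ^ 2) + a₂ * (E₂ ^ 2 * e₂ ^ 2)
        + a₃ * (E₁ ^ 2 * e₂ ^ 2) + a₄ * (E₂ ^ 2 * e₁ ^ 2)
        + b₁ * (E₁ * E₂ * e₁ ^ 2) + b₂ * (E₁ * E₂ * e₂ ^ 2)
        + b₃ * (E₁ ^ 2 * e₁ * e₂) + b₄ * (E₂ ^ 2 * e₁ * e₂)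
        + c * (E₁ * e₁ * E₂ * e₂)
        + d₁ * (E₁ ^ 2 * E₂ * e₁ ^ 2 * e₂) + d₂ * (E₁ * E₂ ^ 2 * e₁ * e₂ ^ 2)
        + d₃ * (E₁ ^ 2 * E₂ * e₁ * e₂ ^ 2) + d₄ * (E₁ * E₂ ^ 2 * e₁ ^ 2 * e₂)
        + f * (E₁ ^ 2 * E₂ ^ 2 * e₁ ^ 2 * e₂ ^ 2) := by
  subst q₁ q₂ q₃ q₄ m₁ m₂ m₃ m₄ k r₁ r₂ r₃ r₄ o
  generalize ho : det₄ p₁₁ p₂₁ t₁₁ t₁₂ p₁₂ p₂₂ t₁₂ t₂₂ s₁₁ s₁₂ p₁₁ p₁₂ s₁₂ s₂₂ p₂₁ p₂₂ = o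
  simp only [tauExpansion, ho, det₃]
  ring

theorem det_flowTau_waveNumbers (hz₁ : z₁ ≠ 0) (hz₂ : z₂ ≠ 0) (h₁₁ : z₁ + conj z₁ ≠ 0)
    (h₁₂ : z₁ + conj z₂ ≠ 0) (h₂₁ : z₂ + conj z₁ ≠ 0) (h₂₂ : z₂ + conj z₂ ≠ 0)
    (hz : z₁ + z₂ ≠ 0) (hy : conj z₁ + conj z₂ ≠ 0) (A₁ A₂ : ℂ) (t x : ℝ) :
    (flowTau (waveNumbers z₁ z₂) (amplitudes A₁ A₂) conjPerm t x).det = ssF z₁ z₂ A₁ A₂ t x := by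
  have hy₁ : conj z₁ ≠ 0 := (map_ne_zero _).2 hz₁
  have hy₂ : conj z₂ ≠ 0 := (map_ne_zero _).2 hz₂
  rw [flowTau_waveNumbers, det_one_add_blockGram]
  simp only [ssF, ssDiagF, ssHalfF, map_add, map_sub, map_mul, map_div₀, map_pow,
    Complex.conj_conj, map_ofNat]
  generalize hirotaExp z₁ A₁ t x = E₁
  generalize hirotaExp z₂ A₂ t x = E₂
  generalize conj z₁ = y₁ at *
  generalize conj z₂ = y₂ at *
  generalize conj E₁ = e₁
  generalize conj E₂ = e₂
  have hz' : z₂ + z₁ ≠ 0 := by rwa [add_comm]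
  have hy' : y₂ + y₁ ≠ 0 := by rwa [add_comm]
  have h₁₁' : y₁ + z₁ ≠ 0 := by rwa [add_comm]
  have h₁₂' : y₂ + z₁ ≠ 0 := by rwa [add_comm]
  have h₂₁' : y₁ + z₂ ≠ 0 := by rwa [add_comm]
  have h₂₂' : y₂ + z₂ ≠ 0 := by rwa [add_comm]
  have q₁ := tauCoeff_quartic hz₁ hy₁ h₁₁
  have q₂ := tauCoeff_quartic hz₂ hy₂ h₂₂
  have q₃ := tauCoeff_quartic hz₁ hy₂ h₁₂
  have q₄ := tauCoeff_quartic hy₁ hz₂ h₂₁'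
  have m₁ := tauCoeff_mixed hy₁ hz h₁₁ h₂₁
  have m₂ := tauCoeff_mixed hy₂ hz h₁₂ h₂₂
  have m₃ := tauCoeff_mixed hz₁ hy h₁₁' h₁₂'
  have m₄ := tauCoeff_mixed hz₂ hy h₂₁' h₂₂'
  have k := tauCoeff_middle h₁₁ h₁₂ h₂₁ h₂₂ hz hy
  have s₁ := tauCoeff_sextic hz₁ hy₁ h₁₁ h₁₂ h₂₁ h₂₂ hz hy
  have s₂ := tauCoeff_sextic hz₂ hy₂ h₂₂ h₂₁ h₁₂ h₁₁ hz' hy'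
  have s₃ := tauCoeff_sextic hz₁ hy₂ h₁₂ h₁₁ h₂₂ h₂₁ hz hy'
  have s₄ := tauCoeff_sextic hz₂ hy₁ h₂₁ h₂₂ h₁₁ h₁₂ hz' hy
  have o := tauCoeff_octic hz₁ hz₂ hy₁ hy₂ h₁₁ h₁₂ h₂₁ h₂₂ hz hy
  -- The exchanged instances contain sums in the opposite order; they are normalized to a fixed
  -- order.
  rw [add_comm z₂ z₁, add_comm y₂ y₁] at s₂
  rw [add_comm y₂ y₁] at s₃
  rw [add_comm z₂ z₁] at s₄
  rw [add_comm y₁ z₂] at q₄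
  rw [add_comm y₁ z₁, add_comm y₂ z₁] at m₃
  rw [add_comm y₁ z₂, add_comm y₂ z₂] at m₄
  rw [add_comm y₁ z₁, add_comm y₁ z₂, add_comm y₂ z₁, add_comm y₂ z₂]
  rw [tauExpansion_of_coefficients q₁ q₂ q₃ q₄ m₁ m₂ m₃ m₄ k s₁ s₂ s₃ s₄ o]
  clear * -
  -- With every sum and difference of wave numbers turned into an atom, both sides agree coefficient
  -- by coefficient, without any relation between the atoms.
  rw [← neg_sub z₁ z₂, ← neg_sub z₁ y₁, ← neg_sub z₁ y₂, ← neg_sub z₂ y₁, ← neg_sub z₂ y₂,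
    ← neg_sub y₁ y₂]
  generalize z₁ - z₂ = v₁
  generalize y₁ - y₂ = v₂
  generalize z₁ - y₁ = v₁₁
  generalize z₁ - y₂ = v₁₂
  generalize z₂ - y₁ = v₂₁
  generalize z₂ - y₂ = v₂₂
  generalize z₁ + z₂ = u₁
  generalize y₁ + y₂ = u₂
  generalize z₁ + y₁ = u₁₁
  generalize z₁ + y₂ = u₁₂
  generalize z₂ + y₁ = u₂₁
  generalize z₂ + y₂ = u₂₂
  ring

theorem numeratorExpansion_of_coefficients {E₁ E₂ e₁ e₂ p₁₁ p₁₂ p₂₁ p₂₂ s₁₁ s₁₂ s₂₂ t₁₁ t₁₂ t₂₂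
      a₁ a₂ a₃ a₄ b₁ b₂ c₁ c₂ c₃ c₄ d₁ d₂ f₁ f₂ : ℂ}
    (q₁ : 2 * p₁₁ * (p₁₁ - s₁₁) = a₁) (q₂ : 2 * p₁₂ * (p₁₂ - s₁₁) = a₂)
    (q₃ : 2 * p₂₁ * (p₂₁ - s₂₂) = a₃) (q₄ : 2 * p₂₂ * (p₂₂ - s₂₂) = a₄)
    (m₁ : 2 * (p₂₁ * (p₂₁ - s₁₂) + p₁₁ * (p₁₁ - s₁₂) + (p₁₁ - p₂₁) ^ 2) = b₁)
    (m₂ : 2 * (p₂₂ * (p₂₂ - s₁₂) + p₁₂ * (p₁₂ - s₁₂) + (p₁₂ - p₂₂) ^ 2) = b₂)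
    (r₁ : 4 * (p₁₁ - p₂₁) * p₂₁ * det₃ p₁₁ p₂₁ t₁₁ 1 1 1 s₁₂ s₂₂ p₂₁ = c₁)
    (r₂ : 4 * (p₁₂ - p₂₂) * p₂₂ * det₃ p₁₂ p₂₂ t₂₂ 1 1 1 s₁₂ s₂₂ p₂₂ = c₂)
    (r₃ : 4 * (p₂₁ - p₁₁) * p₁₁ * det₃ p₂₁ p₁₁ t₁₁ 1 1 1 s₁₂ s₁₁ p₁₁ = c₃)
    (r₄ : 4 * (p₂₂ - p₁₂) * p₁₂ * det₃ p₂₂ p₁₂ t₂₂ 1 1 1 s₁₂ s₁₁ p₁₂ = c₄)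
    (k₁ : 4 * ((p₁₁ * p₂₂ - p₁₂ * p₂₁) * det₃ 1 1 1 s₁₁ p₁₁ p₁₂ s₁₂ p₂₁ p₂₂
      + (p₁₁ - p₂₁) * p₁₂ * det₃ p₁₁ p₂₁ t₁₂ 1 1 1 s₁₁ s₁₂ p₁₂
      + (p₁₂ - p₂₂) * p₁₁ * det₃ p₁₂ p₂₂ t₁₂ 1 1 1 s₁₁ s₁₂ p₁₁) = d₁)
    (k₂ : 4 * ((p₂₁ * p₁₂ - p₂₂ * p₁₁) * det₃ 1 1 1 s₂₂ p₂₁ p₂₂ s₁₂ p₁₁ p₁₂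
      + (p₂₁ - p₁₁) * p₂₂ * det₃ p₂₁ p₁₁ t₁₂ 1 1 1 s₂₂ s₁₂ p₂₂
      + (p₂₂ - p₁₂) * p₂₁ * det₃ p₂₂ p₁₂ t₁₂ 1 1 1 s₂₂ s₁₂ p₂₁) = d₂)
    (o₁ : 8 * (p₁₁ * p₂₂ - p₁₂ * p₂₁) * (p₁₂ - p₂₂)
      * det₄ p₁₂ p₂₂ t₁₂ t₂₂ 1 1 1 1 s₁₁ s₁₂ p₁₁ p₁₂ s₁₂ s₂₂ p₂₁ p₂₂ = f₁)
    (o₂ : 8 * (p₂₂ * p₁₁ - p₂₁ * p₁₂) * (p₂₁ - p₁₁)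
      * det₄ p₂₁ p₁₁ t₁₂ t₁₁ 1 1 1 1 s₂₂ s₁₂ p₂₂ p₂₁ s₁₂ s₁₁ p₁₂ p₁₁ = f₂) :
    numeratorExpansion E₁ E₂ e₁ e₂ p₁₁ p₁₂ p₂₁ p₂₂ s₁₁ s₁₂ s₂₂ t₁₁ t₁₂ t₂₂
      = E₁ + E₂ + a₁ * (E₁ ^ 2 * e₁) + a₂ * (E₁ ^ 2 * e₂) + a₃ * (E₂ ^ 2 * e₁)
        + a₄ * (E₂ ^ 2 * e₂) + b₁ * (E₁ * E₂ * e₁) + b₂ * (E₁ * E₂ * e₂)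
        + c₁ * (E₁ * E₂ ^ 2 * e₁ ^ 2) + c₂ * (E₁ * E₂ ^ 2 * e₂ ^ 2)
        + c₃ * (E₁ ^ 2 * E₂ * e₁ ^ 2) + c₄ * (E₁ ^ 2 * E₂ * e₂ ^ 2)
        + d₁ * (E₁ ^ 2 * E₂ * e₁ * e₂) + d₂ * (E₁ * E₂ ^ 2 * e₁ * e₂)
        + f₁ * (E₁ ^ 2 * E₂ ^ 2 * e₁ * e₂ ^ 2) + f₂ * (E₁ ^ 2 * E₂ ^ 2 * e₁ ^ 2 * e₂) := by
  -- Exchanging the indices 1 and 2 permutes rows and columns; here and below the combined sign is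
  -- -1 and is absorbed by the prefactor, which changes sign too.
  have ho : det₄ p₂₁ p₁₁ t₁₂ t₁₁ 1 1 1 1 s₂₂ s₁₂ p₂₂ p₂₁ s₁₂ s₁₁ p₁₂ p₁₁
      = -det₄ p₁₁ p₂₁ t₁₁ t₁₂ 1 1 1 1 s₁₁ s₁₂ p₁₁ p₁₂ s₁₂ s₂₂ p₂₁ p₂₂ := by
    simp only [det₄_laplace]
    ring
  rw [ho] at o₂
  have e₃ : det₃ p₂₁ p₁₁ t₁₁ 1 1 1 s₁₂ s₁₁ p₁₁ = -det₃ p₁₁ p₂₁ t₁₁ 1 1 1 s₁₁ s₁₂ p₁₁ := by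
    simp only [det₃]
    ring
  have e₄ : det₃ p₂₂ p₁₂ t₂₂ 1 1 1 s₁₂ s₁₁ p₁₂ = -det₃ p₁₂ p₂₂ t₂₂ 1 1 1 s₁₁ s₁₂ p₁₂ := by
    simp only [det₃]
    ring
  have g₁ : det₃ 1 1 1 s₂₂ p₂₁ p₂₂ s₁₂ p₁₁ p₁₂ = -det₃ 1 1 1 s₁₂ p₁₁ p₁₂ s₂₂ p₂₁ p₂₂ := by
    simp only [det₃]
    ring
  have g₂ : det₃ p₂₁ p₁₁ t₁₂ 1 1 1 s₂₂ s₁₂ p₂₂ = -det₃ p₁₁ p₂₁ t₁₂ 1 1 1 s₁₂ s₂₂ p₂₂ := by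
    simp only [det₃]
    ring
  have g₃ : det₃ p₂₂ p₁₂ t₁₂ 1 1 1 s₂₂ s₁₂ p₂₁ = -det₃ p₁₂ p₂₂ t₁₂ 1 1 1 s₁₂ s₂₂ p₂₁ := by
    simp only [det₃]
    ring
  rw [e₃] at r₃
  rw [e₄] at r₄
  rw [g₁, g₂, g₃] at k₂
  subst q₁ q₂ q₃ q₄ m₁ m₂ r₁ r₂ r₃ r₄ k₁ k₂ o₁ o₂
  simp only [numeratorExpansion]
  ring

theorem numeratorExpansion_eq (hz₁ : z₁ ≠ 0) (hz₂ : z₂ ≠ 0) (h₁₁ : z₁ + conj z₁ ≠ 0)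
    (h₁₂ : z₁ + conj z₂ ≠ 0) (h₂₁ : z₂ + conj z₁ ≠ 0) (h₂₂ : z₂ + conj z₂ ≠ 0)
    (hz : z₁ + z₂ ≠ 0) (hy : conj z₁ + conj z₂ ≠ 0) (E₁ E₂ : ℂ) :
    numeratorExpansion E₁ E₂ (conj E₁) (conj E₂) (1 / (z₁ + conj z₁)) (1 / (z₁ + conj z₂))
        (1 / (z₂ + conj z₁)) (1 / (z₂ + conj z₂)) (1 / (2 * z₁)) (1 / (z₁ + z₂)) (1 / (2 * z₂))
        (1 / (2 * conj z₁)) (1 / (conj z₁ + conj z₂)) (1 / (2 * conj z₂))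
      = ssHalfG z₁ z₂ E₁ E₂ + ssHalfG z₂ z₁ E₂ E₁ := by
  have hy₁ : conj z₁ ≠ 0 := (map_ne_zero _).2 hz₁
  have hy₂ : conj z₂ ≠ 0 := (map_ne_zero _).2 hz₂
  simp only [ssHalfG]
  generalize conj z₁ = y₁ at *
  generalize conj z₂ = y₂ at *
  generalize conj E₁ = e₁
  generalize conj E₂ = e₂
  have hz' : z₂ + z₁ ≠ 0 := by rwa [add_comm]
  have hy' : y₂ + y₁ ≠ 0 := by rwa [add_comm]
  have r₃ := numCoeff_quintic hz₁ hy₁ hz' h₂₁ h₁₁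
  have r₄ := numCoeff_quintic hz₁ hy₂ hz' h₂₂ h₁₂
  have k₂ := numCoeff_quintic_mixed hz₂ h₂₁ h₂₂ h₁₁ h₁₂ hz' hy
  have o₂ := numCoeff_septic hz₂ hz₁ hy₁ h₂₂ h₂₁ h₁₂ h₁₁ hz' hy'
  rw [add_comm z₂ z₁] at r₃ r₄ k₂ o₂
  rw [add_comm y₂ y₁] at o₂
  rw [numeratorExpansion_of_coefficients (numCoeff_cubic hz₁ h₁₁) (numCoeff_cubic hz₁ h₁₂)
    (numCoeff_cubic hz₂ h₂₁) (numCoeff_cubic hz₂ h₂₂) (numCoeff_mixed hz h₁₁ h₂₁)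
    (numCoeff_mixed hz h₁₂ h₂₂) (numCoeff_quintic hz₂ hy₁ hz h₁₁ h₂₁)
    (numCoeff_quintic hz₂ hy₂ hz h₁₂ h₂₂) r₃ r₄
    (numCoeff_quintic_mixed hz₁ h₁₁ h₁₂ h₂₁ h₂₂ hz hy) k₂
    (numCoeff_septic hz₁ hz₂ hy₂ h₁₁ h₁₂ h₂₁ h₂₂ hz hy) o₂]
  clear * -
  rw [add_comm z₂ z₁, add_comm y₂ y₁, ← neg_sub z₁ z₂, ← neg_sub y₁ y₂]
  generalize z₁ - z₂ = v₁
  generalize y₁ - y₂ = v₂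
  generalize z₁ - y₁ = v₁₁
  generalize z₁ - y₂ = v₁₂
  generalize z₂ - y₁ = v₂₁
  generalize z₂ - y₂ = v₂₂
  generalize z₁ + z₂ = u₁
  generalize y₁ + y₂ = u₂
  generalize z₁ + y₁ = u₁₁
  generalize z₁ + y₂ = u₁₂
  generalize z₂ + y₁ = u₂₁
  generalize z₂ + y₂ = u₂₂
  ring

theorem det_mul_moment_waveNumbers (hz₁ : z₁ ≠ 0) (hz₂ : z₂ ≠ 0) (h₁₁ : z₁ + conj z₁ ≠ 0)
    (h₁₂ : z₁ + conj z₂ ≠ 0) (h₂₁ : z₂ + conj z₁ ≠ 0) (h₂₂ : z₂ + conj z₂ ≠ 0)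
    (hz : z₁ + z₂ ≠ 0) (hy : conj z₁ + conj z₂ ≠ 0) {t x : ℝ}
    (h : (flowTau (waveNumbers z₁ z₂) (amplitudes A₁ A₂) conjPerm t x).det ≠ 0) :
    (flowTau (waveNumbers z₁ z₂) (amplitudes A₁ A₂) conjPerm t x).det
        * moment (waveNumbers z₁ z₂) (amplitudes A₁ A₂) conjPerm 0 t x
      = ssG z₁ z₂ A₁ A₂ t x := by
  have e : (fun i => waveNumbers z₁ z₂ i ^ 0) = 1 := funext fun i => pow_zero _
  rw [moment, e, det_mul_dotProduct_inv _ h, expVec_amplitudes, flowTau_waveNumbers,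
    det_one_add_blockGram_add, det_one_add_blockGram, add_sub_cancel_left,
    numeratorExpansion_eq hz₁ hz₂ h₁₁ h₁₂ h₂₁ h₂₂ hz hy, ssG]

end Expansion

/-! ### A positive value of the tau function on every line t = const -/

section Positivity

open Filter Topology

variable {l : Filter ℝ}

theorem norm_hirotaExp (z A : ℂ) (t x : ℝ) :
    ‖hirotaExp z A t x‖ = ‖A‖ * Real.exp (z.re * x - (z ^ 3).re * t) := by
  rw [hirotaExp, norm_mul, Complex.norm_exp]
  simp

theorem hirotaExp_ne_zero {z A : ℂ} (hA : A ≠ 0) (t x : ℝ) : hirotaExp z A t x ≠ 0 :=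
  mul_ne_zero hA (Complex.exp_ne_zero _)

theorem inv_hirotaExp (z A : ℂ) (t x : ℝ) :
    (hirotaExp z A t x)⁻¹ = hirotaExp (-z) A⁻¹ t x := by
  rw [hirotaExp, hirotaExp, mul_inv, ← Complex.exp_neg]
  congr 2
  ring

theorem tendsto_hirotaExp_zero {z : ℂ} (A : ℂ) (t : ℝ)
    (h : Tendsto (fun x : ℝ => z.re * x) l atBot) :
    Tendsto (fun x => hirotaExp z A t x) l (𝓝 0) := by
  rw [tendsto_zero_iff_norm_tendsto_zero]
  simp only [norm_hirotaExp]
  have h' : Tendsto (fun x : ℝ => z.re * x - (z ^ 3).re * t) l atBot := by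
    simpa only [sub_eq_add_neg] using tendsto_atBot_add_const_right l (-((z ^ 3).re * t)) h
  simpa using (Real.tendsto_exp_atBot.comp h').const_mul ‖A‖

theorem continuous_tauExpansion {X : Type*} [TopologicalSpace X] {E₁ E₂ e₁ e₂ : X → ℂ}
    (h₁ : Continuous E₁) (h₂ : Continuous E₂) (h₃ : Continuous e₁) (h₄ : Continuous e₂)
    (p₁₁ p₁₂ p₂₁ p₂₂ s₁₁ s₁₂ s₂₂ t₁₁ t₁₂ t₂₂ : ℂ) :
    Continuous fun z => tauExpansion (E₁ z) (E₂ z) (e₁ z) (e₂ z)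
      p₁₁ p₁₂ p₂₁ p₂₂ s₁₁ s₁₂ s₂₂ t₁₁ t₁₂ t₂₂ := by
  simp only [tauExpansion]
  fun_prop

theorem exists_re_tauExpansion_pos_of_tendsto_zero [l.NeBot] {f g : ℝ → ℂ}
    (hf : Tendsto f l (𝓝 0)) (hg : Tendsto g l (𝓝 0))
    (p₁₁ p₁₂ p₂₁ p₂₂ s₁₁ s₁₂ s₂₂ t₁₁ t₁₂ t₂₂ : ℂ) :
    ∃ x, 0 < (tauExpansion (f x) (g x) (conj (f x)) (conj (g x))
      p₁₁ p₁₂ p₂₁ p₂₂ s₁₁ s₁₂ s₂₂ t₁₁ t₁₂ t₂₂).re := by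
  have hc : Continuous fun z : ℂ × ℂ => (tauExpansion z.1 z.2 (conj z.1) (conj z.2)
      p₁₁ p₁₂ p₂₁ p₂₂ s₁₁ s₁₂ s₂₂ t₁₁ t₁₂ t₂₂).re :=
    Complex.continuous_re.comp (continuous_tauExpansion continuous_fst continuous_snd
      (Complex.continuous_conj.comp continuous_fst) (Complex.continuous_conj.comp continuous_snd)
      _ _ _ _ _ _ _ _ _ _)
  have h := (hc.tendsto (0, 0)).comp (hf.prodMk_nhds hg)
  have h₀ : (tauExpansion 0 0 (conj 0) (conj 0)
      p₁₁ p₁₂ p₂₁ p₂₂ s₁₁ s₁₂ s₂₂ t₁₁ t₁₂ t₂₂).re = 1 := by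
    simp [tauExpansion]
  exact (h.eventually (lt_mem_nhds (by rw [h₀]; exact one_pos))).exists

/-- After division by |g|⁴ the tau function is a polynomial in f, 1/g and their conjugates whose
constant term is the coefficient of |E₂|⁴. -/
theorem exists_re_tauExpansion_pos_of_tendsto_inv_zero [l.NeBot] {f g : ℝ → ℂ}
    (hf : Tendsto f l (𝓝 0)) (hg : Tendsto (fun x => (g x)⁻¹) l (𝓝 0)) (hg₀ : ∀ x, g x ≠ 0)
    {p₁₁ p₁₂ p₂₁ p₂₂ s₁₁ s₁₂ s₂₂ t₁₁ t₁₂ t₂₂ : ℂ}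
    (h : 0 < (4 * p₂₂ ^ 2 * (p₂₂ ^ 2 - s₂₂ * t₂₂)).re) :
    ∃ x, 0 < (tauExpansion (f x) (g x) (conj (f x)) (conj (g x))
      p₁₁ p₁₂ p₂₁ p₂₂ s₁₁ s₁₂ s₂₂ t₁₁ t₁₂ t₂₂).re := by
  -- P is w²W² times the expansion, with u = f, v = f̄ and w = 1/g, W = 1/ḡ substituted, so it is
  -- continuous at the origin.
  obtain ⟨P, hP⟩ : ∃ P : ℂ → ℂ → ℂ → ℂ → ℂ, P = fun u v w W =>
      w ^ 2 * W ^ 2 + 4 * p₁₁ ^ 2 * (u * v * w ^ 2 * W ^ 2) + 4 * p₂₂ ^ 2 * (w * W)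
      + 4 * p₁₂ ^ 2 * (u * w ^ 2 * W) + 4 * p₂₁ ^ 2 * (v * w * W ^ 2)
      + 4 * p₁₁ ^ 2 * (p₁₁ ^ 2 - s₁₁ * t₁₁) * (u ^ 2 * v ^ 2 * w ^ 2 * W ^ 2)
      + 4 * p₂₂ ^ 2 * (p₂₂ ^ 2 - s₂₂ * t₂₂)
      + 4 * p₁₂ ^ 2 * (p₁₂ ^ 2 - s₁₁ * t₂₂) * (u ^ 2 * w ^ 2)
      + 4 * p₂₁ ^ 2 * (p₂₁ ^ 2 - s₂₂ * t₁₁) * (v ^ 2 * W ^ 2)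
      + 8 * (p₁₁ * p₁₂) * (p₁₁ * p₁₂ - s₁₁ * t₁₂) * (u ^ 2 * v * w ^ 2 * W)
      + 8 * (p₂₁ * p₂₂) * (p₂₁ * p₂₂ - s₂₂ * t₁₂) * (v * W)
      + 8 * (p₁₁ * p₂₁) * (p₁₁ * p₂₁ - s₁₂ * t₁₁) * (u * v ^ 2 * w * W ^ 2)
      + 8 * (p₁₂ * p₂₂) * (p₁₂ * p₂₂ - s₁₂ * t₂₂) * (u * w)
      + 8 * ((p₁₁ * p₂₂ - p₁₂ * p₂₁) ^ 2 + p₁₁ * p₂₂ * (p₁₁ * p₂₂ - s₁₂ * t₁₂)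
          + p₁₂ * p₂₁ * (p₁₂ * p₂₁ - s₁₂ * t₁₂)) * (u * v * w * W)
      + 16 * (p₁₁ * p₂₂ - p₁₂ * p₂₁) * p₁₁ * det₃ p₁₁ p₂₁ t₁₁ p₁₂ p₂₂ t₁₂ s₁₁ s₁₂ p₁₁
          * (u ^ 2 * v ^ 2 * w * W)
      + 16 * (p₁₁ * p₂₂ - p₁₂ * p₂₁) * p₂₂ * det₃ p₁₁ p₂₁ t₁₂ p₁₂ p₂₂ t₂₂ s₁₂ s₂₂ p₂₂
          * (u * v)
      + 16 * (p₁₁ * p₂₂ - p₁₂ * p₂₁) * p₁₂ * det₃ p₁₁ p₂₁ t₁₂ p₁₂ p₂₂ t₂₂ s₁₁ s₁₂ p₁₂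
          * (u ^ 2 * v * w)
      + 16 * (p₁₁ * p₂₂ - p₁₂ * p₂₁) * p₂₁ * det₃ p₁₁ p₂₁ t₁₁ p₁₂ p₂₂ t₁₂ s₁₂ s₂₂ p₂₁
          * (u * v ^ 2 * W)
      + 16 * (p₁₁ * p₂₂ - p₁₂ * p₂₁) ^ 2
          * det₄ p₁₁ p₂₁ t₁₁ t₁₂ p₁₂ p₂₂ t₁₂ t₂₂ s₁₁ s₁₂ p₁₁ p₁₂ s₁₂ s₂₂ p₂₁ p₂₂
          * (u ^ 2 * v ^ 2) := ⟨_, rfl⟩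
  have hc : Continuous fun z : ℂ × ℂ => (P z.1 (conj z.1) z.2 (conj z.2)).re := by
    rw [hP]
    fun_prop
  have hl := (hc.tendsto (0, 0)).comp (hf.prodMk_nhds hg)
  have h₀ : P 0 (conj 0) 0 (conj 0) = 4 * p₂₂ ^ 2 * (p₂₂ ^ 2 - s₂₂ * t₂₂) := by
    simp [hP]
  obtain ⟨x, hx⟩ := (hl.eventually (lt_mem_nhds (by rw [h₀]; exact h))).exists
  refine ⟨x, ?_⟩
  have e : P (f x) (conj (f x)) (g x)⁻¹ (conj (g x)⁻¹)
      = ((Complex.normSq (g x)⁻¹ ^ 2 : ℝ) : ℂ)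
        * tauExpansion (f x) (g x) (conj (f x)) (conj (g x))
          p₁₁ p₁₂ p₂₁ p₂₂ s₁₁ s₁₂ s₂₂ t₁₁ t₁₂ t₂₂ := by
    have hx₀ := hg₀ x
    have hx₁ : conj (g x) ≠ 0 := (map_ne_zero _).2 hx₀
    rw [Complex.ofReal_pow, Complex.normSq_eq_conj_mul_self, map_inv₀]
    simp only [hP, tauExpansion]
    generalize conj (f x) = v
    generalize conj (g x) = e at *
    generalize f x = u
    generalize g x = E at *
    generalize (det₃ _ _ _ _ _ _ _ _ _ : ℂ) = q₁
    generalize (det₃ _ _ _ _ _ _ _ _ _ : ℂ) = q₂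
    generalize (det₃ _ _ _ _ _ _ _ _ _ : ℂ) = q₃
    generalize (det₃ _ _ _ _ _ _ _ _ _ : ℂ) = q₄
    generalize (det₄ _ _ _ _ _ _ _ _ _ _ _ _ _ _ _ _ : ℂ) = q
    field_simp
  have hx' : 0 < (P (f x) (conj (f x)) (g x)⁻¹ (conj (g x)⁻¹)).re := hx
  rw [e, Complex.re_ofReal_mul] at hx'
  exact (pos_iff_pos_of_mul_pos hx').1
    (pow_pos (Complex.normSq_pos.2 (inv_ne_zero (hg₀ x))) 2)

/-- The sign comes from (2 Re z)² < 4|z|², strict since Im z ≠ 0. -/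
theorem re_tauCoeff_pos {z : ℂ} (hr : z.re ≠ 0) (hi : z.im ≠ 0) :
    0 < (4 * (1 / (z + conj z)) ^ 2
      * ((1 / (z + conj z)) ^ 2 - 1 / (2 * z) * (1 / (2 * conj z)))).re := by
  have h₁ : z + conj z = ((2 * z.re : ℝ) : ℂ) := Complex.add_conj z
  have h₂ : 1 / (2 * z) * (1 / (2 * conj z)) = ((1 / (4 * Complex.normSq z) : ℝ) : ℂ) := by
    push_cast
    rw [← Complex.mul_conj, div_mul_div_comm]
    congr 1 <;> ring
  rw [h₁, h₂, show (4 : ℂ) = ((4 : ℝ) : ℂ) by norm_num, ← Complex.ofReal_one]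
  norm_cast
  have h₃ : 0 < z.re ^ 2 := by positivity
  have h₄ : 0 < z.im ^ 2 := by positivity
  have h₅ : 1 / (4 * Complex.normSq z) < (1 / (2 * z.re)) ^ 2 := by
    rw [Complex.normSq_apply, div_pow, one_pow]
    refine one_div_lt_one_div_of_lt (by positivity) ?_
    nlinarith
  have h₆ : 0 < (1 / (2 * z.re)) ^ 2 := by positivity
  have := mul_pos (mul_pos (zero_lt_four (α := ℝ)) h₆) (sub_pos.2 h₅)
  exact this

/-- Take the end of the x-axis at which E₁ → 0. There E₂ → 0 if the real parts have equal signs, and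
then the limit is 1; otherwise 1/E₂ → 0, and the |E₂|⁴ term decides. -/
theorem exists_re_tauExpansion_pos {z₁ z₂ A₁ A₂ : ℂ} (hr₁ : z₁.re ≠ 0) (hr₂ : z₂.re ≠ 0)
    (hi₂ : z₂.im ≠ 0) (hA₂ : A₂ ≠ 0) (t : ℝ) (p₁₁ p₁₂ p₂₁ s₁₁ s₁₂ t₁₁ t₁₂ : ℂ) :
    ∃ x, 0 < (tauExpansion (hirotaExp z₁ A₁ t x) (hirotaExp z₂ A₂ t x)
      (conj (hirotaExp z₁ A₁ t x)) (conj (hirotaExp z₂ A₂ t x))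
      p₁₁ p₁₂ p₂₁ (1 / (z₂ + conj z₂)) s₁₁ s₁₂ (1 / (2 * z₂)) t₁₁ t₁₂
        (1 / (2 * conj z₂))).re := by
  have hinv {l : Filter ℝ} (h : Tendsto (fun x : ℝ => (-z₂).re * x) l atBot) :
      Tendsto (fun x => (hirotaExp z₂ A₂ t x)⁻¹) l (𝓝 0) := by
    simpa only [inv_hirotaExp] using tendsto_hirotaExp_zero A₂⁻¹ t h
  have htop {z : ℂ} (h : z.re < 0) : Tendsto (fun x : ℝ => z.re * x) atTop atBot :=
    tendsto_id.const_mul_atTop_of_neg h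
  have hbot {z : ℂ} (h : 0 < z.re) : Tendsto (fun x : ℝ => z.re * x) atBot atBot :=
    tendsto_id.const_mul_atBot h
  have hpos := re_tauCoeff_pos hr₂ hi₂
  have hA := hirotaExp_ne_zero (z := z₂) hA₂ t
  rcases hr₁.lt_or_gt with h₁ | h₁ <;> rcases hr₂.lt_or_gt with h₂ | h₂
  · exact exists_re_tauExpansion_pos_of_tendsto_zero (tendsto_hirotaExp_zero A₁ t (htop h₁))
      (tendsto_hirotaExp_zero A₂ t (htop h₂)) _ _ _ _ _ _ _ _ _ _
  · exact exists_re_tauExpansion_pos_of_tendsto_inv_zero (tendsto_hirotaExp_zero A₁ t (htop h₁))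
      (hinv (htop (by simpa using h₂))) hA hpos
  · exact exists_re_tauExpansion_pos_of_tendsto_inv_zero (tendsto_hirotaExp_zero A₁ t (hbot h₁))
      (hinv (hbot (by simpa using h₂))) hA hpos
  · exact exists_re_tauExpansion_pos_of_tendsto_zero (tendsto_hirotaExp_zero A₁ t (hbot h₁))
      (tendsto_hirotaExp_zero A₂ t (hbot h₂)) _ _ _ _ _ _ _ _ _ _

end Positivity

/-! ### Smoothness of F and G -/

section Smoothness

variable {E : Type*} [NormedAddCommGroup E] [NormedSpace ℝ E] {E₁ E₂ : E → ℂ} {n : WithTop ℕ∞}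

theorem contDiff_conj_comp {f : E → ℂ} (hf : ContDiff ℝ n f) :
    ContDiff ℝ n fun q => conj (f q) :=
  Complex.conjCLE.contDiff.comp hf

theorem contDiff_hirotaExp (z A : ℂ) :
    ContDiff ℝ n fun q : ℝ × ℝ => hirotaExp z A q.1 q.2 := by
  have h₁ : ContDiff ℝ n fun q : ℝ × ℝ => (q.1 : ℂ) := Complex.ofRealCLM.contDiff.comp contDiff_fst
  have h₂ : ContDiff ℝ n fun q : ℝ × ℝ => (q.2 : ℂ) := Complex.ofRealCLM.contDiff.comp contDiff_snd
  exact contDiff_const.mul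
    (((contDiff_const.mul h₂).sub (contDiff_const.mul h₁)).cexp)

theorem contDiff_ssHalfG (z₁ z₂ : ℂ) (h₁ : ContDiff ℝ n E₁) (h₂ : ContDiff ℝ n E₂) :
    ContDiff ℝ n fun q => ssHalfG z₁ z₂ (E₁ q) (E₂ q) := by
  have h₃ := contDiff_conj_comp h₁
  have h₄ := contDiff_conj_comp h₂
  simp only [ssHalfG]
  fun_prop

theorem contDiff_ssHalfF (z₁ z₂ : ℂ) (h₁ : ContDiff ℝ n E₁) (h₂ : ContDiff ℝ n E₂) :
    ContDiff ℝ n fun q => ssHalfF z₁ z₂ (E₁ q) (E₂ q) := by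
  have h₃ := contDiff_conj_comp h₁
  have h₄ := contDiff_conj_comp h₂
  simp only [ssHalfF]
  fun_prop

theorem contDiff_ssDiagF (z₁ z₂ : ℂ) (h₁ : ContDiff ℝ n E₁) (h₂ : ContDiff ℝ n E₂) :
    ContDiff ℝ n fun q => ssDiagF z₁ z₂ (E₁ q) (E₂ q) := by
  have h₃ := contDiff_conj_comp h₁
  have h₄ := contDiff_conj_comp h₂
  simp only [ssDiagF]
  fun_prop

theorem contDiff_ssG (z₁ z₂ A₁ A₂ : ℂ) :
    ContDiff ℝ n fun q : ℝ × ℝ => ssG z₁ z₂ A₁ A₂ q.1 q.2 :=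
  (contDiff_ssHalfG z₁ z₂ (contDiff_hirotaExp z₁ A₁) (contDiff_hirotaExp z₂ A₂)).add
    (contDiff_ssHalfG z₂ z₁ (contDiff_hirotaExp z₂ A₂) (contDiff_hirotaExp z₁ A₁))

theorem contDiff_ssF (z₁ z₂ A₁ A₂ : ℂ) :
    ContDiff ℝ n fun q : ℝ × ℝ => ssF z₁ z₂ A₁ A₂ q.1 q.2 :=
  have h := contDiff_ssHalfF z₁ z₂ (contDiff_hirotaExp z₁ A₁) (contDiff_hirotaExp z₂ A₂)
  ((contDiff_const.add (contDiff_ssDiagF z₁ z₂ (contDiff_hirotaExp z₁ A₁)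
    (contDiff_hirotaExp z₂ A₂))).add h).add (contDiff_conj_comp h)

end Smoothness

/-! ### The 2-soliton solves the equation -/

section Soliton

variable {p : ModParams}

/-- The quotient w/k is -(k² - 3κ²). Since this depends only on k² and κ², distinct speeds exclude
z₁ = ±z₂ and z₁ = ±z̄₂, which makes every denominator nonzero. -/
theorem sq_ne_of_speeds_ne (hk₁ : p.k₁ ≠ 0) (hk₂ : p.k₂ ≠ 0) (hw : p.w₁ / p.k₁ ≠ p.w₂ / p.k₂) :
    p.k₁ ^ 2 - 3 * p.κ₁ ^ 2 ≠ p.k₂ ^ 2 - 3 * p.κ₂ ^ 2 := by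
  intro h
  apply hw
  rw [div_eq_div_iff hk₁ hk₂, ModParams.w₁, ModParams.w₂]
  linear_combination -p.k₁ * p.k₂ * h

theorem z₁_ne_zero (hk₁ : p.k₁ ≠ 0) : p.z₁ ≠ 0 := fun h => hk₁ (congrArg Complex.re h)

theorem z₂_ne_zero (hk₂ : p.k₂ ≠ 0) : p.z₂ ≠ 0 := fun h => hk₂ (congrArg Complex.re h)

theorem z_add_conj_ne_zero {z : ℂ} (h : z.re ≠ 0) : z + conj z ≠ 0 := by
  rw [Complex.add_conj]
  exact_mod_cast mul_ne_zero two_ne_zero h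

theorem z₁_add_z₂_ne_zero (hq : p.k₁ ^ 2 - 3 * p.κ₁ ^ 2 ≠ p.k₂ ^ 2 - 3 * p.κ₂ ^ 2) :
    p.z₁ + p.z₂ ≠ 0 := by
  intro h
  have hr : p.k₁ + p.k₂ = 0 := congrArg Complex.re h
  have hi : p.κ₁ + p.κ₂ = 0 := congrArg Complex.im h
  exact hq (by linear_combination (p.k₁ - p.k₂) * hr - 3 * (p.κ₁ - p.κ₂) * hi)

theorem z₁_sub_z₂_ne_zero (hq : p.k₁ ^ 2 - 3 * p.κ₁ ^ 2 ≠ p.k₂ ^ 2 - 3 * p.κ₂ ^ 2) :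
    p.z₁ - p.z₂ ≠ 0 := by
  intro h
  have hr : p.k₁ - p.k₂ = 0 := congrArg Complex.re h
  have hi : p.κ₁ - p.κ₂ = 0 := congrArg Complex.im h
  exact hq (by linear_combination (p.k₁ + p.k₂) * hr - 3 * (p.κ₁ + p.κ₂) * hi)

theorem z₁_add_conj_z₂_ne_zero (hq : p.k₁ ^ 2 - 3 * p.κ₁ ^ 2 ≠ p.k₂ ^ 2 - 3 * p.κ₂ ^ 2) :
    p.z₁ + conj p.z₂ ≠ 0 := by
  intro h
  have hr : p.k₁ + p.k₂ = 0 := congrArg Complex.re h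
  have hi : p.κ₁ + -p.κ₂ = 0 := congrArg Complex.im h
  exact hq (by linear_combination (p.k₁ - p.k₂) * hr - 3 * (p.κ₁ + p.κ₂) * hi)

theorem z₁_sub_conj_z₂_ne_zero (hq : p.k₁ ^ 2 - 3 * p.κ₁ ^ 2 ≠ p.k₂ ^ 2 - 3 * p.κ₂ ^ 2) :
    p.z₁ - conj p.z₂ ≠ 0 := by
  intro h
  have hr : p.k₁ - p.k₂ = 0 := congrArg Complex.re h
  have hi : p.κ₁ - -p.κ₂ = 0 := congrArg Complex.im h
  exact hq (by linear_combination (p.k₁ + p.k₂) * hr - 3 * (p.κ₁ - p.κ₂) * hi)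

theorem z₂_add_conj_z₁_ne_zero (hq : p.k₁ ^ 2 - 3 * p.κ₁ ^ 2 ≠ p.k₂ ^ 2 - 3 * p.κ₂ ^ 2) :
    p.z₂ + conj p.z₁ ≠ 0 := by
  have h := (map_ne_zero conj).2 (z₁_add_conj_z₂_ne_zero hq)
  rwa [map_add, Complex.conj_conj, add_comm] at h

theorem conj_z₁_add_conj_z₂_ne_zero
    (hq : p.k₁ ^ 2 - 3 * p.κ₁ ^ 2 ≠ p.k₂ ^ 2 - 3 * p.κ₂ ^ 2) :
    conj p.z₁ + conj p.z₂ ≠ 0 := by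
  have h := (map_ne_zero conj).2 (z₁_add_z₂_ne_zero hq)
  rwa [map_add] at h

theorem waveNumbers_add_conj_ne_zero (hk₁ : p.k₁ ≠ 0) (hk₂ : p.k₂ ≠ 0)
    (hq : p.k₁ ^ 2 - 3 * p.κ₁ ^ 2 ≠ p.k₂ ^ 2 - 3 * p.κ₂ ^ 2) (i j : Fin 4) :
    waveNumbers p.z₁ p.z₂ i + conj (waveNumbers p.z₁ p.z₂ j) ≠ 0 := by
  have h₁₁ : p.z₁ + conj p.z₁ ≠ 0 := z_add_conj_ne_zero hk₁
  have h₂₂ : p.z₂ + conj p.z₂ ≠ 0 := z_add_conj_ne_zero hk₂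
  have h₁₂ := z₁_add_conj_z₂_ne_zero hq
  have h₂₁ := z₂_add_conj_z₁_ne_zero hq
  have hz := z₁_add_z₂_ne_zero hq
  have hy := conj_z₁_add_conj_z₂_ne_zero hq
  have d {z : ℂ} (h : z ≠ 0) : z + z ≠ 0 := by
    rw [← two_mul]
    exact mul_ne_zero two_ne_zero h
  have h₁ := d (z₁_ne_zero hk₁)
  have h₂ := d (z₂_ne_zero hk₂)
  have h₁' := d ((map_ne_zero conj).2 (z₁_ne_zero hk₁))
  have h₂' := d ((map_ne_zero conj).2 (z₂_ne_zero hk₂))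
  have cc (z : ℂ) : conj (conj z) = z := Complex.conj_conj z
  fin_cases i <;> fin_cases j <;>
    simp only [waveNumbers, Fin.reduceFinMk, Matrix.cons_val, Fin.zero_eta, Fin.mk_one, cc] <;>
    first | assumption | (rw [add_comm]; assumption)

variable {A₁ A₂ : ℂ}

theorem det_flowTau_eq_ssF (hk₁ : p.k₁ ≠ 0) (hk₂ : p.k₂ ≠ 0)
    (hq : p.k₁ ^ 2 - 3 * p.κ₁ ^ 2 ≠ p.k₂ ^ 2 - 3 * p.κ₂ ^ 2) (t x : ℝ) :
    (flowTau (waveNumbers p.z₁ p.z₂) (amplitudes A₁ A₂) conjPerm t x).det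
      = ssF p.z₁ p.z₂ A₁ A₂ t x :=
  det_flowTau_waveNumbers (z₁_ne_zero hk₁) (z₂_ne_zero hk₂) (z_add_conj_ne_zero hk₁)
    (z₁_add_conj_z₂_ne_zero hq) (z₂_add_conj_z₁_ne_zero hq) (z_add_conj_ne_zero hk₂)
    (z₁_add_z₂_ne_zero hq) (conj_z₁_add_conj_z₂_ne_zero hq) _ _ t x

theorem det_flowTau_waveNumbers_ne_zero (hk₁ : p.k₁ ≠ 0) (hk₂ : p.k₂ ≠ 0)
    (hq : p.k₁ ^ 2 - 3 * p.κ₁ ^ 2 ≠ p.k₂ ^ 2 - 3 * p.κ₂ ^ 2) (hκ₂ : p.κ₂ ≠ 0) (hA₂ : A₂ ≠ 0)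
    (t x : ℝ) :
    (flowTau (waveNumbers p.z₁ p.z₂) (amplitudes A₁ A₂) conjPerm t x).det ≠ 0 := by
  obtain ⟨x₁, h⟩ := exists_re_tauExpansion_pos (z₁ := p.z₁) (z₂ := p.z₂) (A₁ := A₁) hk₁ hk₂ hκ₂
    hA₂ t _ _ _ _ _ _ _
  refine det_flowTau_ne_zero conjPerm_conjPerm (waveNumbers_conjPerm _ _)
    (waveNumbers_add_conj_ne_zero hk₁ hk₂ hq) (x₁ := x₁) ?_ x
  rw [flowTau_waveNumbers, det_one_add_blockGram]
  exact h

theorem ssF_ne_zero (hk₁ : p.k₁ ≠ 0) (hk₂ : p.k₂ ≠ 0)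
    (hq : p.k₁ ^ 2 - 3 * p.κ₁ ^ 2 ≠ p.k₂ ^ 2 - 3 * p.κ₂ ^ 2) (hκ₂ : p.κ₂ ≠ 0) (hA₂ : A₂ ≠ 0)
    (t x : ℝ) : ssF p.z₁ p.z₂ A₁ A₂ t x ≠ 0 := by
  rw [← det_flowTau_eq_ssF hk₁ hk₂ hq]
  exact det_flowTau_waveNumbers_ne_zero hk₁ hk₂ hq hκ₂ hA₂ t x

theorem ssF_mul_moment (hk₁ : p.k₁ ≠ 0) (hk₂ : p.k₂ ≠ 0)
    (hq : p.k₁ ^ 2 - 3 * p.κ₁ ^ 2 ≠ p.k₂ ^ 2 - 3 * p.κ₂ ^ 2) (hκ₂ : p.κ₂ ≠ 0) (hA₂ : A₂ ≠ 0)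
    (t x : ℝ) :
    ssF p.z₁ p.z₂ A₁ A₂ t x * moment (waveNumbers p.z₁ p.z₂) (amplitudes A₁ A₂) conjPerm 0 t x
      = ssG p.z₁ p.z₂ A₁ A₂ t x := by
  rw [← det_flowTau_eq_ssF hk₁ hk₂ hq]
  exact det_mul_moment_waveNumbers (z₁_ne_zero hk₁) (z₂_ne_zero hk₂) (z_add_conj_ne_zero hk₁)
    (z₁_add_conj_z₂_ne_zero hq) (z₂_add_conj_z₁_ne_zero hq) (z_add_conj_ne_zero hk₂)
    (z₁_add_z₂_ne_zero hq) (conj_z₁_add_conj_z₂_ne_zero hq)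
    (det_flowTau_waveNumbers_ne_zero hk₁ hk₂ hq hκ₂ hA₂ t x)

/-- The 2-soliton satisfies the bilinear system. -/
theorem exists_isSasaSatsumaBilinear (hk₁ : p.k₁ ≠ 0) (hk₂ : p.k₂ ≠ 0)
    (hq : p.k₁ ^ 2 - 3 * p.κ₁ ^ 2 ≠ p.k₂ ^ 2 - 3 * p.κ₂ ^ 2) (hκ₂ : p.κ₂ ≠ 0) (hA₂ : A₂ ≠ 0) :
    ∃ H : ℝ → ℝ → ℂ,
      IsSasaSatsumaBilinear (ssG p.z₁ p.z₂ A₁ A₂) (ssF p.z₁ p.z₂ A₁ A₂) H := by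
  have h := moment_bilinear conjPerm_conjPerm (waveNumbers_conjPerm p.z₁ p.z₂)
    (waveNumbers_add_conj_ne_zero hk₁ hk₂ hq)
    (det_flowTau_waveNumbers_ne_zero (A₁ := A₁) hk₁ hk₂ hq hκ₂ hA₂)
  simp only [det_flowTau_eq_ssF hk₁ hk₂ hq, ssF_mul_moment hk₁ hk₂ hq hκ₂ hA₂] at h
  exact ⟨_, h⟩

/-- The 2-soliton is a smooth solution of the Sasa-Satsuma equation. -/
theorem isSasaSatsumaSolution_ssTwoSoliton (hk₁ : p.k₁ ≠ 0) (hk₂ : p.k₂ ≠ 0)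
    (hq : p.k₁ ^ 2 - 3 * p.κ₁ ^ 2 ≠ p.k₂ ^ 2 - 3 * p.κ₂ ^ 2) (hκ₂ : p.κ₂ ≠ 0) (hA₂ : A₂ ≠ 0) :
    IsSasaSatsumaSolution (ssTwoSoliton p.z₁ p.z₂ A₁ A₂) := by
  have hs := (contDiff_ssG (n := ∞) p.z₁ p.z₂ A₁ A₂).mul ((contDiff_ssF p.z₁ p.z₂ A₁ A₂).inv
    fun q => ssF_ne_zero hk₁ hk₂ hq hκ₂ hA₂ q.1 q.2)
  refine ⟨(funext fun q => div_eq_mul_inv (ssG p.z₁ p.z₂ A₁ A₂ q.1 q.2) _ :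
    (fun q : ℝ × ℝ => ssTwoSoliton p.z₁ p.z₂ A₁ A₂ q.1 q.2) = _) ▸ hs, ?_⟩
  -- Since G = F·m₀, the quotient is m₀, to which the dressing result applies.
  have e : ssTwoSoliton p.z₁ p.z₂ A₁ A₂
      = moment (waveNumbers p.z₁ p.z₂) (amplitudes A₁ A₂) conjPerm 0 := by
    funext t x
    rw [ssTwoSoliton, div_eq_iff (ssF_ne_zero hk₁ hk₂ hq hκ₂ hA₂ t x),
      ← ssF_mul_moment hk₁ hk₂ hq hκ₂ hA₂, mul_comm]
  rw [e]
  exact moment_sasaSatsuma conjPerm_conjPerm (waveNumbers_conjPerm p.z₁ p.z₂)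
    (waveNumbers_add_conj_ne_zero hk₁ hk₂ hq)
    (det_flowTau_waveNumbers_ne_zero (A₁ := A₁) hk₁ hk₂ hq hκ₂ hA₂)

end Soliton

/-! ### The numerator as a sum of cosh terms -/

section CoshIdentities

/-- A parametrization of two wave numbers `z₁`, `z₂`, their conjugates `y₁`, `y₂`, and two
exponentials `E₁`, `E₂` with conjugates `e₁`, `e₂`, such that all the coefficients of the 2-soliton
become sums of monomials. -/
structure IsCoshParametrization (z₁ z₂ y₁ y₂ E₁ E₂ e₁ e₂ p q c d ℓ₁ ℓ₂ a b χ ε m₁ m₂ n₁ n₂ K₁ K₂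
    x₁ x₂ g₁ g₂ s s₁ s₂ : ℂ) : Prop where
  hp : p ≠ 0
  hq : q ≠ 0
  hc : c ≠ 0
  hd : d ≠ 0
  hℓ₁ : ℓ₁ ≠ 0
  hℓ₂ : ℓ₂ ≠ 0
  ha : a ≠ 0
  hb : b ≠ 0
  hχ : χ ≠ 0
  hε : ε ≠ 0
  hm₁ : m₁ ≠ 0
  hm₂ : m₂ ≠ 0
  hn₁ : n₁ ≠ 0
  hn₂ : n₂ ≠ 0
  hK₁ : K₁ ≠ 0
  hK₂ : K₂ ≠ 0
  hx₁ : x₁ ≠ 0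
  hx₂ : x₂ ≠ 0
  hg₁ : g₁ ≠ 0
  hg₂ : g₂ ≠ 0
  hs : s ^ 2 = -1
  hs₁ : s₁ ^ 2 = -1
  hs₂ : s₂ ^ 2 = -1
  ez₁ : z₁ = s₁ * m₁ ^ 2 / ℓ₁ ^ 2
  ez₂ : z₂ = s₂ * m₂ ^ 2 / ℓ₂ ^ 2
  ey₁ : y₁ = -s₁ * m₁ ^ 2 * ℓ₁ ^ 2
  ey₂ : y₂ = -s₂ * m₂ ^ 2 * ℓ₂ ^ 2
  ezy₁ : z₁ - y₁ = s₁ * n₁ ^ 2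
  ezy₂ : z₂ - y₂ = s₂ * n₂ ^ 2
  eS₁ : (z₁ + y₁) ^ 2 = 4 * K₁ ^ 2
  eS₂ : (z₂ + y₂) ^ 2 = 4 * K₂ ^ 2
  ep : z₁ - z₂ = p
  ep' : y₁ - y₂ = a ^ 2 / p
  eq₁ : z₁ + y₂ = q
  eq' : z₂ + y₁ = b ^ 2 / q
  ec : z₁ + z₂ = c
  ec' : y₁ + y₂ = χ ^ 4 / c
  eu : z₁ - y₂ = -ε ^ 2 * χ ^ 2 / (d ^ 2 * c)
  eu' : z₂ - y₁ = ε ^ 2 * d ^ 2 * c / χ ^ 2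
  eE₁ : E₁ = -2 * K₁ * m₁ * χ * q * c * d / (n₁ * ε * s * χ ^ 2 * p * ℓ₁) * x₁ * g₁
  ee₁ : e₁ = -2 * K₁ * m₁ * χ * b ^ 2 * p * s * χ ^ 2 * ℓ₁ / (n₁ * ε * a ^ 2 * q * c * d)
      * x₁ / g₁
  eE₂ : E₂ = 2 * K₂ * m₂ * χ * b ^ 2 / (n₂ * ε * p * q * ℓ₂ * d) * x₂ * g₂
  ee₂ : e₂ = 2 * K₂ * m₂ * χ * p * q * ℓ₂ * d / (n₂ * ε * a ^ 2) * x₂ / g₂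

/-- The part of the numerator of the 2-soliton which has the phase of the first exponential,
up to powers of the quotient of the phases. -/
def numeratorPart (z₁ z₂ y₁ y₂ E₁ E₂ e₁ e₂ : ℂ) : ℂ :=
  E₁
  + (z₁ - y₁) / (z₁ * (z₁ + y₁) ^ 2) * (E₁ ^ 2 * e₁)
  + (z₁ - y₂) / (z₁ * (z₁ + y₂) ^ 2) * (E₁ ^ 2 * e₂)
  + 2 * ((z₁ + z₂) * (z₁ - z₂) ^ 2 + (z₁ - y₂) * (z₁ + y₂) ^ 2 + (z₂ - y₂) * (z₂ + y₂) ^ 2)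
      / ((z₁ + z₂) * (z₁ + y₂) ^ 2 * (z₂ + y₂) ^ 2) * (E₁ * E₂ * e₂)
  - (z₂ - y₂) * (z₁ - z₂) ^ 2 * (z₁ - y₂) ^ 2
      / (z₁ * y₂ * (z₁ + z₂) * (z₂ + y₂) ^ 2 * (z₁ + y₂) ^ 4) * (E₁ ^ 2 * E₂ * e₂ ^ 2)
  - (z₁ - y₂) * (z₁ - z₂) ^ 2 * (z₂ - y₂) ^ 2
      / (z₂ * y₂ * (z₁ + z₂) * (z₁ + y₂) ^ 2 * (z₂ + y₂) ^ 4) * (E₁ * E₂ ^ 2 * e₂ ^ 2)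
  - 2 * (z₁ - y₁) * (z₁ - y₂) * (z₁ - z₂) ^ 2
      * ((z₂ - y₁) * (z₂ + y₁) ^ 2 + (z₂ - y₂) * (z₂ + y₂) ^ 2 - (y₁ + y₂) * (y₁ - y₂) ^ 2)
      / (z₁ * (z₁ + z₂) * (y₁ + y₂) * (z₁ + y₁) ^ 2 * (z₁ + y₂) ^ 2
          * (z₂ + y₁) ^ 2 * (z₂ + y₂) ^ 2) * (E₁ ^ 2 * E₂ * e₁ * e₂)
  + (z₁ - y₁) * (z₂ - y₁) * (z₁ - y₂) ^ 2 * (z₂ - y₂) ^ 2 * (y₁ - y₂) ^ 2 * (z₁ - z₂) ^ 4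
      / (z₁ * z₂ * y₂ * (y₁ + y₂) * (z₁ + z₂) ^ 2 * (z₁ + y₁) ^ 2
          * (z₂ + y₁) ^ 2 * (z₁ + y₂) ^ 4 * (z₂ + y₂) ^ 4) * (E₁ ^ 2 * E₂ ^ 2 * e₁ * e₂ ^ 2)

/-- `cosh` as a function of `exp`. -/
def joukowski (w : ℂ) : ℂ := (w + w⁻¹) / 2

/-- The coefficient of E₁E₂ē₂ is not a monomial in the parametrization, but each of its three
summands is; likewise for the quintic coefficient below. -/
theorem div_split_cubic {c P Q S u v : ℂ} (hc : c ≠ 0) (hQ : Q ≠ 0) (hS : S ≠ 0) :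
    2 * (c * P + u * Q + v * S) / (c * Q * S)
      = 2 * v / (c * Q) + 2 * P / (Q * S) + 2 * u / (c * S) := by
  field_simp
  ring

theorem div_split_quintic {z c y S₁ S₂ Q Q' u u' v₁ v₂ P A : ℂ} (hz : z ≠ 0) (hc : c ≠ 0)
    (hy : y ≠ 0) (hS₁ : S₁ ≠ 0) (hS₂ : S₂ ≠ 0) (hQ : Q ≠ 0) (hQ' : Q' ≠ 0) :
    2 * v₁ * u * P * (u' * Q' + v₂ * S₂ - y * A) / (z * c * y * S₁ * Q * Q' * S₂)
      = -(-2 * v₁ * u * P * v₂ / (z * c * y * S₁ * Q * Q')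
        + 2 * v₁ * u * P * A / (z * c * S₁ * Q * Q' * S₂)
        + -2 * v₁ * u * P * u' / (z * c * y * S₁ * Q * S₂)) := by
  field_simp
  ring

/-- The prefactor turns the constant term 1 of F into the lower half of the cosh(2(θ₁ + θ₂)) term of
Y. After multiplication by it the twelve monomials form six pairs w, 1/w with equal coefficients,
one for each cosh of X₁. The amplitudes in the parametrization are chosen to make these coefficients
equal. -/
theorem numeratorPart_eq {z₁ z₂ y₁ y₂ E₁ E₂ e₁ e₂ p q c d ℓ₁ ℓ₂ a b χ ε m₁ m₂ n₁ n₂ K₁ K₂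
      x₁ x₂ g₁ g₂ s s₁ s₂ : ℂ}
    (h : IsCoshParametrization z₁ z₂ y₁ y₂ E₁ E₂ e₁ e₂ p q c d ℓ₁ ℓ₂ a b χ ε m₁ m₂ n₁ n₂ K₁ K₂
      x₁ x₂ g₁ g₂ s s₁ s₂) :
    n₁ ^ 2 * n₂ ^ 2 * ε ^ 2 * a ^ 2 / (8 * χ ^ 2 * b ^ 2) * (x₁ ^ 2 * x₂ ^ 2)⁻¹
        * numeratorPart z₁ z₂ y₁ y₂ E₁ E₂ e₁ e₂
      = g₁ * (K₁ * m₁ * n₁ * (n₂ ^ 2 / 2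
            * (ε * a / (χ * b)
                * joukowski (x₁ * x₂ ^ 2 * (ℓ₁ * (s * χ ^ 2 / (c * d)) * (-(p * b) / (a * q))))
              + χ * b / (ε * a)
                * joukowski (x₁ / x₂ ^ 2 * (ℓ₁ * c * d / (s * χ ^ 2) * (-(a * q) / (p * b)))))
          + m₂ ^ 2
            * (-4 * K₂ ^ 2 * n₂ ^ 2 / (χ * ε * a * b)
                * joukowski (x₁ * (-s * s₂ * (ℓ₁ / d) * (p * q / (a * b))))
              + a * χ / (b * ε)
                * joukowski (x₁ * (ℓ₁ * (s * χ ^ 2 / (c * d)) * (-(a * q) / (p * b))))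
              + ε * b / (χ * a)
                * joukowski (x₁ * (ℓ₁ * (c * d / (s * χ ^ 2)) * (-(p * b) / (a * q))))))
        - K₁ ^ 2 * K₂ * m₂ * (2 * n₂) * (χ * ε / (a * b) * (g₁ / g₂)
          * joukowski (x₂⁻¹ * (-s * s₁ * (ℓ₂ * c * d / (s * χ ^ 2)) * (-(a * q) / (p * b)))))) := by
  obtain ⟨hp, hq, hc, hd, hℓ₁, hℓ₂, ha, hb, hχ, hε, hm₁, hm₂, hn₁, hn₂, hK₁, hK₂, hx₁, hx₂,
    hg₁, hg₂, hs, hs₁, hs₂, ez₁, ez₂, ey₁, ey₂, ezy₁, ezy₂, eS₁, eS₂, ep, ep', eq₁, eq', ec,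
    ec', eu, eu', eE₁, ee₁, eE₂, ee₂⟩ := h
  have eS₁' : (z₁ + y₁) ^ 4 = 16 * K₁ ^ 4 := by rw [show 4 = 2 * 2 from rfl, pow_mul, eS₁]; ring
  have eS₂' : (z₂ + y₂) ^ 4 = 16 * K₂ ^ 4 := by rw [show 4 = 2 * 2 from rfl, pow_mul, eS₂]; ring
  have hs₀ : s ≠ 0 := by rintro rfl; norm_num at hs
  have hs₁₀ : s₁ ≠ 0 := by rintro rfl; norm_num at hs₁
  have hs₂₀ : s₂ ≠ 0 := by rintro rfl; norm_num at hs₂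
  -- The pairs are (t₁, t₆), (t₂, t₅), (t₃, t₄), (t₇, t₁₀), (t₈, t₁₁), (t₉, t₁₂). Each is an
  -- identity between two monomials, up to the signs s² = s₁² = s₂² = -1.
  have t₁ : n₁ ^ 2 * n₂ ^ 2 * ε ^ 2 * a ^ 2 / (8 * χ ^ 2 * b ^ 2) * (x₁ ^ 2 * x₂ ^ 2)⁻¹ * E₁
      = g₁ * (K₁ * m₁ * n₁ * (n₂ ^ 2 / 2 * (ε * a / (χ * b))))
        * (x₁ * x₂ ^ 2 * (ℓ₁ * (s * χ ^ 2 / (c * d)) * (-(p * b) / (a * q))))⁻¹ / 2 := by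
    rw [eE₁]; field_simp; norm_num [hs, hs₁, hs₂]
  have t₂ : n₁ ^ 2 * n₂ ^ 2 * ε ^ 2 * a ^ 2 / (8 * χ ^ 2 * b ^ 2) * (x₁ ^ 2 * x₂ ^ 2)⁻¹
        * ((z₁ - y₁) / (z₁ * (z₁ + y₁) ^ 2) * (E₁ ^ 2 * e₁))
      = g₁ * (K₁ * m₁ * n₁ * (n₂ ^ 2 / 2 * (χ * b / (ε * a))))
        * (x₁ / x₂ ^ 2 * (ℓ₁ * c * d / (s * χ ^ 2) * (-(a * q) / (p * b)))) / 2 := by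
    rw [ezy₁, eS₁, ez₁, eE₁, ee₁]; field_simp; norm_num [hs, hs₁, hs₂]
  have t₃ : n₁ ^ 2 * n₂ ^ 2 * ε ^ 2 * a ^ 2 / (8 * χ ^ 2 * b ^ 2) * (x₁ ^ 2 * x₂ ^ 2)⁻¹
        * ((z₁ - y₂) / (z₁ * (z₁ + y₂) ^ 2) * (E₁ ^ 2 * e₂))
      = g₁ * (-(K₁ ^ 2 * K₂ * m₂ * (2 * n₂)) * (χ * ε / (a * b)) * (g₁ / g₂)
        * (x₂⁻¹ * (-s * s₁ * (ℓ₂ * c * d / (s * χ ^ 2)) * (-(a * q) / (p * b)))) / 2) := by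
    rw [eu, eq₁, ez₁, eE₁, ee₂]; field_simp; norm_num [hs, hs₁, hs₂]
  have t₄ : n₁ ^ 2 * n₂ ^ 2 * ε ^ 2 * a ^ 2 / (8 * χ ^ 2 * b ^ 2) * (x₁ ^ 2 * x₂ ^ 2)⁻¹
        * ((z₂ - y₂) * (z₁ - z₂) ^ 2 * (z₁ - y₂) ^ 2
      / (z₁ * y₂ * (z₁ + z₂) * (z₂ + y₂) ^ 2 * (z₁ + y₂) ^ 4) * (E₁ ^ 2 * E₂ * e₂ ^ 2))
      = -(g₁ * (-(K₁ ^ 2 * K₂ * m₂ * (2 * n₂)) * (χ * ε / (a * b)) * (g₁ / g₂)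
        * (x₂⁻¹ * (-s * s₁ * (ℓ₂ * c * d / (s * χ ^ 2)) * (-(a * q) / (p * b))))⁻¹ / 2)) := by
    rw [ezy₂, eS₂, eu, ec, ep, eq₁, ez₁, ey₂, eE₁, ee₂, eE₂]; field_simp; norm_num [hs, hs₁, hs₂]
  have t₅ : n₁ ^ 2 * n₂ ^ 2 * ε ^ 2 * a ^ 2 / (8 * χ ^ 2 * b ^ 2) * (x₁ ^ 2 * x₂ ^ 2)⁻¹
        * ((z₁ - y₂) * (z₁ - z₂) ^ 2 * (z₂ - y₂) ^ 2
      / (z₂ * y₂ * (z₁ + z₂) * (z₁ + y₂) ^ 2 * (z₂ + y₂) ^ 4) * (E₁ * E₂ ^ 2 * e₂ ^ 2))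
      = -(g₁ * (K₁ * m₁ * n₁ * (n₂ ^ 2 / 2 * (χ * b / (ε * a))))
        * (x₁ / x₂ ^ 2 * (ℓ₁ * c * d / (s * χ ^ 2) * (-(a * q) / (p * b))))⁻¹ / 2) := by
    rw [ezy₂, eS₂', eu, ec, ep, eq₁, ez₂, ey₂, eE₁, ee₂, eE₂]; field_simp; norm_num [hs, hs₁, hs₂]
  have t₆ : n₁ ^ 2 * n₂ ^ 2 * ε ^ 2 * a ^ 2 / (8 * χ ^ 2 * b ^ 2) * (x₁ ^ 2 * x₂ ^ 2)⁻¹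
        * ((z₁ - y₁) * (z₂ - y₁) * (z₁ - y₂) ^ 2 * (z₂ - y₂) ^ 2 * (y₁ - y₂) ^ 2 * (z₁ - z₂) ^ 4
      / (z₁ * z₂ * y₂ * (y₁ + y₂) * (z₁ + z₂) ^ 2 * (z₁ + y₁) ^ 2
          * (z₂ + y₁) ^ 2 * (z₁ + y₂) ^ 4 * (z₂ + y₂) ^ 4) * (E₁ ^ 2 * E₂ ^ 2 * e₁ * e₂ ^ 2))
      = g₁ * (K₁ * m₁ * n₁ * (n₂ ^ 2 / 2 * (ε * a / (χ * b))))
        * (x₁ * x₂ ^ 2 * (ℓ₁ * (s * χ ^ 2 / (c * d)) * (-(p * b) / (a * q)))) / 2 := by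
    rw [ezy₁, ezy₂, eS₁, eS₂', eu, eu', ec, ec', ep, ep', eq₁, eq', ez₁, ez₂, ey₂, eE₁, ee₁, ee₂, eE₂]; field_simp; norm_num [hs, hs₁, hs₂]
  have t₇ : n₁ ^ 2 * n₂ ^ 2 * ε ^ 2 * a ^ 2 / (8 * χ ^ 2 * b ^ 2) * (x₁ ^ 2 * x₂ ^ 2)⁻¹
        * (2 * (z₂ - y₂) / ((z₁ + z₂) * (z₁ + y₂) ^ 2) * (E₁ * E₂ * e₂))
      = g₁ * (K₁ * m₁ * n₁ * m₂ ^ 2 * (-4 * K₂ ^ 2 * n₂ ^ 2 / (χ * ε * a * b))) * (x₁ * (-s * s₂ * (ℓ₁ / d) * (p * q / (a * b))))⁻¹ / 2 := by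
    rw [ezy₂, ec, eq₁, eE₁, eE₂, ee₂]; field_simp; norm_num [hs, hs₁, hs₂]
  have t₈ : n₁ ^ 2 * n₂ ^ 2 * ε ^ 2 * a ^ 2 / (8 * χ ^ 2 * b ^ 2) * (x₁ ^ 2 * x₂ ^ 2)⁻¹
        * (2 * (z₁ - z₂) ^ 2 / ((z₁ + y₂) ^ 2 * (z₂ + y₂) ^ 2) * (E₁ * E₂ * e₂))
      = g₁ * (K₁ * m₁ * n₁ * m₂ ^ 2 * (a * χ / (b * ε))) * (x₁ * (ℓ₁ * (s * χ ^ 2 / (c * d)) * (-(a * q) / (p * b))))⁻¹ / 2 := by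
    rw [eS₂, ep, eq₁, eE₁, eE₂, ee₂]; field_simp; norm_num [hs, hs₁, hs₂]
  have t₉ : n₁ ^ 2 * n₂ ^ 2 * ε ^ 2 * a ^ 2 / (8 * χ ^ 2 * b ^ 2) * (x₁ ^ 2 * x₂ ^ 2)⁻¹
        * (2 * (z₁ - y₂) / ((z₁ + z₂) * (z₂ + y₂) ^ 2) * (E₁ * E₂ * e₂))
      = g₁ * (K₁ * m₁ * n₁ * m₂ ^ 2 * (ε * b / (χ * a))) * (x₁ * (ℓ₁ * (c * d / (s * χ ^ 2)) * (-(p * b) / (a * q))))⁻¹ / 2 := by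
    rw [eS₂, ec, eu, eE₁, eE₂, ee₂]; field_simp; norm_num [hs, hs₁, hs₂]
  have t₁₀ : n₁ ^ 2 * n₂ ^ 2 * ε ^ 2 * a ^ 2 / (8 * χ ^ 2 * b ^ 2) * (x₁ ^ 2 * x₂ ^ 2)⁻¹
        * (-2 * (z₁ - y₁) * (z₁ - y₂) * (z₁ - z₂) ^ 2 * (z₂ - y₂) / (z₁ * (z₁ + z₂) * (y₁ + y₂) * (z₁ + y₁) ^ 2 * (z₁ + y₂) ^ 2 * (z₂ + y₁) ^ 2) * (E₁ ^ 2 * E₂ * e₁ * e₂))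
      = g₁ * (K₁ * m₁ * n₁ * m₂ ^ 2 * (-4 * K₂ ^ 2 * n₂ ^ 2 / (χ * ε * a * b))) * (x₁ * (-s * s₂ * (ℓ₁ / d) * (p * q / (a * b)))) / 2 := by
    rw [ezy₁, ezy₂, eS₁, eu, ec, ec', ep, eq₁, eq', ez₁, eE₁, ee₁, ee₂, eE₂]; field_simp; norm_num [hs, hs₁, hs₂]
  have t₁₁ : n₁ ^ 2 * n₂ ^ 2 * ε ^ 2 * a ^ 2 / (8 * χ ^ 2 * b ^ 2) * (x₁ ^ 2 * x₂ ^ 2)⁻¹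
        * (2 * (z₁ - y₁) * (z₁ - y₂) * (z₁ - z₂) ^ 2 * (y₁ - y₂) ^ 2 / (z₁ * (z₁ + z₂) * (z₁ + y₁) ^ 2 * (z₁ + y₂) ^ 2 * (z₂ + y₁) ^ 2 * (z₂ + y₂) ^ 2) * (E₁ ^ 2 * E₂ * e₁ * e₂))
      = g₁ * (K₁ * m₁ * n₁ * m₂ ^ 2 * (a * χ / (b * ε))) * (x₁ * (ℓ₁ * (s * χ ^ 2 / (c * d)) * (-(a * q) / (p * b)))) / 2 := by
    rw [ezy₁, eS₁, eS₂, eu, ec, ep, ep', eq₁, eq', ez₁, eE₁, ee₁, ee₂, eE₂]; field_simp; norm_num [hs, hs₁, hs₂]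
  have t₁₂ : n₁ ^ 2 * n₂ ^ 2 * ε ^ 2 * a ^ 2 / (8 * χ ^ 2 * b ^ 2) * (x₁ ^ 2 * x₂ ^ 2)⁻¹
        * (-2 * (z₁ - y₁) * (z₁ - y₂) * (z₁ - z₂) ^ 2 * (z₂ - y₁) / (z₁ * (z₁ + z₂) * (y₁ + y₂) * (z₁ + y₁) ^ 2 * (z₁ + y₂) ^ 2 * (z₂ + y₂) ^ 2) * (E₁ ^ 2 * E₂ * e₁ * e₂))
      = g₁ * (K₁ * m₁ * n₁ * m₂ ^ 2 * (ε * b / (χ * a))) * (x₁ * (ℓ₁ * (c * d / (s * χ ^ 2)) * (-(p * b) / (a * q)))) / 2 := by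
    rw [ezy₁, eS₁, eS₂, eu, eu', ec, ec', ep, eq₁, ez₁, eE₁, ee₁, ee₂, eE₂]; field_simp; norm_num [hs, hs₁, hs₂]
  have nS₁ : (z₁ + y₁) ^ 2 ≠ 0 := by rw [eS₁]; simpa
  have nS₂ : (z₂ + y₂) ^ 2 ≠ 0 := by rw [eS₂]; simpa
  have nc : z₁ + z₂ ≠ 0 := by rwa [ec]
  have nc' : y₁ + y₂ ≠ 0 := by rw [ec']; simp [hχ, hc]
  have nq : (z₁ + y₂) ^ 2 ≠ 0 := by rw [eq₁]; simpa
  have nq' : (z₂ + y₁) ^ 2 ≠ 0 := by rw [eq']; simp [hb, hq]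
  have nz₁ : z₁ ≠ 0 := by rw [ez₁]; simp [hs₁₀, hm₁, hℓ₁]
  rw [numeratorPart, div_split_cubic nc nq nS₂, div_split_quintic nz₁ nc nc' nS₁ nS₂ nq nq']
  simp only [joukowski]
  -- From here only linear algebra in the monomials remains, so the relations between the wave
  -- numbers are forgotten.
  clear eS₁ eS₂ eS₁' eS₂' ez₁ ez₂ ey₁ ey₂ ezy₁ ezy₂ ep ep' eq₁ eq' ec ec' eu eu' eE₁ ee₁ eE₂ ee₂
  generalize z₁ - z₂ = v₀ at *
  generalize y₁ - y₂ = v₀' at *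
  generalize z₁ - y₁ = v₁₁ at *
  generalize z₁ - y₂ = v₁₂ at *
  generalize z₂ - y₁ = v₂₁ at *
  generalize z₂ - y₂ = v₂₂ at *
  generalize z₁ + z₂ = u₀ at *
  generalize y₁ + y₂ = u₀' at *
  generalize z₁ + y₁ = u₁₁ at *
  generalize z₁ + y₂ = u₁₂ at *
  generalize z₂ + y₁ = u₂₁ at *
  generalize z₂ + y₂ = u₂₂ at *
  linear_combination t₁ + t₂ + t₃ - t₄ - t₅ + t₆ + t₇ + t₈ + t₉ + t₁₀ + t₁₁ + t₁₂

end CoshIdentities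

/-! ### The denominator as a sum of cosh terms -/

section CoshDenominator

/-- Half of the monomials of the denominator which are not self-conjugate, chosen with the phase
of the quotient of the two exponentials. -/
def denominatorCross (z₁ z₂ y₁ y₂ E₁ E₂ e₁ e₂ : ℂ) : ℂ :=
  4 / (z₁ + y₂) ^ 2 * (E₁ * e₂)
  - (z₁ - y₂) ^ 2 / (z₁ * y₂ * (z₁ + y₂) ^ 4) * (E₁ ^ 2 * e₂ ^ 2)
  + 4 * (z₁ - y₁) * (z₁ - y₂) / (z₁ * (y₁ + y₂) * (z₁ + y₁) ^ 2 * (z₁ + y₂) ^ 2)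
      * (-(E₁ ^ 2 * e₁ * e₂))
  - 4 * (z₁ - y₂) * (z₂ - y₂) / (y₂ * (z₁ + z₂) * (z₁ + y₂) ^ 2 * (z₂ + y₂) ^ 2)
      * (E₁ * E₂ * e₂ ^ 2)
  + 4 * (z₁ - y₁) * (z₂ - y₂) * (z₁ - z₂) ^ 2 * (z₁ - y₂) ^ 2 * (y₁ - y₂) ^ 2
      / (z₁ * y₂ * (z₁ + z₂) * (y₁ + y₂) * (z₁ + y₁) ^ 2
          * (z₂ + y₁) ^ 2 * (z₂ + y₂) ^ 2 * (z₁ + y₂) ^ 4) * (E₁ ^ 2 * E₂ * e₁ * e₂ ^ 2)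

/-- Of the five monomials t₁, t₅ and t₃, t₄ are cosh pairs with the phase g₁/g₂. The remaining t₂
has the squared phase, and its real part is the cosine in Y. -/
theorem denominatorCross_eq {z₁ z₂ y₁ y₂ E₁ E₂ e₁ e₂ p q c d ℓ₁ ℓ₂ a b χ ε m₁ m₂ n₁ n₂ K₁ K₂
      x₁ x₂ g₁ g₂ s s₁ s₂ : ℂ}
    (h : IsCoshParametrization z₁ z₂ y₁ y₂ E₁ E₂ e₁ e₂ p q c d ℓ₁ ℓ₂ a b χ ε m₁ m₂ n₁ n₂ K₁ K₂
      x₁ x₂ g₁ g₂ s s₁ s₂) :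
    n₁ ^ 2 * n₂ ^ 2 * ε ^ 2 * a ^ 2 / (8 * χ ^ 2 * b ^ 2) * (x₁ ^ 2 * x₂ ^ 2)⁻¹
        * denominatorCross z₁ z₂ y₁ y₂ E₁ E₂ e₁ e₂
      = 2 * K₁ ^ 2 * K₂ ^ 2 * (χ ^ 2 * ε ^ 2 / (a ^ 2 * b ^ 2)) * ((g₁ / g₂) ^ 2 * (-s₁ * s₂))
        - 4 * (K₁ * K₂ * n₁ * n₂ * m₁ * m₂) * (g₁ / g₂
          * (1 / b ^ 2 * joukowski (x₁ * x₂ * (ℓ₁ * (s * χ ^ 2 / (c * d)) / (d * ℓ₂)))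
            + 1 / a ^ 2 * joukowski (x₁ / x₂ * (ℓ₁ * ℓ₂ * c / (s * χ ^ 2))))) := by
  obtain ⟨hp, hq, hc, hd, hℓ₁, hℓ₂, ha, hb, hχ, hε, hm₁, hm₂, hn₁, hn₂, hK₁, hK₂, hx₁, hx₂,
    hg₁, hg₂, hs, hs₁, hs₂, ez₁, ez₂, ey₁, ey₂, ezy₁, ezy₂, eS₁, eS₂, ep, ep', eq₁, eq', ec,
    ec', eu, eu', eE₁, ee₁, eE₂, ee₂⟩ := h
  have eS₁' : (z₁ + y₁) ^ 4 = 16 * K₁ ^ 4 := by rw [show 4 = 2 * 2 from rfl, pow_mul, eS₁]; ring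
  have eS₂' : (z₂ + y₂) ^ 4 = 16 * K₂ ^ 4 := by rw [show 4 = 2 * 2 from rfl, pow_mul, eS₂]; ring
  have hs₀ : s ≠ 0 := by rintro rfl; norm_num at hs
  have hs₁₀ : s₁ ≠ 0 := by rintro rfl; norm_num at hs₁
  have hs₂₀ : s₂ ≠ 0 := by rintro rfl; norm_num at hs₂
  have t₁ : n₁ ^ 2 * n₂ ^ 2 * ε ^ 2 * a ^ 2 / (8 * χ ^ 2 * b ^ 2) * (x₁ ^ 2 * x₂ ^ 2)⁻¹
        * (4 / (z₁ + y₂) ^ 2 * (E₁ * e₂))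
      = -(4 * (K₁ * K₂ * n₁ * n₂ * m₁ * m₂) * (g₁ / g₂)) * (1 / b ^ 2) * (x₁ * x₂ * (ℓ₁ * (s * χ ^ 2 / (c * d)) / (d * ℓ₂)))⁻¹ / 2 := by
    rw [eq₁, eE₁, ee₂]; field_simp; norm_num [hs, hs₁, hs₂]
  have t₂ : n₁ ^ 2 * n₂ ^ 2 * ε ^ 2 * a ^ 2 / (8 * χ ^ 2 * b ^ 2) * (x₁ ^ 2 * x₂ ^ 2)⁻¹
        * ((z₁ - y₂) ^ 2 / (z₁ * y₂ * (z₁ + y₂) ^ 4) * (E₁ ^ 2 * e₂ ^ 2))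
      = -(2 * K₁ ^ 2 * K₂ ^ 2 * (χ ^ 2 * ε ^ 2 / (a ^ 2 * b ^ 2)) * ((g₁ / g₂) ^ 2 * (-s₁ * s₂))) := by
    rw [eu, eq₁, ez₁, ey₂, eE₁, ee₂]; field_simp; norm_num [hs, hs₁, hs₂]
  have t₃ : n₁ ^ 2 * n₂ ^ 2 * ε ^ 2 * a ^ 2 / (8 * χ ^ 2 * b ^ 2) * (x₁ ^ 2 * x₂ ^ 2)⁻¹
        * (4 * (z₁ - y₁) * (z₁ - y₂) / (z₁ * (y₁ + y₂) * (z₁ + y₁) ^ 2 * (z₁ + y₂) ^ 2) * (-(E₁ ^ 2 * e₁ * e₂)))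
      = -(4 * (K₁ * K₂ * n₁ * n₂ * m₁ * m₂) * (g₁ / g₂)) * (1 / a ^ 2) * (x₁ / x₂ * (ℓ₁ * ℓ₂ * c / (s * χ ^ 2))) / 2 := by
    rw [ezy₁, eu, ec', eS₁, eq₁, ez₁, eE₁, ee₁, ee₂]; field_simp; norm_num [hs, hs₁, hs₂]
  have t₄ : n₁ ^ 2 * n₂ ^ 2 * ε ^ 2 * a ^ 2 / (8 * χ ^ 2 * b ^ 2) * (x₁ ^ 2 * x₂ ^ 2)⁻¹
        * (4 * (z₁ - y₂) * (z₂ - y₂) / (y₂ * (z₁ + z₂) * (z₁ + y₂) ^ 2 * (z₂ + y₂) ^ 2) * (E₁ * E₂ * e₂ ^ 2))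
      = -(-(4 * (K₁ * K₂ * n₁ * n₂ * m₁ * m₂) * (g₁ / g₂)) * (1 / a ^ 2) * (x₁ / x₂ * (ℓ₁ * ℓ₂ * c / (s * χ ^ 2)))⁻¹ / 2) := by
    rw [ezy₂, eu, ec, eS₂, eq₁, ey₂, eE₁, eE₂, ee₂]; field_simp; norm_num [hs, hs₁, hs₂]
  have t₅ : n₁ ^ 2 * n₂ ^ 2 * ε ^ 2 * a ^ 2 / (8 * χ ^ 2 * b ^ 2) * (x₁ ^ 2 * x₂ ^ 2)⁻¹
        * (4 * (z₁ - y₁) * (z₂ - y₂) * (z₁ - z₂) ^ 2 * (z₁ - y₂) ^ 2 * (y₁ - y₂) ^ 2 / (z₁ * y₂ * (z₁ + z₂) * (y₁ + y₂) * (z₁ + y₁) ^ 2 * (z₂ + y₁) ^ 2 * (z₂ + y₂) ^ 2 * (z₁ + y₂) ^ 4) * (E₁ ^ 2 * E₂ * e₁ * e₂ ^ 2))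
      = -(4 * (K₁ * K₂ * n₁ * n₂ * m₁ * m₂) * (g₁ / g₂)) * (1 / b ^ 2) * (x₁ * x₂ * (ℓ₁ * (s * χ ^ 2 / (c * d)) / (d * ℓ₂))) / 2 := by
    rw [ezy₁, ezy₂, ep, ep', eu, ec, ec', eS₁, eS₂, eq₁, eq', ez₁, ey₂, eE₁, eE₂, ee₁, ee₂]; field_simp; norm_num [hs, hs₁, hs₂]
  simp only [denominatorCross, joukowski]
  clear eS₁ eS₂ eS₁' eS₂' ez₁ ez₂ ey₁ ey₂ ezy₁ ezy₂ ep ep' eq₁ eq' ec ec' eu eu' eE₁ ee₁ eE₂ ee₂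
  generalize z₁ - z₂ = v₀ at *
  generalize y₁ - y₂ = v₀' at *
  generalize z₁ - y₁ = v₁₁ at *
  generalize z₁ - y₂ = v₁₂ at *
  generalize z₂ - y₁ = v₂₁ at *
  generalize z₂ - y₂ = v₂₂ at *
  generalize z₁ + z₂ = u₀ at *
  generalize y₁ + y₂ = u₀' at *
  generalize z₁ + y₁ = u₁₁ at *
  generalize z₁ + y₂ = u₁₂ at *
  generalize z₂ + y₁ = u₂₁ at *
  generalize z₂ + y₂ = u₂₂ at *
  linear_combination t₁ - t₂ + t₃ - t₄ + t₅

theorem div_split_quartic {c y S₁ S₂ Q Q' u u' v₁ v₂ P A : ℂ} (hc : c ≠ 0)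
    (hy : y ≠ 0) (hS₁ : S₁ ≠ 0) (hS₂ : S₂ ≠ 0) (hQ : Q ≠ 0) (hQ' : Q' ≠ 0) :
    8 * (c * P * y * A - S₁ * v₁ * S₂ * v₂ - Q * u * Q' * u') / (c * y * S₁ * Q * Q' * S₂)
      = 8 * P * A / (S₁ * Q * Q' * S₂) - 8 * v₁ * v₂ / (c * y * Q * Q')
        - 8 * u * u' / (c * y * S₁ * S₂) := by
  field_simp

/-- The self-conjugate monomials of the denominator, with independent conjugate variables. -/
def denominatorDiag (z₁ z₂ y₁ y₂ E₁ E₂ e₁ e₂ : ℂ) : ℂ :=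
  4 / (z₁ + y₁) ^ 2 * (E₁ * e₁)
  + 4 / (z₂ + y₂) ^ 2 * (E₂ * e₂)
  - (z₁ - y₁) ^ 2 / (z₁ * y₁ * (z₁ + y₁) ^ 4) * (E₁ ^ 2 * e₁ ^ 2)
  - (z₂ - y₂) ^ 2 / (z₂ * y₂ * (z₂ + y₂) ^ 4) * (E₂ ^ 2 * e₂ ^ 2)
  + 8 * ((z₁ + z₂) * (z₁ - z₂) ^ 2 * (y₁ + y₂) * (y₁ - y₂) ^ 2
        - (z₁ + y₁) ^ 2 * (z₁ - y₁) * (z₂ + y₂) ^ 2 * (z₂ - y₂)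
        - (z₁ + y₂) ^ 2 * (z₁ - y₂) * (z₂ + y₁) ^ 2 * (z₂ - y₁))
      / ((z₁ + z₂) * (y₁ + y₂) * (z₁ + y₁) ^ 2 * (z₁ + y₂) ^ 2
          * (z₂ + y₁) ^ 2 * (z₂ + y₂) ^ 2)
      * (E₁ * e₁ * E₂ * e₂)
  + 4 * (z₁ - y₂) * (z₂ - y₁) * (z₁ - z₂) ^ 2 * (z₁ - y₁) ^ 2 * (y₁ - y₂) ^ 2
      / (z₁ * y₁ * (z₁ + z₂) * (y₁ + y₂) * (z₁ + y₂) ^ 2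
          * (z₂ + y₁) ^ 2 * (z₂ + y₂) ^ 2 * (z₁ + y₁) ^ 4)
      * (E₁ ^ 2 * E₂ * e₁ ^ 2 * e₂)
  + 4 * (z₁ - y₂) * (z₂ - y₁) * (z₁ - z₂) ^ 2 * (z₂ - y₂) ^ 2 * (y₁ - y₂) ^ 2
      / (z₂ * y₂ * (z₁ + z₂) * (y₁ + y₂) * (z₁ + y₁) ^ 2
          * (z₁ + y₂) ^ 2 * (z₂ + y₁) ^ 2 * (z₂ + y₂) ^ 4)
      * (E₁ * E₂ ^ 2 * e₁ * e₂ ^ 2)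
  + (z₁ - y₁) ^ 2 * (z₁ - y₂) ^ 2 * (z₂ - y₁) ^ 2 * (z₂ - y₂) ^ 2
      * (z₁ - z₂) ^ 4 * (y₁ - y₂) ^ 4
      / (z₁ * z₂ * y₁ * y₂ * (z₁ + z₂) ^ 2 * (y₁ + y₂) ^ 2
          * (z₁ + y₁) ^ 4 * (z₁ + y₂) ^ 4 * (z₂ + y₁) ^ 4 * (z₂ + y₂) ^ 4)
      * (E₁ ^ 2 * E₂ ^ 2 * e₁ ^ 2 * e₂ ^ 2)

/-- The pairs are 1 and |E₁E₂|⁴, |E₁|⁴ and |E₂|⁴, |E₁|² and |E₁|²|E₂|⁴, |E₂|² and |E₁|⁴|E₂|². The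
term |E₁E₂|² splits into three constants. Equality of coefficients in the first two pairs determines
the moduli of both amplitudes. -/
theorem denominatorDiag_eq {z₁ z₂ y₁ y₂ E₁ E₂ e₁ e₂ p q c d ℓ₁ ℓ₂ a b χ ε m₁ m₂ n₁ n₂ K₁ K₂
      x₁ x₂ g₁ g₂ s s₁ s₂ : ℂ}
    (h : IsCoshParametrization z₁ z₂ y₁ y₂ E₁ E₂ e₁ e₂ p q c d ℓ₁ ℓ₂ a b χ ε m₁ m₂ n₁ n₂ K₁ K₂
      x₁ x₂ g₁ g₂ s s₁ s₂) :
    n₁ ^ 2 * n₂ ^ 2 * ε ^ 2 * a ^ 2 / (8 * χ ^ 2 * b ^ 2) * (x₁ ^ 2 * x₂ ^ 2)⁻¹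
        * (1 + denominatorDiag z₁ z₂ y₁ y₂ E₁ E₂ e₁ e₂)
      = m₁ ^ 2 * m₂ ^ 2 * (a ^ 2 * χ ^ 2 / (b ^ 2 * ε ^ 2) + b ^ 2 * ε ^ 2 / (a ^ 2 * χ ^ 2)
          + 16 * K₁ ^ 2 * K₂ ^ 2 * (-s₁ * s₂ * n₁ ^ 2 * n₂ ^ 2) / (χ ^ 2 * ε ^ 2 * a ^ 2 * b ^ 2))
        + n₁ ^ 2 * n₂ ^ 2 / 4
          * (ε ^ 2 * a ^ 2 / (χ ^ 2 * b ^ 2) * joukowski (x₁ ^ 2 * x₂ ^ 2)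
            + χ ^ 2 * b ^ 2 / (ε ^ 2 * a ^ 2) * joukowski (x₁ ^ 2 / x₂ ^ 2))
        + n₂ ^ 2 * m₁ ^ 2 * joukowski (x₂ ^ 2) + n₁ ^ 2 * m₂ ^ 2 * joukowski (x₁ ^ 2) := by
  obtain ⟨hp, hq, hc, hd, hℓ₁, hℓ₂, ha, hb, hχ, hε, hm₁, hm₂, hn₁, hn₂, hK₁, hK₂, hx₁, hx₂,
    hg₁, hg₂, hs, hs₁, hs₂, ez₁, ez₂, ey₁, ey₂, ezy₁, ezy₂, eS₁, eS₂, ep, ep', eq₁, eq', ec,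
    ec', eu, eu', eE₁, ee₁, eE₂, ee₂⟩ := h
  have eS₁' : (z₁ + y₁) ^ 4 = 16 * K₁ ^ 4 := by rw [show 4 = 2 * 2 from rfl, pow_mul, eS₁]; ring
  have eS₂' : (z₂ + y₂) ^ 4 = 16 * K₂ ^ 4 := by rw [show 4 = 2 * 2 from rfl, pow_mul, eS₂]; ring
  have hs₀ : s ≠ 0 := by rintro rfl; norm_num at hs
  have hs₁₀ : s₁ ≠ 0 := by rintro rfl; norm_num at hs₁
  have hs₂₀ : s₂ ≠ 0 := by rintro rfl; norm_num at hs₂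
  have t₁ : n₁ ^ 2 * n₂ ^ 2 * ε ^ 2 * a ^ 2 / (8 * χ ^ 2 * b ^ 2) * (x₁ ^ 2 * x₂ ^ 2)⁻¹
        * (4 / (z₁ + y₁) ^ 2 * (E₁ * e₁))
      = n₂ ^ 2 * m₁ ^ 2 * (x₂ ^ 2)⁻¹ / 2 := by
    rw [eS₁, eE₁, ee₁]; field_simp; norm_num [hs, hs₁, hs₂]
  have t₂ : n₁ ^ 2 * n₂ ^ 2 * ε ^ 2 * a ^ 2 / (8 * χ ^ 2 * b ^ 2) * (x₁ ^ 2 * x₂ ^ 2)⁻¹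
        * (4 / (z₂ + y₂) ^ 2 * (E₂ * e₂))
      = n₁ ^ 2 * m₂ ^ 2 * (x₁ ^ 2)⁻¹ / 2 := by
    rw [eS₂, eE₂, ee₂]; field_simp; norm_num [hs, hs₁, hs₂]
  have t₃ : n₁ ^ 2 * n₂ ^ 2 * ε ^ 2 * a ^ 2 / (8 * χ ^ 2 * b ^ 2) * (x₁ ^ 2 * x₂ ^ 2)⁻¹
        * ((z₁ - y₁) ^ 2 / (z₁ * y₁ * (z₁ + y₁) ^ 4) * (E₁ ^ 2 * e₁ ^ 2))
      = -((n₁ ^ 2 * n₂ ^ 2 / 4 * (χ ^ 2 * b ^ 2 / (ε ^ 2 * a ^ 2))) * (x₁ ^ 2 / x₂ ^ 2) / 2) := by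
    rw [ezy₁, eS₁', ez₁, ey₁, eE₁, ee₁]; field_simp; norm_num [hs, hs₁, hs₂]
  have t₄ : n₁ ^ 2 * n₂ ^ 2 * ε ^ 2 * a ^ 2 / (8 * χ ^ 2 * b ^ 2) * (x₁ ^ 2 * x₂ ^ 2)⁻¹
        * ((z₂ - y₂) ^ 2 / (z₂ * y₂ * (z₂ + y₂) ^ 4) * (E₂ ^ 2 * e₂ ^ 2))
      = -((n₁ ^ 2 * n₂ ^ 2 / 4 * (χ ^ 2 * b ^ 2 / (ε ^ 2 * a ^ 2))) * (x₁ ^ 2 / x₂ ^ 2)⁻¹ / 2) := by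
    rw [ezy₂, eS₂', ez₂, ey₂, eE₂, ee₂]; field_simp; norm_num [hs, hs₁, hs₂]
  have t₅ : n₁ ^ 2 * n₂ ^ 2 * ε ^ 2 * a ^ 2 / (8 * χ ^ 2 * b ^ 2) * (x₁ ^ 2 * x₂ ^ 2)⁻¹
        * (8 * (z₁ - z₂) ^ 2 * (y₁ - y₂) ^ 2 / ((z₁ + y₁) ^ 2 * (z₁ + y₂) ^ 2 * (z₂ + y₁) ^ 2 * (z₂ + y₂) ^ 2) * (E₁ * e₁ * E₂ * e₂))
      = m₁ ^ 2 * m₂ ^ 2 * (a ^ 2 * χ ^ 2 / (b ^ 2 * ε ^ 2)) := by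
    rw [eS₁, eS₂, ep, ep', eq₁, eq', eE₁, ee₁, eE₂, ee₂]; field_simp; norm_num [hs, hs₁, hs₂]
  have t₆ : n₁ ^ 2 * n₂ ^ 2 * ε ^ 2 * a ^ 2 / (8 * χ ^ 2 * b ^ 2) * (x₁ ^ 2 * x₂ ^ 2)⁻¹
        * (8 * (z₁ - y₁) * (z₂ - y₂) / ((z₁ + z₂) * (y₁ + y₂) * (z₁ + y₂) ^ 2 * (z₂ + y₁) ^ 2) * (E₁ * e₁ * E₂ * e₂))
      = -(m₁ ^ 2 * m₂ ^ 2 * (16 * K₁ ^ 2 * K₂ ^ 2 * (-s₁ * s₂ * n₁ ^ 2 * n₂ ^ 2) / (χ ^ 2 * ε ^ 2 * a ^ 2 * b ^ 2))) := by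
    rw [ezy₁, ezy₂, ec, ec', eq₁, eq', eE₁, ee₁, eE₂, ee₂]; field_simp; norm_num [hs, hs₁, hs₂]
  have t₇ : n₁ ^ 2 * n₂ ^ 2 * ε ^ 2 * a ^ 2 / (8 * χ ^ 2 * b ^ 2) * (x₁ ^ 2 * x₂ ^ 2)⁻¹
        * (8 * (z₁ - y₂) * (z₂ - y₁) / ((z₁ + z₂) * (y₁ + y₂) * (z₁ + y₁) ^ 2 * (z₂ + y₂) ^ 2) * (E₁ * e₁ * E₂ * e₂))
      = -(m₁ ^ 2 * m₂ ^ 2 * (b ^ 2 * ε ^ 2 / (a ^ 2 * χ ^ 2))) := by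
    rw [eu, eu', ec, ec', eS₁, eS₂, eE₁, ee₁, eE₂, ee₂]; field_simp; norm_num [hs, hs₁, hs₂]
  have t₈ : n₁ ^ 2 * n₂ ^ 2 * ε ^ 2 * a ^ 2 / (8 * χ ^ 2 * b ^ 2) * (x₁ ^ 2 * x₂ ^ 2)⁻¹
        * (4 * (z₁ - y₂) * (z₂ - y₁) * (z₁ - z₂) ^ 2 * (z₁ - y₁) ^ 2 * (y₁ - y₂) ^ 2 / (z₁ * y₁ * (z₁ + z₂) * (y₁ + y₂) * (z₁ + y₂) ^ 2 * (z₂ + y₁) ^ 2 * (z₂ + y₂) ^ 2 * (z₁ + y₁) ^ 4) * (E₁ ^ 2 * E₂ * e₁ ^ 2 * e₂))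
      = n₁ ^ 2 * m₂ ^ 2 * x₁ ^ 2 / 2 := by
    rw [eu, eu', ep, ep', ezy₁, ec, ec', eq₁, eq', eS₂, eS₁', ez₁, ey₁, eE₁, ee₁, eE₂, ee₂]; field_simp; norm_num [hs, hs₁, hs₂]
  have t₉ : n₁ ^ 2 * n₂ ^ 2 * ε ^ 2 * a ^ 2 / (8 * χ ^ 2 * b ^ 2) * (x₁ ^ 2 * x₂ ^ 2)⁻¹
        * (4 * (z₁ - y₂) * (z₂ - y₁) * (z₁ - z₂) ^ 2 * (z₂ - y₂) ^ 2 * (y₁ - y₂) ^ 2 / (z₂ * y₂ * (z₁ + z₂) * (y₁ + y₂) * (z₁ + y₁) ^ 2 * (z₁ + y₂) ^ 2 * (z₂ + y₁) ^ 2 * (z₂ + y₂) ^ 4) * (E₁ * E₂ ^ 2 * e₁ * e₂ ^ 2))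
      = n₂ ^ 2 * m₁ ^ 2 * x₂ ^ 2 / 2 := by
    rw [eu, eu', ep, ep', ezy₂, ec, ec', eq₁, eq', eS₁, eS₂', ez₂, ey₂, eE₁, ee₁, eE₂, ee₂]; field_simp; norm_num [hs, hs₁, hs₂]
  have t₁₀ : n₁ ^ 2 * n₂ ^ 2 * ε ^ 2 * a ^ 2 / (8 * χ ^ 2 * b ^ 2) * (x₁ ^ 2 * x₂ ^ 2)⁻¹
        * ((z₁ - y₁) ^ 2 * (z₁ - y₂) ^ 2 * (z₂ - y₁) ^ 2 * (z₂ - y₂) ^ 2 * (z₁ - z₂) ^ 4 * (y₁ - y₂) ^ 4 / (z₁ * z₂ * y₁ * y₂ * (z₁ + z₂) ^ 2 * (y₁ + y₂) ^ 2 * (z₁ + y₁) ^ 4 * (z₁ + y₂) ^ 4 * (z₂ + y₁) ^ 4 * (z₂ + y₂) ^ 4) * (E₁ ^ 2 * E₂ ^ 2 * e₁ ^ 2 * e₂ ^ 2))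
      = (n₁ ^ 2 * n₂ ^ 2 / 4 * (ε ^ 2 * a ^ 2 / (χ ^ 2 * b ^ 2))) * (x₁ ^ 2 * x₂ ^ 2) / 2 := by
    rw [ezy₁, ezy₂, eu, eu', ep, ep', ec, ec', eq₁, eq', eS₁', eS₂', ez₁, ey₁, ez₂, ey₂, eE₁, ee₁, eE₂, ee₂]; field_simp; norm_num [hs, hs₁, hs₂]
  have nS₁ : (z₁ + y₁) ^ 2 ≠ 0 := by rw [eS₁]; simpa
  have nS₂ : (z₂ + y₂) ^ 2 ≠ 0 := by rw [eS₂]; simpa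
  have nc : z₁ + z₂ ≠ 0 := by rwa [ec]
  have nc' : y₁ + y₂ ≠ 0 := by rw [ec']; simp [hχ, hc]
  have nq : (z₁ + y₂) ^ 2 ≠ 0 := by rw [eq₁]; simpa
  have nq' : (z₂ + y₁) ^ 2 ≠ 0 := by rw [eq']; simp [hb, hq]
  rw [denominatorDiag, div_split_quartic nc nc' nS₁ nS₂ nq nq']
  simp only [joukowski]
  clear eS₁ eS₂ eS₁' eS₂' ez₁ ez₂ ey₁ ey₂ ezy₁ ezy₂ ep ep' eq₁ eq' ec ec' eu eu' eE₁ ee₁ eE₂ ee₂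
  generalize z₁ - z₂ = v₀ at *
  generalize y₁ - y₂ = v₀' at *
  generalize z₁ - y₁ = v₁₁ at *
  generalize z₁ - y₂ = v₁₂ at *
  generalize z₂ - y₁ = v₂₁ at *
  generalize z₂ - y₂ = v₂₂ at *
  generalize z₁ + z₂ = u₀ at *
  generalize y₁ + y₂ = u₀' at *
  generalize z₁ + y₁ = u₁₁ at *
  generalize z₁ + y₂ = u₁₂ at *
  generalize z₂ + y₁ = u₂₁ at *
  generalize z₂ + y₂ = u₂₂ at *
  linear_combination t₁ + t₂ - t₃ - t₄ + t₅ - t₆ - t₇ + t₈ + t₉ + t₁₀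

end CoshDenominator

/-! ### Moduli and angles of the wave parameters -/

section Parameters

variable (p : ModParams)

theorem exp_arg_mul_I {z : ℂ} (hz : z ≠ 0) : Complex.exp (z.arg * Complex.I) = z / ‖z‖ := by
  have h : (‖z‖ : ℂ) ≠ 0 := by simpa using hz
  rw [eq_div_iff h, mul_comm, Complex.norm_mul_exp_arg_mul_I]

theorem sq_norm_z₁_sub_z₂ :
    ‖p.z₁ - p.z₂‖ ^ 2 = (p.k₁ - p.k₂) ^ 2 + (p.κ₁ - p.κ₂) ^ 2 := by
  rw [Complex.sq_norm, Complex.normSq_apply]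
  simp only [ModParams.z₁, ModParams.z₂, Complex.sub_re, Complex.sub_im]
  ring

theorem sq_norm_z₁_add_conj_z₂ :
    ‖p.z₁ + conj p.z₂‖ ^ 2 = (p.k₁ + p.k₂) ^ 2 + (p.κ₁ - p.κ₂) ^ 2 := by
  rw [Complex.sq_norm, Complex.normSq_apply]
  simp only [ModParams.z₁, ModParams.z₂, Complex.add_re, Complex.add_im, Complex.conj_re,
    Complex.conj_im]
  ring

theorem sq_norm_z₁_add_z₂ :
    ‖p.z₁ + p.z₂‖ ^ 2 = (p.k₁ + p.k₂) ^ 2 + (p.κ₁ + p.κ₂) ^ 2 := by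
  rw [Complex.sq_norm, Complex.normSq_apply]
  simp only [ModParams.z₁, ModParams.z₂, Complex.add_re, Complex.add_im]
  ring

theorem sq_norm_z₁_sub_conj_z₂ :
    ‖p.z₁ - conj p.z₂‖ ^ 2 = (p.k₁ - p.k₂) ^ 2 + (p.κ₁ + p.κ₂) ^ 2 := by
  rw [Complex.sq_norm, Complex.normSq_apply]
  simp only [ModParams.z₁, ModParams.z₂, Complex.sub_re, Complex.sub_im, Complex.conj_re,
    Complex.conj_im]
  ring

theorem Υ_eq : p.Υ = (‖p.z₁ - p.z₂‖ * ‖p.z₁ + conj p.z₂‖) ^ 2 := by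
  rw [ModParams.Υ, mul_pow, sq_norm_z₁_sub_z₂, sq_norm_z₁_add_conj_z₂]

theorem Γ_eq : p.Γ = (‖p.z₁ - p.z₂‖ / ‖p.z₁ + conj p.z₂‖) ^ 2 := by
  rw [ModParams.Γ, div_pow, sq_norm_z₁_sub_z₂, sq_norm_z₁_add_conj_z₂]

theorem Ω_eq : p.Ω = (√‖p.z₁ + p.z₂‖ * √‖p.z₁ - conj p.z₂‖) ^ 2 := by
  rw [ModParams.Ω, ← sq_norm_z₁_add_z₂, ← sq_norm_z₁_sub_conj_z₂, ← mul_pow, Real.sqrt_sq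
    (by positivity), mul_pow, Real.sq_sqrt (norm_nonneg _), Real.sq_sqrt (norm_nonneg _)]

theorem Δ_eq : p.Δ = (√‖p.z₁ - conj p.z₂‖ / √‖p.z₁ + p.z₂‖) ^ 2 := by
  rw [ModParams.Δ, ← sq_norm_z₁_add_z₂, ← sq_norm_z₁_sub_conj_z₂, ← div_pow, Real.sqrt_sq
    (by positivity), div_pow, Real.sq_sqrt (norm_nonneg _), Real.sq_sqrt (norm_nonneg _)]

theorem norm_z₁ : p.k₁ ^ 2 + p.κ₁ ^ 2 = (√‖p.z₁‖ ^ 2) ^ 2 := by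
  rw [Real.sq_sqrt (norm_nonneg _), Complex.sq_norm, Complex.normSq_apply]
  simp only [ModParams.z₁]
  ring

theorem norm_z₂ : p.k₂ ^ 2 + p.κ₂ ^ 2 = (√‖p.z₂‖ ^ 2) ^ 2 := by
  rw [Real.sq_sqrt (norm_nonneg _), Complex.sq_norm, Complex.normSq_apply]
  simp only [ModParams.z₂]
  ring

theorem rpow_sq_sq {m : ℝ} (hm : 0 ≤ m) : ((m ^ 2) ^ 2) ^ (1 / 4 : ℝ) = m := by
  rw [← pow_mul, ← Real.rpow_natCast, ← Real.rpow_mul hm]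
  norm_num

variable {p}

/-- Each angle is the argument of a product of two of z₁ ± z₂, z₁ ± z̄₂ and their conjugates, up to
sign; here it is (z₁ - z₂)(z₁ + z̄₂). -/
theorem exp_γ₁ (hq : p.k₁ ^ 2 - 3 * p.κ₁ ^ 2 ≠ p.k₂ ^ 2 - 3 * p.κ₂ ^ 2) :
    Complex.exp (p.γ₁ * Complex.I) = (p.z₁ - p.z₂) * (p.z₁ + conj p.z₂)
      / (‖p.z₁ - p.z₂‖ * ‖p.z₁ + conj p.z₂‖) := by
  have e : (⟨p.k₁ ^ 2 - p.k₂ ^ 2 - (p.κ₁ - p.κ₂) ^ 2, 2 * p.k₁ * (p.κ₁ - p.κ₂)⟩ : ℂ)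
      = (p.z₁ - p.z₂) * (p.z₁ + conj p.z₂) := by
    apply Complex.ext <;> simp [ModParams.z₁, ModParams.z₂] <;> ring
  rw [ModParams.γ₁, e, exp_arg_mul_I
    (mul_ne_zero (z₁_sub_z₂_ne_zero hq) (z₁_add_conj_z₂_ne_zero hq)), norm_mul]
  push_cast
  rfl

theorem conj_eq_sq_norm_div {z : ℂ} (hz : z ≠ 0) : conj z = (‖z‖ : ℂ) ^ 2 / z := by
  rw [eq_div_iff hz, mul_comm, Complex.mul_conj']

theorem exp_γ₂ (hq : p.k₁ ^ 2 - 3 * p.κ₁ ^ 2 ≠ p.k₂ ^ 2 - 3 * p.κ₂ ^ 2) :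
    Complex.exp (p.γ₂ * Complex.I) = -((p.z₁ - p.z₂) * ‖p.z₁ + conj p.z₂‖)
      / (‖p.z₁ - p.z₂‖ * (p.z₁ + conj p.z₂)) := by
  have e : (⟨p.k₂ ^ 2 - p.k₁ ^ 2 - (p.κ₁ - p.κ₂) ^ 2, -2 * p.k₂ * (p.κ₁ - p.κ₂)⟩ : ℂ)
      = -(p.z₁ - p.z₂) * conj (p.z₁ + conj p.z₂) := by
    apply Complex.ext <;> simp [ModParams.z₁, ModParams.z₂] <;> ring
  have h₁ := z₁_sub_z₂_ne_zero hq
  have h₂ := z₁_add_conj_z₂_ne_zero hq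
  have h₃ : (‖p.z₁ + conj p.z₂‖ : ℂ) ≠ 0 := by simpa using h₂
  rw [ModParams.γ₂, e, exp_arg_mul_I (mul_ne_zero (neg_ne_zero.2 h₁) ((map_ne_zero _).2 h₂)),
    norm_mul, norm_neg, Complex.norm_conj, conj_eq_sq_norm_div h₂]
  push_cast
  field_simp

theorem exp_δ₁ (hq : p.k₁ ^ 2 - 3 * p.κ₁ ^ 2 ≠ p.k₂ ^ 2 - 3 * p.κ₂ ^ 2) :
    Complex.exp (p.δ₁ * Complex.I) = (p.z₂ - conj p.z₁) * (conj p.z₁ + conj p.z₂)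
      / (‖p.z₁ - conj p.z₂‖ * ‖p.z₁ + p.z₂‖) := by
  have e : (⟨p.k₂ ^ 2 - p.k₁ ^ 2 + (p.κ₁ + p.κ₂) ^ 2, 2 * p.k₁ * (p.κ₁ + p.κ₂)⟩ : ℂ)
      = -conj (p.z₁ - conj p.z₂) * conj (p.z₁ + p.z₂) := by
    apply Complex.ext <;> simp [ModParams.z₁, ModParams.z₂] <;> ring
  rw [ModParams.δ₁, e, exp_arg_mul_I
    (mul_ne_zero (neg_ne_zero.2 ((map_ne_zero _).2 (z₁_sub_conj_z₂_ne_zero hq)))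
      ((map_ne_zero _).2 (z₁_add_z₂_ne_zero hq))), norm_mul, norm_neg, Complex.norm_conj,
    Complex.norm_conj]
  push_cast
  rw [map_sub, map_add, Complex.conj_conj, neg_sub]

theorem exp_δ₂ (hq : p.k₁ ^ 2 - 3 * p.κ₁ ^ 2 ≠ p.k₂ ^ 2 - 3 * p.κ₂ ^ 2) :
    Complex.exp (p.δ₂ * Complex.I) = (p.z₁ - conj p.z₂) * (conj p.z₁ + conj p.z₂)
      / (‖p.z₁ - conj p.z₂‖ * ‖p.z₁ + p.z₂‖) := by
  have e : (⟨p.k₁ ^ 2 - p.k₂ ^ 2 + (p.κ₁ + p.κ₂) ^ 2, 2 * p.k₂ * (p.κ₁ + p.κ₂)⟩ : ℂ)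
      = (p.z₁ - conj p.z₂) * conj (p.z₁ + p.z₂) := by
    apply Complex.ext <;> simp [ModParams.z₁, ModParams.z₂] <;> ring
  rw [ModParams.δ₂, e, exp_arg_mul_I
    (mul_ne_zero (z₁_sub_conj_z₂_ne_zero hq) ((map_ne_zero _).2 (z₁_add_z₂_ne_zero hq))),
    norm_mul, Complex.norm_conj]
  push_cast
  rw [map_add]

theorem exp_ρ (hq : p.k₁ ^ 2 - 3 * p.κ₁ ^ 2 ≠ p.k₂ ^ 2 - 3 * p.κ₂ ^ 2) :
    Complex.exp (p.ρ * Complex.I)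
      = Complex.exp ((p.δ₁ / 2 : ℝ) * Complex.I) * Complex.exp ((p.δ₂ / 2 : ℝ) * Complex.I)
        * ((p.z₁ + p.z₂) / (Complex.I * ‖p.z₁ + p.z₂‖)) := by
  have e : (⟨p.κ₁ + p.κ₂, p.k₁ + p.k₂⟩ : ℂ) = Complex.I * conj (p.z₁ + p.z₂) := by
    apply Complex.ext <;> simp [ModParams.z₁, ModParams.z₂, add_comm]
  have h := z₁_add_z₂_ne_zero hq
  have h' : (‖p.z₁ + p.z₂‖ : ℂ) ≠ 0 := by simpa using h
  have h₀ : ((p.ρ : ℝ) : ℂ) * Complex.I = (p.δ₁ / 2 : ℝ) * Complex.I + (p.δ₂ / 2 : ℝ) * Complex.I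
      - (Complex.I * conj (p.z₁ + p.z₂)).arg * Complex.I := by
    rw [ModParams.ρ, e]
    push_cast
    ring
  rw [h₀, Complex.exp_sub, Complex.exp_add, exp_arg_mul_I
    (mul_ne_zero Complex.I_ne_zero ((map_ne_zero _).2 h)), norm_mul, Complex.norm_I, one_mul,
    Complex.norm_conj, conj_eq_sq_norm_div h]
  field_simp

/-- The product of exp(iδ₁) and exp(iδ₂) is the square of the unit vector of κ₁ + κ₂ + i(k₁ + k₂),
so exp(iρ) = ±1. It records the sign lost when principal arguments are halved. -/
theorem exp_ρ_sq (hq : p.k₁ ^ 2 - 3 * p.κ₁ ^ 2 ≠ p.k₂ ^ 2 - 3 * p.κ₂ ^ 2) :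
    Complex.exp (p.ρ * Complex.I) ^ 2 = 1 := by
  have hc := z₁_add_z₂_ne_zero hq
  have hu := z₁_sub_conj_z₂_ne_zero hq
  have hc' : (‖p.z₁ + p.z₂‖ : ℂ) ≠ 0 := by simpa using hc
  have hu' : (‖p.z₁ - conj p.z₂‖ : ℂ) ≠ 0 := by simpa using hu
  have half (δ : ℝ) : Complex.exp ((δ / 2 : ℝ) * Complex.I) ^ 2 = Complex.exp (δ * Complex.I) := by
    rw [← Complex.exp_nat_mul]
    congr 1
    push_cast
    ring
  have e : p.z₂ - conj p.z₁ = -conj (p.z₁ - conj p.z₂) := by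
    rw [map_sub, Complex.conj_conj, neg_sub]
  rw [exp_ρ hq, mul_pow, mul_pow, half, half, exp_δ₁ hq, exp_δ₂ hq, e, ← map_add,
    conj_eq_sq_norm_div hc, conj_eq_sq_norm_div hu, div_pow, mul_pow, Complex.I_sq]
  field_simp

theorem exp_arg_ofReal_sq {κ : ℝ} (hκ : κ ≠ 0) :
    Complex.exp ((κ : ℂ).arg * Complex.I) ^ 2 = 1 := by
  have h : (κ : ℂ) ≠ 0 := by exact_mod_cast hκ
  rw [exp_arg_mul_I h, div_pow, Complex.norm_real, Real.norm_eq_abs]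
  norm_cast
  rw [sq_abs]
  exact div_self (pow_ne_zero 2 hκ)

theorem ofReal_eq_abs_mul_exp_arg (κ : ℝ) :
    (κ : ℂ) = (|κ| : ℝ) * Complex.exp ((κ : ℂ).arg * Complex.I) := by
  rw [← Real.norm_eq_abs, ← Complex.norm_real, Complex.norm_mul_exp_arg_mul_I]

/-- The conjugate wave number in terms of the angles `lam₁`, `lam₂`. -/
theorem conj_eq_mul_exp_half_arg_sq {z : ℂ} (hz : z.im ≠ 0) :
    conj z = -(Complex.exp ((z.im : ℂ).arg * Complex.I) * Complex.I) * ‖z‖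
      * Complex.exp (((z.im * (z.im + z.re * Complex.I) : ℂ).arg / 2 : ℝ) * Complex.I) ^ 2 := by
  have h₀ : z ≠ 0 := by
    rintro rfl
    exact hz rfl
  have e : (z.im * (z.im + z.re * Complex.I) : ℂ) = z.im * (Complex.I * conj z) := by
    congr 1
    apply Complex.ext <;> simp
  have h₁ : (z.im : ℂ) ≠ 0 := by exact_mod_cast hz
  have h₂ : conj z ≠ 0 := (map_ne_zero _).2 h₀
  have h₃ : (‖z‖ : ℂ) ≠ 0 := by simpa using h₀
  have h₄ : Complex.exp (((z.im * (z.im + z.re * Complex.I) : ℂ).arg / 2 : ℝ) * Complex.I) ^ 2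
      = Complex.exp ((z.im * (z.im + z.re * Complex.I) : ℂ).arg * Complex.I) := by
    rw [← Complex.exp_nat_mul]
    congr 1
    push_cast
    ring
  rw [h₄, e, exp_arg_mul_I (mul_ne_zero h₁ (mul_ne_zero Complex.I_ne_zero h₂)), norm_mul, norm_mul, Complex.norm_I, one_mul, Complex.norm_conj, Complex.norm_real,
    Real.norm_eq_abs]
  have h₅ := ofReal_eq_abs_mul_exp_arg z.im
  have h₆ := exp_arg_ofReal_sq hz
  generalize Complex.exp ((z.im : ℂ).arg * Complex.I) = r at *
  have h₇ : ((|z.im| : ℝ) : ℂ) ≠ 0 := by exact_mod_cast abs_ne_zero.2 hz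
  rw [h₅]
  push_cast at h₇ ⊢
  field_simp
  rw [Complex.I_sq, h₆]
  norm_num

end Parameters

/-! ### The cosh amplitudes realize the monomial parametrization -/

section Parametrization

variable (p : ModParams)

/-- The first amplitude of the 2-soliton in the rational cosh form. -/
def coshAmplitude₁ (φ : ℝ) : ℂ :=
  (2 * |p.k₁| * √‖p.z₁‖ / (√|2 * p.κ₁| * √(p.Δ * p.Γ)) : ℝ)
    * Complex.exp ((φ - (p.α₂ + p.γ₂) : ℝ) * Complex.I)

/-- The second amplitude of the 2-soliton in the rational cosh form. -/
def coshAmplitude₂ (φ : ℝ) : ℂ :=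
  (2 * |p.k₂| * √‖p.z₂‖ / (√|2 * p.κ₂| * √(p.Δ * p.Γ)) : ℝ)
    * Complex.exp ((φ - (p.α₁ + p.γ₁) : ℝ) * Complex.I)

theorem hirotaExp_polar (k κ R φ β t x : ℝ) :
    hirotaExp ⟨k, κ⟩ (R * Complex.exp ((φ - β : ℝ) * Complex.I)) t x
      = R * Complex.exp ((k * x + -k * (k ^ 2 - 3 * κ ^ 2) * t : ℝ))
        * Complex.exp ((φ + (κ * x + -κ * (3 * k ^ 2 - κ ^ 2) * t) : ℝ) * Complex.I)
        / Complex.exp (β * Complex.I) := by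
  have e : (⟨k, κ⟩ : ℂ) = k + κ * Complex.I := Complex.mk_eq_add_mul_I k κ
  rw [hirotaExp, e, mul_assoc, mul_assoc, mul_div_assoc, mul_div_assoc, ← Complex.exp_sub,
    ← Complex.exp_add, ← Complex.exp_add]
  congr 2
  push_cast
  have hI := Complex.I_sq
  -- The real and imaginary parts of -z³ are the frequencies w and ω.
  linear_combination (-(3 * k * κ ^ 2 + κ ^ 3 * Complex.I) * t : ℂ) * hI

theorem conj_polar (R X g β : ℝ) :
    conj ((R : ℂ) * Complex.exp (X : ℝ) * Complex.exp (g * Complex.I)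
        / Complex.exp (β * Complex.I))
      = R * Complex.exp (X : ℝ) / Complex.exp (g * Complex.I) * Complex.exp (β * Complex.I) := by
  have h (y : ℝ) : conj (Complex.exp (y * Complex.I)) = (Complex.exp (y * Complex.I))⁻¹ := by
    rw [← Complex.exp_conj, map_mul, Complex.conj_I, Complex.conj_ofReal, mul_neg,
      Complex.exp_neg]
  rw [map_div₀, map_mul, map_mul, h, h, Complex.conj_ofReal, ← Complex.exp_conj,
    Complex.conj_ofReal, div_inv_eq_mul]
  rfl

theorem sqrt_Δ_mul_Γ : √(p.Δ * p.Γ)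
    = √‖p.z₁ - conj p.z₂‖ / √‖p.z₁ + p.z₂‖ * (‖p.z₁ - p.z₂‖ / ‖p.z₁ + conj p.z₂‖) := by
  rw [Δ_eq, Γ_eq, ← mul_pow, Real.sqrt_sq (by positivity)]

variable {p}

/-- The definition of ρ solved for the second half angle. It removes δ₂ as an independent quantity,
leaving d = exp(iδ₁/2) and the sign exp(iρ). -/
theorem exp_half_δ₂ (hq : p.k₁ ^ 2 - 3 * p.κ₁ ^ 2 ≠ p.k₂ ^ 2 - 3 * p.κ₂ ^ 2) :
    Complex.exp ((p.δ₂ / 2 : ℝ) * Complex.I)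
      = Complex.exp (p.ρ * Complex.I) * Complex.I * (√‖p.z₁ + p.z₂‖ : ℝ) ^ 2
        / ((p.z₁ + p.z₂) * Complex.exp ((p.δ₁ / 2 : ℝ) * Complex.I)) := by
  have h := z₁_add_z₂_ne_zero hq
  have h' : (‖p.z₁ + p.z₂‖ : ℂ) ≠ 0 := by simpa using h
  rw [exp_ρ hq, ← Complex.ofReal_pow, Real.sq_sqrt (norm_nonneg _)]
  field_simp [Complex.exp_ne_zero]

theorem exp_α₂_add_γ₂ (hq : p.k₁ ^ 2 - 3 * p.κ₁ ^ 2 ≠ p.k₂ ^ 2 - 3 * p.κ₂ ^ 2) :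
    Complex.exp ((p.α₂ + p.γ₂ : ℝ) * Complex.I)
      = Complex.exp ((p.lam₁ / 2 : ℝ) * Complex.I)
        * (Complex.exp (p.ρ * Complex.I) * Complex.I * (√‖p.z₁ + p.z₂‖ : ℝ) ^ 2
          / ((p.z₁ + p.z₂) * Complex.exp ((p.δ₁ / 2 : ℝ) * Complex.I)))
        * (-((p.z₁ - p.z₂) * ‖p.z₁ + conj p.z₂‖)
          / (‖p.z₁ - p.z₂‖ * (p.z₁ + conj p.z₂))) := by
  rw [← exp_half_δ₂ hq, ← exp_γ₂ hq, ← Complex.exp_add, ← Complex.exp_add, ModParams.α₂]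
  congr 1
  push_cast
  ring

theorem exp_α₁_add_γ₁ (hq : p.k₁ ^ 2 - 3 * p.κ₁ ^ 2 ≠ p.k₂ ^ 2 - 3 * p.κ₂ ^ 2) :
    Complex.exp ((p.α₁ + p.γ₁ : ℝ) * Complex.I)
      = Complex.exp ((p.lam₂ / 2 : ℝ) * Complex.I) * Complex.exp ((p.δ₁ / 2 : ℝ) * Complex.I)
        * ((p.z₁ - p.z₂) * (p.z₁ + conj p.z₂)
          / (‖p.z₁ - p.z₂‖ * ‖p.z₁ + conj p.z₂‖)) := by
  rw [← exp_γ₁ hq, ← Complex.exp_add, ← Complex.exp_add, ModParams.α₁]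
  congr 1
  push_cast
  ring

/-- The dictionary: s, s₁, s₂ are signs times i; K, m, n are |k|, √|z|, √|2κ|; a, b, χ², ε² are the
moduli of z₁ - z₂, z₁ + z̄₂, z₁ + z₂, z₁ - z̄₂; d, ℓ₁, ℓ₂ are half-angle exponentials; x, g are the
exponentials of the envelope variables and of the carrier phases. -/
theorem isCoshParametrization (hk₁ : p.k₁ ≠ 0) (hk₂ : p.k₂ ≠ 0)
    (hq : p.k₁ ^ 2 - 3 * p.κ₁ ^ 2 ≠ p.k₂ ^ 2 - 3 * p.κ₂ ^ 2) (hκ₁ : p.κ₁ ≠ 0) (hκ₂ : p.κ₂ ≠ 0)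
    (φ₁ φ₂ t x : ℝ) :
    IsCoshParametrization p.z₁ p.z₂ (conj p.z₁) (conj p.z₂)
      (hirotaExp p.z₁ (coshAmplitude₁ p φ₁) t x) (hirotaExp p.z₂ (coshAmplitude₂ p φ₂) t x)
      (conj (hirotaExp p.z₁ (coshAmplitude₁ p φ₁) t x))
      (conj (hirotaExp p.z₂ (coshAmplitude₂ p φ₂) t x))
      (p.z₁ - p.z₂) (p.z₁ + conj p.z₂) (p.z₁ + p.z₂) (Complex.exp ((p.δ₁ / 2 : ℝ) * Complex.I))
      (Complex.exp ((p.lam₁ / 2 : ℝ) * Complex.I)) (Complex.exp ((p.lam₂ / 2 : ℝ) * Complex.I))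
      ‖p.z₁ - p.z₂‖ ‖p.z₁ + conj p.z₂‖ (√‖p.z₁ + p.z₂‖ : ℝ) (√‖p.z₁ - conj p.z₂‖ : ℝ)
      (√‖p.z₁‖ : ℝ) (√‖p.z₂‖ : ℝ) (√|2 * p.κ₁| : ℝ) (√|2 * p.κ₂| : ℝ) (|p.k₁| : ℝ) (|p.k₂| : ℝ)
      (Complex.exp (p.k₁ * x + p.w₁ * t : ℝ)) (Complex.exp (p.k₂ * x + p.w₂ * t : ℝ))
      (Complex.exp ((φ₁ + (p.κ₁ * x + p.ω₁ * t) : ℝ) * Complex.I))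
      (Complex.exp ((φ₂ + (p.κ₂ * x + p.ω₂ * t) : ℝ) * Complex.I))
      (Complex.exp (p.ρ * Complex.I) * Complex.I) (Complex.exp (p.ρ₁ * Complex.I) * Complex.I)
      (Complex.exp (p.ρ₂ * Complex.I) * Complex.I) := by
  have hz₁ := z₁_ne_zero hk₁
  have hz₂ := z₂_ne_zero hk₂
  have hp := z₁_sub_z₂_ne_zero hq
  have hb := z₁_add_conj_z₂_ne_zero hq
  have hc := z₁_add_z₂_ne_zero hq
  have hu := z₁_sub_conj_z₂_ne_zero hq
  have nz {z : ℂ} (h : z ≠ 0) : ((√‖z‖ : ℝ) : ℂ) ≠ 0 := by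
    exact_mod_cast (Real.sqrt_pos.2 (norm_pos_iff.2 h)).ne'
  have nn {z : ℂ} (h : z ≠ 0) : (‖z‖ : ℂ) ≠ 0 := by simpa using h
  have nκ {κ : ℝ} (h : κ ≠ 0) : ((√|2 * κ| : ℝ) : ℂ) ≠ 0 := by
    exact_mod_cast (Real.sqrt_pos.2 (abs_pos.2 (mul_ne_zero two_ne_zero h))).ne'
  have nk {k : ℝ} (h : k ≠ 0) : ((|k| : ℝ) : ℂ) ≠ 0 := by exact_mod_cast abs_ne_zero.2 h
  have sq (y : ℝ) (h : 0 ≤ y) : ((√y : ℝ) : ℂ) ^ 2 = y := by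
    rw [← Complex.ofReal_pow, Real.sq_sqrt h]
  have sI {r : ℂ} (h : r ^ 2 = 1) : (r * Complex.I) ^ 2 = -1 := by
    rw [mul_pow, h, Complex.I_sq, one_mul]
  have hs := sI (exp_ρ_sq hq)
  have hs₁ : (Complex.exp (p.ρ₁ * Complex.I) * Complex.I) ^ 2 = -1 := sI (exp_arg_ofReal_sq hκ₁)
  have hs₂ : (Complex.exp (p.ρ₂ * Complex.I) * Complex.I) ^ 2 = -1 := sI (exp_arg_ofReal_sq hκ₂)
  have ey₁ : conj p.z₁ = -(Complex.exp (p.ρ₁ * Complex.I) * Complex.I) * (√‖p.z₁‖ : ℝ) ^ 2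
      * Complex.exp ((p.lam₁ / 2 : ℝ) * Complex.I) ^ 2 := by
    rw [sq _ (norm_nonneg _)]
    exact conj_eq_mul_exp_half_arg_sq (z := p.z₁) hκ₁
  have ey₂ : conj p.z₂ = -(Complex.exp (p.ρ₂ * Complex.I) * Complex.I) * (√‖p.z₂‖ : ℝ) ^ 2
      * Complex.exp ((p.lam₂ / 2 : ℝ) * Complex.I) ^ 2 := by
    rw [sq _ (norm_nonneg _)]
    exact conj_eq_mul_exp_half_arg_sq (z := p.z₂) hκ₂
  -- z is recovered from z̄ by z·z̄ = |z|² = m⁴.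
  have ez {z s m ℓ : ℂ} (hz : z ≠ 0) (hs : s ^ 2 = -1) (hℓ : ℓ ≠ 0) (hm : m ≠ 0)
      (h : m ^ 2 = ‖z‖) (e : conj z = -s * m ^ 2 * ℓ ^ 2) : z = s * m ^ 2 / ℓ ^ 2 := by
    have h₁ := Complex.mul_conj' z
    rw [e, ← h] at h₁
    rw [eq_div_iff (pow_ne_zero 2 hℓ)]
    have h₂ : m ^ 2 * (z * ℓ ^ 2 - s * m ^ 2) = 0 := by
      linear_combination s * h₁ + m ^ 2 * z * ℓ ^ 2 * hs
    exact sub_eq_zero.1 ((mul_eq_zero.1 h₂).resolve_left (pow_ne_zero 2 hm))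
  have ezy (z : ℂ) : z - conj z = Complex.exp ((z.im : ℂ).arg * Complex.I) * Complex.I
      * (√|2 * z.im| : ℝ) ^ 2 := by
    rw [sq _ (abs_nonneg _), Complex.sub_conj, abs_mul, abs_two]
    push_cast
    conv_lhs => rw [ofReal_eq_abs_mul_exp_arg z.im]
    ring
  have eS (z : ℂ) : (z + conj z) ^ 2 = 4 * ((|z.re| : ℝ) : ℂ) ^ 2 := by
    rw [Complex.add_conj, ← Complex.ofReal_pow (|z.re|), sq_abs]
    push_cast
    ring
  have ec' : conj p.z₁ + conj p.z₂ = ((√‖p.z₁ + p.z₂‖ : ℝ) : ℂ) ^ 4 / (p.z₁ + p.z₂) := by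
    rw [← map_add, conj_eq_sq_norm_div hc, show 4 = 2 * 2 from rfl, pow_mul,
      sq _ (norm_nonneg _)]
  have eu' : p.z₂ - conj p.z₁ = ((√‖p.z₁ - conj p.z₂‖ : ℝ) : ℂ) ^ 2
      * Complex.exp ((p.δ₁ / 2 : ℝ) * Complex.I) ^ 2 * (p.z₁ + p.z₂)
      / ((√‖p.z₁ + p.z₂‖ : ℝ) : ℂ) ^ 2 := by
    have h : Complex.exp ((p.δ₁ / 2 : ℝ) * Complex.I) ^ 2 = Complex.exp (p.δ₁ * Complex.I) := by
      rw [← Complex.exp_nat_mul]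
      congr 1
      push_cast
      ring
    have h₁ := nn hc
    have h₂ := nn hu
    rw [h, exp_δ₁ hq, ec', show 4 = 2 * 2 from rfl, pow_mul, sq _ (norm_nonneg _),
      sq _ (norm_nonneg _)]
    field_simp
  -- Up to sign the conjugate of `eu'`, obtained from the squared modulus ε⁴ instead of conjugating
  -- the half-angle exponential.
  have eu : p.z₁ - conj p.z₂ = -((√‖p.z₁ - conj p.z₂‖ : ℝ) : ℂ) ^ 2
      * ((√‖p.z₁ + p.z₂‖ : ℝ) : ℂ) ^ 2
      / (Complex.exp ((p.δ₁ / 2 : ℝ) * Complex.I) ^ 2 * (p.z₁ + p.z₂)) := by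
    have h := conj_eq_sq_norm_div hu
    have e : conj (p.z₁ - conj p.z₂) = -(p.z₂ - conj p.z₁) := by
      rw [map_sub, Complex.conj_conj, neg_sub]
    rw [e, eu', ← sq _ (norm_nonneg _)] at h
    have h₁ := nz hc
    have h₂ := nz hu
    have h₃ := Complex.exp_ne_zero ((p.δ₁ / 2 : ℝ) * Complex.I)
    generalize Complex.exp ((p.δ₁ / 2 : ℝ) * Complex.I) = d at *
    generalize ((√‖p.z₁ - conj p.z₂‖ : ℝ) : ℂ) = ε at *
    field_simp at h ⊢
    linear_combination -h
  have eE₁ := hirotaExp_polar p.k₁ p.κ₁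
    (2 * |p.k₁| * √‖p.z₁‖ / (√|2 * p.κ₁| * √(p.Δ * p.Γ))) φ₁ (p.α₂ + p.γ₂) t x
  have eE₂ := hirotaExp_polar p.k₂ p.κ₂
    (2 * |p.k₂| * √‖p.z₂‖ / (√|2 * p.κ₂| * √(p.Δ * p.Γ))) φ₂ (p.α₁ + p.γ₁) t x
  have ee₁ := congrArg conj eE₁
  have ee₂ := congrArg conj eE₂
  rw [conj_polar] at ee₁ ee₂
  change hirotaExp p.z₁ (coshAmplitude₁ p φ₁) t x = _ * Complex.exp (p.k₁ * x + p.w₁ * t : ℝ)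
    * Complex.exp ((φ₁ + (p.κ₁ * x + p.ω₁ * t) : ℝ) * Complex.I) / _ at eE₁
  change hirotaExp p.z₂ (coshAmplitude₂ p φ₂) t x = _ * Complex.exp (p.k₂ * x + p.w₂ * t : ℝ)
    * Complex.exp ((φ₂ + (p.κ₂ * x + p.ω₂ * t) : ℝ) * Complex.I) / _ at eE₂
  change conj (hirotaExp p.z₁ (coshAmplitude₁ p φ₁) t x)
    = _ * Complex.exp (p.k₁ * x + p.w₁ * t : ℝ)
    / Complex.exp ((φ₁ + (p.κ₁ * x + p.ω₁ * t) : ℝ) * Complex.I) * _ at ee₁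
  change conj (hirotaExp p.z₂ (coshAmplitude₂ p φ₂) t x)
    = _ * Complex.exp (p.k₂ * x + p.w₂ * t : ℝ)
    / Complex.exp ((φ₂ + (p.κ₂ * x + p.ω₂ * t) : ℝ) * Complex.I) * _ at ee₂
  rw [exp_α₂_add_γ₂ hq, sqrt_Δ_mul_Γ] at eE₁ ee₁
  rw [exp_α₁_add_γ₁ hq, sqrt_Δ_mul_Γ] at eE₂ ee₂
  have na := nn hp
  have nb := nn hb
  have nχ := nz hc
  have nε := nz hu
  have nκ₁ := nκ hκ₁
  have nκ₂ := nκ hκ₂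
  have nd := Complex.exp_ne_zero ((p.δ₁ / 2 : ℝ) * Complex.I)
  have nℓ₁ := Complex.exp_ne_zero ((p.lam₁ / 2 : ℝ) * Complex.I)
  have nℓ₂ := Complex.exp_ne_zero ((p.lam₂ / 2 : ℝ) * Complex.I)
  have ng₁ := Complex.exp_ne_zero ((φ₁ + (p.κ₁ * x + p.ω₁ * t) : ℝ) * Complex.I)
  have ng₂ := Complex.exp_ne_zero ((φ₂ + (p.κ₂ * x + p.ω₂ * t) : ℝ) * Complex.I)
  have ns : Complex.exp (p.ρ * Complex.I) * Complex.I ≠ 0 :=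
    mul_ne_zero (Complex.exp_ne_zero _) Complex.I_ne_zero
  refine ⟨hp, hb, hc, nd, nℓ₁, nℓ₂, na, nb, nχ, nε, nz hz₁, nz hz₂, nκ₁, nκ₂, nk hk₁,
    nk hk₂, Complex.exp_ne_zero _, Complex.exp_ne_zero _, ng₁, ng₂, hs, hs₁, hs₂,
    ez hz₁ hs₁ nℓ₁ (nz hz₁) (sq _ (norm_nonneg _)) ey₁,
    ez hz₂ hs₂ nℓ₂ (nz hz₂) (sq _ (norm_nonneg _)) ey₂, ey₁, ey₂, ezy p.z₁, ezy p.z₂, eS p.z₁,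
    eS p.z₂, rfl, ?_, rfl, ?_, rfl, ec', eu, eu', ?_, ?_, ?_, ?_⟩
  · rw [← map_sub, conj_eq_sq_norm_div hp]
  · rw [← conj_eq_sq_norm_div hb, map_add, Complex.conj_conj, add_comm]
  · rw [eE₁]
    push_cast
    generalize Complex.exp (p.ρ * Complex.I) * Complex.I = s at *
    field_simp
  · rw [ee₁]
    push_cast
    generalize Complex.exp (p.ρ * Complex.I) * Complex.I = s at *
    field_simp
  · rw [eE₂]
    push_cast
    field_simp
  · rw [ee₂]
    push_cast
    field_simp

end Parametrization

/-! ### The envelope numerators in the parametrization -/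

section Envelopes

variable {p : ModParams}

theorem coshI_eq (a b : ℝ) :
    ModParams.coshI a b = joukowski (Complex.exp (a : ℝ) * Complex.exp (b * Complex.I)) := by
  rw [ModParams.coshI, joukowski, ← Complex.exp_add, ← Complex.exp_neg, Complex.cosh]

theorem cosh_eq (a : ℝ) : ((Real.cosh a : ℝ) : ℂ) = joukowski (Complex.exp (a : ℝ)) := by
  rw [Complex.ofReal_cosh, joukowski, ← Complex.exp_neg, Complex.cosh]

theorem joukowski_inv (w : ℂ) : joukowski w⁻¹ = joukowski w := by
  rw [joukowski, joukowski, inv_inv, add_comm]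

theorem rpow_quarter₁ (p : ModParams) : (p.k₁ ^ 2 + p.κ₁ ^ 2) ^ (1 / 4 : ℝ) = √‖p.z₁‖ := by
  rw [norm_z₁, rpow_sq_sq (Real.sqrt_nonneg _)]

theorem rpow_quarter₂ (p : ModParams) : (p.k₂ ^ 2 + p.κ₂ ^ 2) ^ (1 / 4 : ℝ) = √‖p.z₂‖ := by
  rw [norm_z₂, rpow_sq_sq (Real.sqrt_nonneg _)]

theorem sqrt_sq_add_sq₁ (p : ModParams) : √(p.k₁ ^ 2 + p.κ₁ ^ 2) = √‖p.z₁‖ ^ 2 := by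
  rw [norm_z₁, Real.sqrt_sq (by positivity)]

theorem sqrt_sq_add_sq₂ (p : ModParams) : √(p.k₂ ^ 2 + p.κ₂ ^ 2) = √‖p.z₂‖ ^ 2 := by
  rw [norm_z₂, Real.sqrt_sq (by positivity)]

theorem abs_eq_sq_sqrt_div_two (κ : ℝ) : |κ| = √|2 * κ| ^ 2 / 2 := by
  rw [Real.sq_sqrt (abs_nonneg _), abs_mul, abs_two]
  ring

theorem sqrt_abs_eight_mul (κ : ℝ) : √|8 * κ| = 2 * √|2 * κ| := by
  rw [show 8 * κ = 2 ^ 2 * (2 * κ) by ring, abs_mul, Real.sqrt_mul (abs_nonneg _),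
    abs_of_pos (by norm_num : (0 : ℝ) < 2 ^ 2), Real.sqrt_sq zero_le_two]

theorem sqrt_abs_mul (κ₁ κ₂ : ℝ) : √|κ₁ * κ₂| = √|2 * κ₁| * √|2 * κ₂| / 2 := by
  rw [← Real.sqrt_mul (abs_nonneg _), ← abs_mul,
    show 2 * κ₁ * (2 * κ₂) = 2 ^ 2 * (κ₁ * κ₂) by ring, abs_mul (2 ^ 2),
    Real.sqrt_mul (abs_nonneg _), abs_of_pos (by norm_num : (0 : ℝ) < 2 ^ 2),
    Real.sqrt_sq zero_le_two, mul_div_cancel_left₀ _ two_ne_zero]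

theorem sqrt_Δ (p : ModParams) : √p.Δ = √‖p.z₁ - conj p.z₂‖ / √‖p.z₁ + p.z₂‖ := by
  rw [Δ_eq, Real.sqrt_sq (by positivity)]

theorem sqrt_Γ (p : ModParams) : √p.Γ = ‖p.z₁ - p.z₂‖ / ‖p.z₁ + conj p.z₂‖ := by
  rw [Γ_eq, Real.sqrt_sq (by positivity)]

theorem sqrt_Ω (p : ModParams) : √p.Ω = √‖p.z₁ + p.z₂‖ * √‖p.z₁ - conj p.z₂‖ := by
  rw [Ω_eq, Real.sqrt_sq (by positivity)]

theorem sqrt_Υ (p : ModParams) : √p.Υ = ‖p.z₁ - p.z₂‖ * ‖p.z₁ + conj p.z₂‖ := by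
  rw [Υ_eq, Real.sqrt_sq (by positivity)]

theorem sqrt_Ω_mul_Υ (p : ModParams) : √(p.Ω * p.Υ)
    = √‖p.z₁ + p.z₂‖ * √‖p.z₁ - conj p.z₂‖ * (‖p.z₁ - p.z₂‖ * ‖p.z₁ + conj p.z₂‖) := by
  rw [Ω_eq, Υ_eq, ← mul_pow, Real.sqrt_sq (by positivity)]

theorem sqrt_Γ_mul_Υ (p : ModParams) : √(p.Γ * p.Υ)
    = ‖p.z₁ - p.z₂‖ / ‖p.z₁ + conj p.z₂‖ * (‖p.z₁ - p.z₂‖ * ‖p.z₁ + conj p.z₂‖) := by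
  rw [Γ_eq, Υ_eq, ← mul_pow, Real.sqrt_sq (by positivity)]

/-- The first envelope numerator in terms of the atoms of `IsCoshParametrization`. -/
theorem X₁_eq (hq : p.k₁ ^ 2 - 3 * p.κ₁ ^ 2 ≠ p.k₂ ^ 2 - 3 * p.κ₂ ^ 2)
    {P q c d ℓ₁ ℓ₂ a b χ ε s s₁ s₂ : ℂ} (φ₁ φ₂ θ₁ θ₂ : ℝ)
    (hP : p.z₁ - p.z₂ = P) (hq' : p.z₁ + conj p.z₂ = q) (hc : p.z₁ + p.z₂ = c)
    (hd : Complex.exp ((p.δ₁ / 2 : ℝ) * Complex.I) = d)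
    (hℓ₁ : Complex.exp ((p.lam₁ / 2 : ℝ) * Complex.I) = ℓ₁)
    (hℓ₂ : Complex.exp ((p.lam₂ / 2 : ℝ) * Complex.I) = ℓ₂)
    (ha : (‖p.z₁ - p.z₂‖ : ℂ) = a) (hb : (‖p.z₁ + conj p.z₂‖ : ℂ) = b)
    (hχ : ((√‖p.z₁ + p.z₂‖ : ℝ) : ℂ) = χ) (hε : ((√‖p.z₁ - conj p.z₂‖ : ℝ) : ℂ) = ε)
    (hs : Complex.exp (p.ρ * Complex.I) * Complex.I = s)
    (hs₁ : Complex.exp (p.ρ₁ * Complex.I) * Complex.I = s₁)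
    (hs₂ : Complex.exp (p.ρ₂ * Complex.I) * Complex.I = s₂) :
    p.X₁ φ₁ φ₂ θ₁ θ₂
      = (|p.k₁| : ℝ) * (√‖p.z₁‖ : ℝ) * (√|2 * p.κ₁| : ℝ) * (((√|2 * p.κ₂| : ℝ) : ℂ) ^ 2 / 2
            * (ε * a / (χ * b)
                * joukowski (Complex.exp (θ₁ : ℝ) * Complex.exp (θ₂ : ℝ) ^ 2
                  * (ℓ₁ * (s * χ ^ 2 / (c * d)) * (-(P * b) / (a * q))))
              + χ * b / (ε * a)
                * joukowski (Complex.exp (θ₁ : ℝ) / Complex.exp (θ₂ : ℝ) ^ 2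
                  * (ℓ₁ * c * d / (s * χ ^ 2) * (-(a * q) / (P * b)))))
          + ((√‖p.z₂‖ : ℝ) : ℂ) ^ 2
            * (-4 * ((|p.k₂| : ℝ) : ℂ) ^ 2 * ((√|2 * p.κ₂| : ℝ) : ℂ) ^ 2 / (χ * ε * a * b)
                * joukowski (Complex.exp (θ₁ : ℝ) * (-s * s₂ * (ℓ₁ / d) * (P * q / (a * b))))
              + a * χ / (b * ε)
                * joukowski (Complex.exp (θ₁ : ℝ)
                  * (ℓ₁ * (s * χ ^ 2 / (c * d)) * (-(a * q) / (P * b))))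
              + ε * b / (χ * a)
                * joukowski (Complex.exp (θ₁ : ℝ)
                  * (ℓ₁ * (c * d / (s * χ ^ 2)) * (-(P * b) / (a * q))))))
        - ((|p.k₁| : ℝ) : ℂ) ^ 2 * (|p.k₂| : ℝ) * (√‖p.z₂‖ : ℝ) * (2 * (√|2 * p.κ₂| : ℝ))
          * (χ * ε / (a * b)
          * Complex.exp ((p.μ₁ * θ₁ - p.μ₂ * θ₂ + φ₁ - φ₂ : ℝ) * Complex.I)
          * joukowski ((Complex.exp (θ₂ : ℝ))⁻¹
            * (-s * s₁ * (ℓ₂ * c * d / (s * χ ^ 2)) * (-(a * q) / (P * b))))) := by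
  have e₁ := exp_α₂_add_γ₂ hq
  have e₂ : Complex.exp ((p.υ₂ - p.γ₂ : ℝ) * Complex.I)
      = Complex.exp ((p.lam₁ / 2 : ℝ) * Complex.I) / Complex.exp ((p.δ₂ / 2 : ℝ) * Complex.I)
        / Complex.exp (p.γ₂ * Complex.I) := by
    rw [← Complex.exp_sub, ← Complex.exp_sub, ModParams.υ₂]
    congr 1
    push_cast
    ring
  have e₃ : Complex.exp ((p.ρ + p.ρ₂ + p.ϖ₁ + p.γ₁ : ℝ) * Complex.I)
      = -(Complex.exp (p.ρ * Complex.I) * Complex.I) * (Complex.exp (p.ρ₂ * Complex.I) * Complex.I)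
        * (Complex.exp ((p.lam₁ / 2 : ℝ) * Complex.I) / Complex.exp ((p.δ₁ / 2 : ℝ) * Complex.I))
        * Complex.exp (p.γ₁ * Complex.I) := by
    have h : -(Complex.exp (p.ρ * Complex.I) * Complex.I)
        * (Complex.exp (p.ρ₂ * Complex.I) * Complex.I)
        = Complex.exp (p.ρ * Complex.I) * Complex.exp (p.ρ₂ * Complex.I) := by
      linear_combination (-(Complex.exp (p.ρ * Complex.I) * Complex.exp (p.ρ₂ * Complex.I)))
        * Complex.I_sq
    rw [h, ← Complex.exp_sub, ← Complex.exp_add, ← Complex.exp_add, ← Complex.exp_add,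
      ModParams.ϖ₁]
    congr 1
    push_cast
    ring
  have e₄ : Complex.exp ((p.α₂ - p.γ₂ : ℝ) * Complex.I)
      = Complex.exp ((p.lam₁ / 2 : ℝ) * Complex.I) * Complex.exp ((p.δ₂ / 2 : ℝ) * Complex.I)
        / Complex.exp (p.γ₂ * Complex.I) := by
    rw [← Complex.exp_add, ← Complex.exp_sub, ModParams.α₂]
    congr 1
    push_cast
    ring
  have e₅ : Complex.exp ((p.υ₂ + p.γ₂ : ℝ) * Complex.I)
      = Complex.exp ((p.lam₁ / 2 : ℝ) * Complex.I) / Complex.exp ((p.δ₂ / 2 : ℝ) * Complex.I)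
        * Complex.exp (p.γ₂ * Complex.I) := by
    rw [← Complex.exp_sub, ← Complex.exp_add, ModParams.υ₂]
    congr 1
    push_cast
    ring
  have e₆ : Complex.exp ((-(p.ρ + p.ρ₁ + p.ϖ₂ - p.γ₂) : ℝ) * Complex.I)
      = (-(Complex.exp (p.ρ * Complex.I) * Complex.I) * (Complex.exp (p.ρ₁ * Complex.I) * Complex.I)
        * (Complex.exp ((p.lam₂ / 2 : ℝ) * Complex.I) / Complex.exp ((p.δ₂ / 2 : ℝ) * Complex.I))
        / Complex.exp (p.γ₂ * Complex.I))⁻¹ := by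
    have h : -(Complex.exp (p.ρ * Complex.I) * Complex.I)
        * (Complex.exp (p.ρ₁ * Complex.I) * Complex.I)
        = Complex.exp (p.ρ * Complex.I) * Complex.exp (p.ρ₁ * Complex.I) := by
      linear_combination (-(Complex.exp (p.ρ * Complex.I) * Complex.exp (p.ρ₁ * Complex.I)))
        * Complex.I_sq
    rw [h, ← Complex.exp_sub, ← Complex.exp_add, ← Complex.exp_add, ← Complex.exp_sub,
      ← Complex.exp_neg, ModParams.ϖ₂]
    congr 1
    push_cast
    ring
  -- All half angles are now expressed by ℓ₁, ℓ₂, d, the sign of ρ and quotients of wave numbers by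
  -- their moduli.
  rw [exp_half_δ₂ hq, exp_γ₂ hq] at e₂ e₄ e₅ e₆
  rw [exp_γ₁ hq] at e₃
  have x₁ : Complex.exp ((θ₁ + 2 * θ₂ : ℝ) : ℂ)
      = Complex.exp (θ₁ : ℝ) * Complex.exp (θ₂ : ℝ) ^ 2 := by
    rw [← Complex.exp_nat_mul, ← Complex.exp_add]
    push_cast
    rfl
  have x₂ : Complex.exp ((θ₁ - 2 * θ₂ : ℝ) : ℂ)
      = Complex.exp (θ₁ : ℝ) / Complex.exp (θ₂ : ℝ) ^ 2 := by
    rw [← Complex.exp_nat_mul, ← Complex.exp_sub]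
    push_cast
    rfl
  rw [ModParams.X₁, coshI_eq, coshI_eq, coshI_eq, coshI_eq, coshI_eq, coshI_eq, e₁, e₂, e₃, e₄, e₅,
    e₆, x₁, x₂, rpow_quarter₁, rpow_quarter₂, sqrt_sq_add_sq₂, abs_eq_sq_sqrt_div_two p.κ₂,
    sqrt_abs_eight_mul, sqrt_Δ_mul_Γ, sqrt_Ω_mul_Υ, sqrt_Δ, sqrt_Γ, sqrt_Ω, sqrt_Υ,
    ← sq_abs p.k₁, ← sq_abs p.k₂]
  simp only [hs, hs₁, hs₂, hd, hℓ₁, hℓ₂]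
  simp only [Complex.ofReal_mul, Complex.ofReal_div, Complex.ofReal_pow, Complex.ofReal_one,
    Complex.ofReal_ofNat, Complex.ofReal_neg, ha, hb, hχ, hε]
  simp only [hP, hq', hc]
  -- Evenness of cosh: the last term carries the negative angle, while the parametrization gives it
  -- with x₂⁻¹.
  rw [← joukowski_inv (Complex.exp (θ₂ : ℝ) * _)]
  rw [show ℓ₁ / (s * χ ^ 2 / (c * d)) / (-(P * b) / (a * q))
      = ℓ₁ * c * d / (s * χ ^ 2) * (-(a * q) / (P * b)) by
      simp only [div_eq_mul_inv, mul_inv, inv_inv, inv_neg]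
      ring,
    show ℓ₁ * (s * χ ^ 2 / (c * d)) / (-(P * b) / (a * q))
      = ℓ₁ * (s * χ ^ 2 / (c * d)) * (-(a * q) / (P * b)) by
      simp only [div_eq_mul_inv, mul_inv, inv_inv, inv_neg]
      ring,
    show ℓ₁ / (s * χ ^ 2 / (c * d)) * (-(P * b) / (a * q))
      = ℓ₁ * (c * d / (s * χ ^ 2)) * (-(P * b) / (a * q)) by
      simp only [div_eq_mul_inv, mul_inv, inv_inv]
      ring,
    show (Complex.exp (θ₂ : ℝ)
        * (-s * s₁ * (ℓ₂ / (s * χ ^ 2 / (c * d))) / (-(P * b) / (a * q)))⁻¹)⁻¹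
      = (Complex.exp (θ₂ : ℝ))⁻¹
        * (-s * s₁ * (ℓ₂ * c * d / (s * χ ^ 2)) * (-(a * q) / (P * b))) by
      simp only [div_eq_mul_inv, mul_inv, inv_inv, inv_neg]
      ring,
    show 1 / (ε / χ * (a / b)) = χ * b / (ε * a) by rw [div_mul_div_comm, one_div_div],
    show a / b / (ε / χ) = a * χ / (b * ε) by rw [div_div_div_eq],
    show ε / χ / (a / b) = ε * b / (χ * a) by rw [div_div_div_eq]]
  ring

end Envelopes

/-! ### The envelope denominator in the parametrization -/

section Denominator

variable {p : ModParams}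

theorem cosh_two_mul_eq (a : ℝ) :
    ((Real.cosh (2 * a) : ℝ) : ℂ) = joukowski (Complex.exp (a : ℝ) ^ 2) := by
  rw [cosh_eq, ← Complex.exp_nat_mul]
  push_cast
  rfl

/-- The phase independent part of the denominator of the envelopes. -/
theorem Y_diag_eq {a b χ ε s₁ s₂ n₁ n₂ : ℂ} (θ₁ θ₂ : ℝ)
    (ha : (‖p.z₁ - p.z₂‖ : ℂ) = a) (hb : (‖p.z₁ + conj p.z₂‖ : ℂ) = b)
    (hχ : ((√‖p.z₁ + p.z₂‖ : ℝ) : ℂ) = χ) (hε : ((√‖p.z₁ - conj p.z₂‖ : ℝ) : ℂ) = ε)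
    (hn₁ : ((√|2 * p.κ₁| : ℝ) : ℂ) = n₁) (hn₂ : ((√|2 * p.κ₂| : ℝ) : ℂ) = n₂)
    (hs₁ : Complex.exp (p.ρ₁ * Complex.I) * Complex.I = s₁)
    (hs₂ : Complex.exp (p.ρ₂ * Complex.I) * Complex.I = s₂) :
    ((√(p.k₁ ^ 2 + p.κ₁ ^ 2) * √(p.k₂ ^ 2 + p.κ₂ ^ 2) *
        (p.Γ / p.Δ + p.Δ / p.Γ
          + 64 * p.k₁ ^ 2 * p.k₂ ^ 2 * p.κ₁ * p.κ₂ * (1 / (p.Ω * p.Υ)))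
      + |p.κ₁ * p.κ₂| *
        (p.Δ * p.Γ * Real.cosh (2 * (θ₁ + θ₂)) + 1 / (p.Δ * p.Γ) * Real.cosh (2 * (θ₁ - θ₂)))
      + 2 * |p.κ₂| * √(p.k₁ ^ 2 + p.κ₁ ^ 2) * Real.cosh (2 * θ₂)
      + 2 * |p.κ₁| * √(p.k₂ ^ 2 + p.κ₂ ^ 2) * Real.cosh (2 * θ₁) : ℝ) : ℂ)
      = ((√‖p.z₁‖ : ℝ) : ℂ) ^ 2 * ((√‖p.z₂‖ : ℝ) : ℂ) ^ 2
          * (a ^ 2 * χ ^ 2 / (b ^ 2 * ε ^ 2) + b ^ 2 * ε ^ 2 / (a ^ 2 * χ ^ 2)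
          + 16 * ((|p.k₁| : ℝ) : ℂ) ^ 2 * ((|p.k₂| : ℝ) : ℂ) ^ 2 * (-s₁ * s₂ * n₁ ^ 2 * n₂ ^ 2)
            / (χ ^ 2 * ε ^ 2 * a ^ 2 * b ^ 2))
        + n₁ ^ 2 * n₂ ^ 2 / 4
          * (ε ^ 2 * a ^ 2 / (χ ^ 2 * b ^ 2)
              * joukowski (Complex.exp (θ₁ : ℝ) ^ 2 * Complex.exp (θ₂ : ℝ) ^ 2)
            + χ ^ 2 * b ^ 2 / (ε ^ 2 * a ^ 2)
              * joukowski (Complex.exp (θ₁ : ℝ) ^ 2 / Complex.exp (θ₂ : ℝ) ^ 2))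
        + n₂ ^ 2 * ((√‖p.z₁‖ : ℝ) : ℂ) ^ 2 * joukowski (Complex.exp (θ₂ : ℝ) ^ 2)
        + n₁ ^ 2 * ((√‖p.z₂‖ : ℝ) : ℂ) ^ 2 * joukowski (Complex.exp (θ₁ : ℝ) ^ 2) := by
  have x₁ : Complex.exp ((θ₁ + θ₂ : ℝ) : ℂ) ^ 2
      = Complex.exp (θ₁ : ℝ) ^ 2 * Complex.exp (θ₂ : ℝ) ^ 2 := by
    rw [← mul_pow, ← Complex.exp_add, Complex.ofReal_add]
  have x₂ : Complex.exp ((θ₁ - θ₂ : ℝ) : ℂ) ^ 2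
      = Complex.exp (θ₁ : ℝ) ^ 2 / Complex.exp (θ₂ : ℝ) ^ 2 := by
    rw [← div_pow, ← Complex.exp_sub, Complex.ofReal_sub]
  -- The signs of κ₁ and κ₂ are -i·s₁ and -i·s₂, so their product is -s₁s₂.
  have eκ : ((p.κ₁ : ℝ) : ℂ) * (p.κ₂ : ℝ) = -s₁ * s₂ * n₁ ^ 2 * n₂ ^ 2 / 4 := by
    rw [ofReal_eq_abs_mul_exp_arg p.κ₁, ofReal_eq_abs_mul_exp_arg p.κ₂, abs_eq_sq_sqrt_div_two p.κ₁,
      abs_eq_sq_sqrt_div_two p.κ₂, ← hs₁, ← hs₂, ← hn₁, ← hn₂, ModParams.ρ₁, ModParams.ρ₂]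
    push_cast
    generalize Complex.exp (Complex.arg p.κ₁ * Complex.I) = u
    generalize Complex.exp (Complex.arg p.κ₂ * Complex.I) = v
    linear_combination (u * v * (√|2 * p.κ₁| : ℝ) ^ 2 * (√|2 * p.κ₂| : ℝ) ^ 2 / 4) * Complex.I_sq
  rw [sqrt_sq_add_sq₁, sqrt_sq_add_sq₂, abs_mul, abs_eq_sq_sqrt_div_two p.κ₁,
    abs_eq_sq_sqrt_div_two p.κ₂, Δ_eq, Γ_eq, Ω_eq, Υ_eq, ← sq_abs p.k₁, ← sq_abs p.k₂]
  simp only [Complex.ofReal_mul, Complex.ofReal_div, Complex.ofReal_pow, Complex.ofReal_one,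
    Complex.ofReal_ofNat, Complex.ofReal_add, cosh_two_mul_eq, ha, hb, hχ, hε, hn₁, hn₂]
  rw [← Complex.ofReal_add, x₁, x₂]
  simp only [div_eq_mul_inv, mul_inv, inv_inv, mul_pow, inv_pow] at eκ ⊢
  linear_combination 64 * ((√‖p.z₁‖ : ℝ) : ℂ) ^ 2 * ((√‖p.z₂‖ : ℝ) : ℂ) ^ 2
    * ((|p.k₁| : ℝ) : ℂ) ^ 2 * ((|p.k₂| : ℝ) : ℂ) ^ 2
    * ((χ ^ 2)⁻¹ * (ε ^ 2)⁻¹ * ((a ^ 2)⁻¹ * (b ^ 2)⁻¹)) * eκ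

/-- The phase dependent part of the denominator of the envelopes. -/
theorem Y_cross_eq (hq : p.k₁ ^ 2 - 3 * p.κ₁ ^ 2 ≠ p.k₂ ^ 2 - 3 * p.κ₂ ^ 2)
    (hκ₁ : p.κ₁ ≠ 0)
    {c d ℓ₁ ℓ₂ a b χ ε s s₁ s₂ n₁ n₂ : ℂ} (φ₁ φ₂ θ₁ θ₂ : ℝ)
    (hc : p.z₁ + p.z₂ = c)
    (hd : Complex.exp ((p.δ₁ / 2 : ℝ) * Complex.I) = d)
    (hℓ₁ : Complex.exp ((p.lam₁ / 2 : ℝ) * Complex.I) = ℓ₁)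
    (hℓ₂ : Complex.exp ((p.lam₂ / 2 : ℝ) * Complex.I) = ℓ₂)
    (ha : (‖p.z₁ - p.z₂‖ : ℂ) = a) (hb : (‖p.z₁ + conj p.z₂‖ : ℂ) = b)
    (hχ : ((√‖p.z₁ + p.z₂‖ : ℝ) : ℂ) = χ) (hε : ((√‖p.z₁ - conj p.z₂‖ : ℝ) : ℂ) = ε)
    (hn₁ : ((√|2 * p.κ₁| : ℝ) : ℂ) = n₁) (hn₂ : ((√|2 * p.κ₂| : ℝ) : ℂ) = n₂)
    (hs : Complex.exp (p.ρ * Complex.I) * Complex.I = s)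
    (hs₁ : Complex.exp (p.ρ₁ * Complex.I) * Complex.I = s₁)
    (hs₂ : Complex.exp (p.ρ₂ * Complex.I) * Complex.I = s₂) :
    ((2 * p.k₁ ^ 2 * p.k₂ ^ 2 * (p.Ω / p.Υ) : ℝ) : ℂ)
        * Complex.exp ((2 * (p.μ₁ * θ₁ - p.μ₂ * θ₂) + 2 * (φ₁ - φ₂) + p.ρ₂ - p.ρ₁ : ℝ) * Complex.I)
      - ((8 * |p.k₁ * p.k₂| * √|p.κ₁ * p.κ₂|
          * (p.k₁ ^ 2 + p.κ₁ ^ 2) ^ (1 / 4 : ℝ) * (p.k₂ ^ 2 + p.κ₂ ^ 2) ^ (1 / 4 : ℝ) : ℝ) : ℂ)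
        * (Complex.exp ((p.μ₁ * θ₁ - p.μ₂ * θ₂ + φ₁ - φ₂ : ℝ) * Complex.I) *
            ((√p.Γ / √p.Υ : ℝ) * ModParams.coshI (θ₁ + θ₂) (p.ϖ₁ - p.ϖ₂)
              + (1 / √(p.Γ * p.Υ) : ℝ) * ModParams.coshI (θ₁ - θ₂) (p.ϖ₁ + p.ϖ₂)))
      = 2 * ((|p.k₁| : ℝ) : ℂ) ^ 2 * ((|p.k₂| : ℝ) : ℂ) ^ 2 * (χ ^ 2 * ε ^ 2 / (a ^ 2 * b ^ 2))
          * (Complex.exp ((p.μ₁ * θ₁ - p.μ₂ * θ₂ + φ₁ - φ₂ : ℝ) * Complex.I) ^ 2 * (-s₁ * s₂))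
        - 4 * ((|p.k₁| : ℝ) * (|p.k₂| : ℝ) * n₁ * n₂ * (√‖p.z₁‖ : ℝ) * (√‖p.z₂‖ : ℝ))
          * (Complex.exp ((p.μ₁ * θ₁ - p.μ₂ * θ₂ + φ₁ - φ₂ : ℝ) * Complex.I)
          * (1 / b ^ 2 * joukowski (Complex.exp (θ₁ : ℝ) * Complex.exp (θ₂ : ℝ)
              * (ℓ₁ * (s * χ ^ 2 / (c * d)) / (d * ℓ₂)))
            + 1 / a ^ 2 * joukowski (Complex.exp (θ₁ : ℝ) / Complex.exp (θ₂ : ℝ)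
              * (ℓ₁ * ℓ₂ * c / (s * χ ^ 2))))) := by
  have x₁ : Complex.exp ((θ₁ + θ₂ : ℝ) : ℂ) = Complex.exp (θ₁ : ℝ) * Complex.exp (θ₂ : ℝ) := by
    rw [← Complex.exp_add, Complex.ofReal_add]
  have x₂ : Complex.exp ((θ₁ - θ₂ : ℝ) : ℂ) = Complex.exp (θ₁ : ℝ) / Complex.exp (θ₂ : ℝ) := by
    rw [← Complex.exp_sub, Complex.ofReal_sub]
  have e₁ : Complex.exp ((p.ϖ₁ - p.ϖ₂ : ℝ) * Complex.I)
      = Complex.exp ((p.lam₁ / 2 : ℝ) * Complex.I) * Complex.exp ((p.δ₂ / 2 : ℝ) * Complex.I)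
        / (Complex.exp ((p.δ₁ / 2 : ℝ) * Complex.I)
          * Complex.exp ((p.lam₂ / 2 : ℝ) * Complex.I)) := by
    rw [← Complex.exp_add, ← Complex.exp_add, ← Complex.exp_sub, ModParams.ϖ₁, ModParams.ϖ₂]
    congr 1
    push_cast
    ring
  have e₂ : Complex.exp ((p.ϖ₁ + p.ϖ₂ : ℝ) * Complex.I)
      = Complex.exp ((p.lam₁ / 2 : ℝ) * Complex.I) * Complex.exp ((p.lam₂ / 2 : ℝ) * Complex.I)
        / (Complex.exp ((p.δ₁ / 2 : ℝ) * Complex.I)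
          * Complex.exp ((p.δ₂ / 2 : ℝ) * Complex.I)) := by
    rw [← Complex.exp_add, ← Complex.exp_add, ← Complex.exp_sub, ModParams.ϖ₁, ModParams.ϖ₂]
    congr 1
    push_cast
    ring
  rw [exp_half_δ₂ hq] at e₁ e₂
  have hr : Complex.exp (p.ρ₁ * Complex.I) ^ 2 = 1 := exp_arg_ofReal_sq hκ₁
  have e₃ : Complex.exp
        ((2 * (p.μ₁ * θ₁ - p.μ₂ * θ₂) + 2 * (φ₁ - φ₂) + p.ρ₂ - p.ρ₁ : ℝ) * Complex.I)
      = Complex.exp ((p.μ₁ * θ₁ - p.μ₂ * θ₂ + φ₁ - φ₂ : ℝ) * Complex.I) ^ 2 * (-s₁ * s₂) := by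
    -- exp(iρ₁) is a sign and equals its own inverse; this is why the difference ρ₂ - ρ₁ appears in
    -- Y.
    have h : -s₁ * s₂ = Complex.exp (p.ρ₂ * Complex.I) / Complex.exp (p.ρ₁ * Complex.I) := by
      rw [← hs₁, ← hs₂, eq_div_iff (Complex.exp_ne_zero _)]
      generalize Complex.exp (p.ρ₁ * Complex.I) = u at hr
      generalize Complex.exp (p.ρ₂ * Complex.I) = v
      linear_combination v * hr - u ^ 2 * v * Complex.I_sq
    rw [h, ← Complex.exp_sub, ← Complex.exp_nat_mul, ← Complex.exp_add]
    congr 1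
    push_cast
    ring
  have hd₀ : d ≠ 0 := hd ▸ Complex.exp_ne_zero _
  rw [coshI_eq, coshI_eq, e₁, e₂, e₃, x₁, x₂, rpow_quarter₁, rpow_quarter₂, sqrt_abs_mul,
    abs_mul, sqrt_Γ_mul_Υ, sqrt_Γ, sqrt_Υ, Ω_eq, Υ_eq, ← sq_abs p.k₁, ← sq_abs p.k₂]
  simp only [hs, hd, hℓ₁, hℓ₂]
  simp only [Complex.ofReal_mul, Complex.ofReal_div, Complex.ofReal_pow, Complex.ofReal_one,
    Complex.ofReal_ofNat, ha, hb, hχ, hε, hn₁, hn₂]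
  simp only [hc]
  have ha₀ : a ≠ 0 := by
    rw [← ha]
    simpa using z₁_sub_z₂_ne_zero hq
  have hb₀ : b ≠ 0 := by
    rw [← hb]
    simpa using z₁_add_conj_z₂_ne_zero hq
  rw [show ℓ₁ * ℓ₂ / (d * (s * χ ^ 2 / (c * d))) = ℓ₁ * ℓ₂ * c / (s * χ ^ 2) by field_simp,
    show a / b / (a * b) = 1 / b ^ 2 by field_simp,
    show 1 / (a / b * (a * b)) = 1 / a ^ 2 by field_simp]
  ring

end Denominator

/-! ### The rational cosh form is the 2-soliton -/

section RationalCoshForm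

/-- The wave parameters with the two solitons exchanged. -/
def swapParams (p : ModParams) : ModParams := ⟨p.k₂, p.k₁, p.κ₂, p.κ₁⟩

variable (p : ModParams)

theorem swapParams_Ω : (swapParams p).Ω = p.Ω := by
  simp only [ModParams.Ω, swapParams]
  ring_nf

theorem swapParams_Υ : (swapParams p).Υ = p.Υ := by
  simp only [ModParams.Υ, swapParams]
  ring_nf

theorem swapParams_Δ : (swapParams p).Δ = p.Δ := by
  simp only [ModParams.Δ, swapParams]
  rw [add_comm p.k₂, add_comm p.κ₂, ← neg_sq (p.k₂ - p.k₁), neg_sub]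

theorem swapParams_Γ : (swapParams p).Γ = p.Γ := by
  simp only [ModParams.Γ, swapParams]
  rw [add_comm p.k₂, ← neg_sq (p.k₂ - p.k₁), neg_sub, ← neg_sq (p.κ₂ - p.κ₁), neg_sub]

theorem swapParams_γ₁ : (swapParams p).γ₁ = p.γ₂ := by
  simp only [ModParams.γ₁, ModParams.γ₂, swapParams]
  congr 2 <;> ring

theorem swapParams_γ₂ : (swapParams p).γ₂ = p.γ₁ := by
  simp only [ModParams.γ₁, ModParams.γ₂, swapParams]
  congr 2 <;> ring

theorem swapParams_δ₁ : (swapParams p).δ₁ = p.δ₂ := by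
  simp only [ModParams.δ₁, ModParams.δ₂, swapParams, add_comm p.κ₂]

theorem swapParams_δ₂ : (swapParams p).δ₂ = p.δ₁ := by
  simp only [ModParams.δ₁, ModParams.δ₂, swapParams, add_comm p.κ₂]

theorem swapParams_ρ : (swapParams p).ρ = p.ρ := by
  rw [ModParams.ρ, ModParams.ρ, swapParams_δ₁, swapParams_δ₂]
  simp only [swapParams]
  rw [add_comm p.δ₂, add_comm p.κ₂, add_comm p.k₂]

theorem swapParams_α₂ : (swapParams p).α₂ = p.α₁ := by
  rw [ModParams.α₁, ModParams.α₂, swapParams_δ₂]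
  rfl

theorem swapParams_υ₂ : (swapParams p).υ₂ = p.υ₁ := by
  rw [ModParams.υ₁, ModParams.υ₂, swapParams_δ₂]
  rfl

theorem swapParams_ϖ₁ : (swapParams p).ϖ₁ = p.ϖ₂ := by
  rw [ModParams.ϖ₁, ModParams.ϖ₂, swapParams_δ₁]
  rfl

theorem swapParams_ϖ₂ : (swapParams p).ϖ₂ = p.ϖ₁ := by
  rw [ModParams.ϖ₁, ModParams.ϖ₂, swapParams_δ₂]
  rfl

theorem swapParams_μ₁ : (swapParams p).μ₁ = p.μ₂ := by
  change (p.w₁ * (p.κ₂ - p.κ₁) - p.k₁ * (p.ω₂ - p.ω₁)) / (p.k₂ * p.w₁ - p.k₁ * p.w₂) = _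
  rw [ModParams.μ₂, ← neg_div_neg_eq]
  congr 1 <;> ring

theorem swapParams_μ₂ : (swapParams p).μ₂ = p.μ₁ := by
  change (p.w₂ * (p.κ₂ - p.κ₁) - p.k₂ * (p.ω₂ - p.ω₁)) / (p.k₂ * p.w₁ - p.k₁ * p.w₂) = _
  rw [ModParams.μ₁, ← neg_div_neg_eq]
  congr 1 <;> ring

/-- X₂ is obtained from the results for X₁ by symmetry, without repeating the monomial computations.
-/
theorem swapParams_X₁ (φ₁ φ₂ θ₁ θ₂ : ℝ) :
    (swapParams p).X₁ φ₂ φ₁ θ₂ θ₁ = p.X₂ φ₁ φ₂ θ₁ θ₂ := by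
  rw [ModParams.X₁, ModParams.X₂, swapParams_Ω, swapParams_Υ, swapParams_Δ, swapParams_Γ,
    swapParams_γ₁, swapParams_γ₂, swapParams_ρ, swapParams_α₂, swapParams_υ₂, swapParams_ϖ₁,
    swapParams_ϖ₂, swapParams_μ₁, swapParams_μ₂]
  rfl

theorem swapParams_coshAmplitude₁ (φ : ℝ) :
    coshAmplitude₁ (swapParams p) φ = coshAmplitude₂ p φ := by
  rw [coshAmplitude₁, coshAmplitude₂, swapParams_Δ, swapParams_Γ, swapParams_γ₂, swapParams_α₂]
  rfl

theorem swapParams_coshAmplitude₂ (φ : ℝ) :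
    coshAmplitude₂ (swapParams p) φ = coshAmplitude₁ p φ := by
  rw [coshAmplitude₁, coshAmplitude₂, swapParams_Δ, swapParams_Γ, swapParams_γ₁, ModParams.α₁,
    swapParams_δ₁]
  rfl

/-- The factor between the denominators of the two forms of the 2-soliton. -/
def denominatorScale (θ₁ θ₂ : ℝ) : ℂ :=
  ((√|2 * p.κ₁| : ℝ) : ℂ) ^ 2 * ((√|2 * p.κ₂| : ℝ) : ℂ) ^ 2
      * ((√‖p.z₁ - conj p.z₂‖ : ℝ) : ℂ) ^ 2 * (‖p.z₁ - p.z₂‖ : ℂ) ^ 2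
      / (8 * ((√‖p.z₁ + p.z₂‖ : ℝ) : ℂ) ^ 2 * (‖p.z₁ + conj p.z₂‖ : ℂ) ^ 2)
    * (Complex.exp (θ₁ : ℝ) ^ 2 * Complex.exp (θ₂ : ℝ) ^ 2)⁻¹

theorem swapParams_denominatorScale (θ₁ θ₂ : ℝ) :
    denominatorScale (swapParams p) θ₂ θ₁ = denominatorScale p θ₁ θ₂ := by
  have h₁ : ‖p.z₂ - conj p.z₁‖ = ‖p.z₁ - conj p.z₂‖ := by
    rw [← Complex.norm_conj, map_sub, Complex.conj_conj, norm_sub_rev]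
  have h₂ : ‖p.z₂ + conj p.z₁‖ = ‖p.z₁ + conj p.z₂‖ := by
    rw [← Complex.norm_conj, map_add, Complex.conj_conj, add_comm]
  change ((√|2 * p.κ₂| : ℝ) : ℂ) ^ 2 * ((√|2 * p.κ₁| : ℝ) : ℂ) ^ 2
      * ((√‖p.z₂ - conj p.z₁‖ : ℝ) : ℂ) ^ 2 * (‖p.z₂ - p.z₁‖ : ℂ) ^ 2
      / (8 * ((√‖p.z₂ + p.z₁‖ : ℝ) : ℂ) ^ 2 * (‖p.z₂ + conj p.z₁‖ : ℂ) ^ 2)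
    * (Complex.exp (θ₂ : ℝ) ^ 2 * Complex.exp (θ₁ : ℝ) ^ 2)⁻¹ = _
  rw [h₁, h₂, norm_sub_rev p.z₂ p.z₁, add_comm p.z₂, denominatorScale, mul_comm (Complex.exp (θ₂ : ℝ) ^ 2),
    mul_comm (((√|2 * p.κ₂| : ℝ) : ℂ) ^ 2)]

theorem conj_denominatorScale (θ₁ θ₂ : ℝ) :
    conj (denominatorScale p θ₁ θ₂) = denominatorScale p θ₁ θ₂ := by
  have h (y : ℝ) : conj (Complex.exp (y : ℝ)) = Complex.exp (y : ℝ) := by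
    rw [← Complex.exp_conj, Complex.conj_ofReal]
  simp only [denominatorScale, map_mul, map_div₀, map_pow, map_inv₀, Complex.conj_ofReal, h,
    map_ofNat]

variable {p}

theorem denominatorScale_ne_zero (hq : p.k₁ ^ 2 - 3 * p.κ₁ ^ 2 ≠ p.k₂ ^ 2 - 3 * p.κ₂ ^ 2)
    (hκ₁ : p.κ₁ ≠ 0) (hκ₂ : p.κ₂ ≠ 0) (θ₁ θ₂ : ℝ) : denominatorScale p θ₁ θ₂ ≠ 0 := by
  have nz {z : ℂ} (h : z ≠ 0) : ((√‖z‖ : ℝ) : ℂ) ≠ 0 := by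
    exact_mod_cast (Real.sqrt_pos.2 (norm_pos_iff.2 h)).ne'
  have nn {z : ℂ} (h : z ≠ 0) : (‖z‖ : ℂ) ≠ 0 := by simpa using h
  have nκ {κ : ℝ} (h : κ ≠ 0) : ((√|2 * κ| : ℝ) : ℂ) ≠ 0 := by
    exact_mod_cast (Real.sqrt_pos.2 (abs_pos.2 (mul_ne_zero two_ne_zero h))).ne'
  have h₁ := nκ hκ₁
  have h₂ := nκ hκ₂
  have h₃ := nz (z₁_sub_conj_z₂_ne_zero hq)
  have h₄ := nn (z₁_sub_z₂_ne_zero hq)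
  have h₅ := nz (z₁_add_z₂_ne_zero hq)
  have h₆ := nn (z₁_add_conj_z₂_ne_zero hq)
  have h₇ := Complex.exp_ne_zero (θ₁ : ℝ)
  have h₈ := Complex.exp_ne_zero (θ₂ : ℝ)
  exact mul_ne_zero (div_ne_zero (mul_ne_zero (mul_ne_zero (mul_ne_zero (pow_ne_zero 2 h₁)
    (pow_ne_zero 2 h₂)) (pow_ne_zero 2 h₃)) (pow_ne_zero 2 h₄)) (mul_ne_zero (mul_ne_zero
    (by norm_num) (pow_ne_zero 2 h₅)) (pow_ne_zero 2 h₆))) (inv_ne_zero (mul_ne_zero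
    (pow_ne_zero 2 h₇) (pow_ne_zero 2 h₈)))

/-- The phase difference of the two carrier waves as a function of the envelope variables. -/
theorem phase_difference_eq (hD : p.k₁ * p.w₂ - p.k₂ * p.w₁ ≠ 0) (t x : ℝ) :
    p.μ₁ * (p.k₁ * x + p.w₁ * t) - p.μ₂ * (p.k₂ * x + p.w₂ * t)
      = p.κ₁ * x + p.ω₁ * t - (p.κ₂ * x + p.ω₂ * t) := by
  rw [ModParams.μ₁, ModParams.μ₂, div_mul_eq_mul_div, div_mul_eq_mul_div, ← sub_div,
    div_eq_iff hD]
  ring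

/-- The quotient g₁/g₂ of the carriers depends on (t, x) only through θ₁ and θ₂; this is the purpose
of μ₁ and μ₂. -/
theorem exp_phase_difference (hD : p.k₁ * p.w₂ - p.k₂ * p.w₁ ≠ 0) (φ₁ φ₂ t x : ℝ) :
    Complex.exp ((φ₁ + (p.κ₁ * x + p.ω₁ * t) : ℝ) * Complex.I)
        / Complex.exp ((φ₂ + (p.κ₂ * x + p.ω₂ * t) : ℝ) * Complex.I)
      = Complex.exp ((p.μ₁ * (p.k₁ * x + p.w₁ * t) - p.μ₂ * (p.k₂ * x + p.w₂ * t)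
          + φ₁ - φ₂ : ℝ) * Complex.I) := by
  rw [phase_difference_eq hD, ← Complex.exp_sub]
  congr 1
  push_cast
  ring

theorem denominatorScale_mul_numeratorPart (hk₁ : p.k₁ ≠ 0) (hk₂ : p.k₂ ≠ 0)
    (hq : p.k₁ ^ 2 - 3 * p.κ₁ ^ 2 ≠ p.k₂ ^ 2 - 3 * p.κ₂ ^ 2) (hκ₁ : p.κ₁ ≠ 0) (hκ₂ : p.κ₂ ≠ 0)
    (hD : p.k₁ * p.w₂ - p.k₂ * p.w₁ ≠ 0) (φ₁ φ₂ t x : ℝ) :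
    denominatorScale p (p.k₁ * x + p.w₁ * t) (p.k₂ * x + p.w₂ * t)
        * numeratorPart p.z₁ p.z₂ (conj p.z₁) (conj p.z₂)
          (hirotaExp p.z₁ (coshAmplitude₁ p φ₁) t x) (hirotaExp p.z₂ (coshAmplitude₂ p φ₂) t x)
          (conj (hirotaExp p.z₁ (coshAmplitude₁ p φ₁) t x))
          (conj (hirotaExp p.z₂ (coshAmplitude₂ p φ₂) t x))
      = Complex.exp ((φ₁ + (p.κ₁ * x + p.ω₁ * t) : ℝ) * Complex.I)
        * p.X₁ φ₁ φ₂ (p.k₁ * x + p.w₁ * t) (p.k₂ * x + p.w₂ * t) := by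
  have h := numeratorPart_eq (isCoshParametrization hk₁ hk₂ hq hκ₁ hκ₂ φ₁ φ₂ t x)
  rw [exp_phase_difference hD] at h
  rw [denominatorScale, h, X₁_eq hq φ₁ φ₂ _ _ rfl rfl rfl rfl rfl rfl rfl rfl rfl rfl rfl rfl rfl]

/-- G is regrouped by phase: compared with the half sum, E₁Ē₁²E₂² is traded for its counterpart
E₁²E₂Ē₂² in the other half, whose phase is g₁ times g₁/g₂. -/
theorem ssG_eq_numeratorPart_add (z₁ z₂ A₁ A₂ : ℂ) (t x : ℝ) :
    ssG z₁ z₂ A₁ A₂ t x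
      = numeratorPart z₁ z₂ (conj z₁) (conj z₂) (hirotaExp z₁ A₁ t x) (hirotaExp z₂ A₂ t x)
          (conj (hirotaExp z₁ A₁ t x)) (conj (hirotaExp z₂ A₂ t x))
        + numeratorPart z₂ z₁ (conj z₂) (conj z₁) (hirotaExp z₂ A₂ t x) (hirotaExp z₁ A₁ t x)
          (conj (hirotaExp z₂ A₂ t x)) (conj (hirotaExp z₁ A₁ t x)) := by
  rw [ssG, ssHalfG, ssHalfG, numeratorPart, numeratorPart, ← neg_sub z₁ z₂, neg_sq,
    add_comm z₂ z₁]
  ring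

theorem ssF_eq_denominatorCross_add (z₁ z₂ A₁ A₂ : ℂ) (t x : ℝ) :
    ssF z₁ z₂ A₁ A₂ t x
      = 1 + denominatorDiag z₁ z₂ (conj z₁) (conj z₂) (hirotaExp z₁ A₁ t x) (hirotaExp z₂ A₂ t x)
          (conj (hirotaExp z₁ A₁ t x)) (conj (hirotaExp z₂ A₂ t x))
        + (denominatorCross z₁ z₂ (conj z₁) (conj z₂) (hirotaExp z₁ A₁ t x) (hirotaExp z₂ A₂ t x)
            (conj (hirotaExp z₁ A₁ t x)) (conj (hirotaExp z₂ A₂ t x))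
          + conj (denominatorCross z₁ z₂ (conj z₁) (conj z₂) (hirotaExp z₁ A₁ t x)
            (hirotaExp z₂ A₂ t x) (conj (hirotaExp z₁ A₁ t x)) (conj (hirotaExp z₂ A₂ t x)))) := by
  have h : ssDiagF z₁ z₂ (hirotaExp z₁ A₁ t x) (hirotaExp z₂ A₂ t x)
      = denominatorDiag z₁ z₂ (conj z₁) (conj z₂) (hirotaExp z₁ A₁ t x) (hirotaExp z₂ A₂ t x)
          (conj (hirotaExp z₁ A₁ t x)) (conj (hirotaExp z₂ A₂ t x)) := rfl
  rw [ssF, h]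
  generalize hirotaExp z₁ A₁ t x = E₁
  generalize hirotaExp z₂ A₂ t x = E₂
  -- The half sum contains the monomial E₁E₂Ē₁², of phase g₂/g₁. It is replaced by its conjugate so
  -- that all cross terms carry a positive power of g₁/g₂.
  have e : 4 * (z₁ - conj z₁) * (z₁ - conj z₂)
        / (z₁ * (conj z₁ + conj z₂) * (z₁ + conj z₁) ^ 2 * (z₁ + conj z₂) ^ 2)
        * (-(E₁ ^ 2 * conj E₁ * conj E₂))
      = -conj (4 * (z₁ - conj z₁) * (z₂ - conj z₁)
        / (conj z₁ * (z₁ + z₂) * (z₁ + conj z₁) ^ 2 * (z₂ + conj z₁) ^ 2)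
        * (E₁ * E₂ * conj E₁ ^ 2)) := by
    simp only [map_mul, map_div₀, map_sub, map_add, map_pow, Complex.conj_conj, map_ofNat]
    rw [← neg_sub z₁ (conj z₁), ← neg_sub z₁ (conj z₂), add_comm (conj z₁) z₁,
      add_comm (conj z₂) z₁]
    ring
  rw [denominatorCross, ssHalfF, e]
  simp only [map_add, map_sub, map_neg, Complex.conj_conj]
  ring

/-- The phase-dependent part of Y is twice the real part of a half sum, matching a cross term plus
its conjugate in F. -/
theorem Y_eq_add_re (φ₁ φ₂ θ₁ θ₂ : ℝ) :
    (p.Y φ₁ φ₂ θ₁ θ₂ : ℂ)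
      = ((√(p.k₁ ^ 2 + p.κ₁ ^ 2) * √(p.k₂ ^ 2 + p.κ₂ ^ 2) *
        (p.Γ / p.Δ + p.Δ / p.Γ
          + 64 * p.k₁ ^ 2 * p.k₂ ^ 2 * p.κ₁ * p.κ₂ * (1 / (p.Ω * p.Υ)))
      + |p.κ₁ * p.κ₂| *
        (p.Δ * p.Γ * Real.cosh (2 * (θ₁ + θ₂)) + 1 / (p.Δ * p.Γ) * Real.cosh (2 * (θ₁ - θ₂)))
      + 2 * |p.κ₂| * √(p.k₁ ^ 2 + p.κ₁ ^ 2) * Real.cosh (2 * θ₂)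
      + 2 * |p.κ₁| * √(p.k₂ ^ 2 + p.κ₂ ^ 2) * Real.cosh (2 * θ₁) : ℝ) : ℂ)
      + (2 * (((2 * p.k₁ ^ 2 * p.k₂ ^ 2 * (p.Ω / p.Υ) : ℝ) : ℂ)
        * Complex.exp ((2 * (p.μ₁ * θ₁ - p.μ₂ * θ₂) + 2 * (φ₁ - φ₂) + p.ρ₂ - p.ρ₁ : ℝ) * Complex.I)
      - ((8 * |p.k₁ * p.k₂| * √|p.κ₁ * p.κ₂|
          * (p.k₁ ^ 2 + p.κ₁ ^ 2) ^ (1 / 4 : ℝ) * (p.k₂ ^ 2 + p.κ₂ ^ 2) ^ (1 / 4 : ℝ) : ℝ) : ℂ)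
        * (Complex.exp ((p.μ₁ * θ₁ - p.μ₂ * θ₂ + φ₁ - φ₂ : ℝ) * Complex.I) *
            ((√p.Γ / √p.Υ : ℝ) * ModParams.coshI (θ₁ + θ₂) (p.ϖ₁ - p.ϖ₂)
              + (1 / √(p.Γ * p.Υ) : ℝ) * ModParams.coshI (θ₁ - θ₂) (p.ϖ₁ + p.ϖ₂)))).re : ℝ) := by
  rw [← Complex.ofReal_add, Complex.sub_re, Complex.re_ofReal_mul, Complex.re_ofReal_mul,
    Complex.exp_ofReal_mul_I_re, ModParams.Y]
  congr 1
  ring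

/-- The scale is real, so multiplication by it commutes with adding the conjugate of the cross
terms. -/
theorem denominatorScale_mul_ssF (hk₁ : p.k₁ ≠ 0) (hk₂ : p.k₂ ≠ 0)
    (hq : p.k₁ ^ 2 - 3 * p.κ₁ ^ 2 ≠ p.k₂ ^ 2 - 3 * p.κ₂ ^ 2) (hκ₁ : p.κ₁ ≠ 0) (hκ₂ : p.κ₂ ≠ 0)
    (hD : p.k₁ * p.w₂ - p.k₂ * p.w₁ ≠ 0) (φ₁ φ₂ t x : ℝ) :
    denominatorScale p (p.k₁ * x + p.w₁ * t) (p.k₂ * x + p.w₂ * t)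
        * ssF p.z₁ p.z₂ (coshAmplitude₁ p φ₁) (coshAmplitude₂ p φ₂) t x
      = p.Y φ₁ φ₂ (p.k₁ * x + p.w₁ * t) (p.k₂ * x + p.w₂ * t) := by
  have h := isCoshParametrization hk₁ hk₂ hq hκ₁ hκ₂ φ₁ φ₂ t x
  have h₁ := denominatorDiag_eq h
  have h₂ := denominatorCross_eq h
  rw [exp_phase_difference hD, ← Y_cross_eq hq hκ₁ φ₁ φ₂ _ _ rfl rfl rfl rfl rfl rfl rfl rfl rfl
    rfl rfl rfl rfl] at h₂
  rw [← Y_diag_eq _ _ rfl rfl rfl rfl rfl rfl rfl rfl] at h₁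
  rw [← denominatorScale] at h₁ h₂
  rw [ssF_eq_denominatorCross_add, Y_eq_add_re, ← h₂, ← h₁, ← Complex.add_conj, map_mul,
    conj_denominatorScale]
  ring

theorem denominatorScale_mul_ssG (hk₁ : p.k₁ ≠ 0) (hk₂ : p.k₂ ≠ 0)
    (hq : p.k₁ ^ 2 - 3 * p.κ₁ ^ 2 ≠ p.k₂ ^ 2 - 3 * p.κ₂ ^ 2) (hκ₁ : p.κ₁ ≠ 0) (hκ₂ : p.κ₂ ≠ 0)
    (hD : p.k₁ * p.w₂ - p.k₂ * p.w₁ ≠ 0) (φ₁ φ₂ t x : ℝ) :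
    denominatorScale p (p.k₁ * x + p.w₁ * t) (p.k₂ * x + p.w₂ * t)
        * ssG p.z₁ p.z₂ (coshAmplitude₁ p φ₁) (coshAmplitude₂ p φ₂) t x
      = Complex.exp ((φ₁ + (p.κ₁ * x + p.ω₁ * t) : ℝ) * Complex.I)
          * p.X₁ φ₁ φ₂ (p.k₁ * x + p.w₁ * t) (p.k₂ * x + p.w₂ * t)
        + Complex.exp ((φ₂ + (p.κ₂ * x + p.ω₂ * t) : ℝ) * Complex.I)
          * p.X₂ φ₁ φ₂ (p.k₁ * x + p.w₁ * t) (p.k₂ * x + p.w₂ * t) := by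
  have hD' : p.k₂ * p.w₁ - p.k₁ * p.w₂ ≠ 0 := by
    rw [← neg_sub]
    exact neg_ne_zero.2 hD
  have h := denominatorScale_mul_numeratorPart (p := swapParams p) hk₂ hk₁ hq.symm hκ₂ hκ₁ hD'
    φ₂ φ₁ t x
  rw [swapParams_coshAmplitude₁, swapParams_coshAmplitude₂] at h
  rw [ssG_eq_numeratorPart_add, mul_add,
    denominatorScale_mul_numeratorPart hk₁ hk₂ hq hκ₁ hκ₂ hD, ← swapParams_X₁,
    ← swapParams_denominatorScale]
  exact congrArg _ h

theorem sub_ne_zero_of_speeds_ne (hk₁ : p.k₁ ≠ 0) (hk₂ : p.k₂ ≠ 0)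
    (hw : p.w₁ / p.k₁ ≠ p.w₂ / p.k₂) : p.k₁ * p.w₂ - p.k₂ * p.w₁ ≠ 0 := by
  rw [ne_eq, div_eq_div_iff hk₁ hk₂] at hw
  intro h
  exact hw (by linarith)

/-- Cramer's rule for the linear map (t, x) ↦ (θ₁, θ₂), which is invertible because the speeds
differ. -/
theorem exists_envelope_variables_eq (hD : p.k₁ * p.w₂ - p.k₂ * p.w₁ ≠ 0) (θ₁ θ₂ : ℝ) :
    ∃ t x : ℝ, p.k₁ * x + p.w₁ * t = θ₁ ∧ p.k₂ * x + p.w₂ * t = θ₂ := by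
  refine ⟨(p.k₁ * θ₂ - p.k₂ * θ₁) / (p.k₁ * p.w₂ - p.k₂ * p.w₁),
    (θ₁ * p.w₂ - θ₂ * p.w₁) / (p.k₁ * p.w₂ - p.k₂ * p.w₁), ?_, ?_⟩ <;>
  · rw [mul_div_assoc', mul_div_assoc', ← add_div, div_eq_iff hD]
    ring

theorem sqrt_Δ_mul_Γ_pos (hq : p.k₁ ^ 2 - 3 * p.κ₁ ^ 2 ≠ p.k₂ ^ 2 - 3 * p.κ₂ ^ 2) :
    0 < √(p.Δ * p.Γ) := by
  have h₃ := norm_pos_iff.2 (z₁_sub_conj_z₂_ne_zero hq)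
  have h₄ := norm_pos_iff.2 (z₁_sub_z₂_ne_zero hq)
  have h₅ := norm_pos_iff.2 (z₁_add_z₂_ne_zero hq)
  have h₆ := norm_pos_iff.2 (z₁_add_conj_z₂_ne_zero hq)
  rw [sqrt_Δ_mul_Γ]
  positivity

theorem coshAmplitude₁_ne_zero (hk₁ : p.k₁ ≠ 0)
    (hq : p.k₁ ^ 2 - 3 * p.κ₁ ^ 2 ≠ p.k₂ ^ 2 - 3 * p.κ₂ ^ 2) (hκ₁ : p.κ₁ ≠ 0) (φ : ℝ) :
    coshAmplitude₁ p φ ≠ 0 := by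
  have h := sqrt_Δ_mul_Γ_pos hq
  have hz := norm_pos_iff.2 (z₁_ne_zero hk₁)
  refine mul_ne_zero (Complex.ofReal_ne_zero.2 (ne_of_gt ?_)) (Complex.exp_ne_zero _)
  positivity

theorem coshAmplitude₂_ne_zero (hk₂ : p.k₂ ≠ 0)
    (hq : p.k₁ ^ 2 - 3 * p.κ₁ ^ 2 ≠ p.k₂ ^ 2 - 3 * p.κ₂ ^ 2) (hκ₂ : p.κ₂ ≠ 0) (φ : ℝ) :
    coshAmplitude₂ p φ ≠ 0 := by
  rw [← swapParams_coshAmplitude₁]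
  exact coshAmplitude₁_ne_zero (p := swapParams p) hk₂ hq.symm hκ₂ φ

theorem exists_coshAmplitude₁_eq {w : ℂ} (hw : ‖w‖ = ‖coshAmplitude₁ p 0‖) :
    ∃ φ, coshAmplitude₁ p φ = w := by
  -- The phase φ only rotates the amplitude, so any argument is attained.
  refine ⟨w.arg + (p.α₂ + p.γ₂), ?_⟩
  rw [coshAmplitude₁, norm_mul, Complex.norm_exp_ofReal_mul_I, mul_one, Complex.norm_real,
    Real.norm_of_nonneg (by positivity)] at hw
  rw [coshAmplitude₁, ← hw, add_sub_cancel_right, Complex.norm_mul_exp_arg_mul_I]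

theorem exists_coshAmplitude₂_eq {w : ℂ} (hw : ‖w‖ = ‖coshAmplitude₂ p 0‖) :
    ∃ φ, coshAmplitude₂ p φ = w := by
  simp only [← swapParams_coshAmplitude₁] at hw ⊢
  exact exists_coshAmplitude₁_eq hw

/-- Every (θ₁, θ₂) comes from some (t, x), and there Y is a nonzero multiple of F. -/
theorem Y_ne_zero (hk₁ : p.k₁ ≠ 0) (hk₂ : p.k₂ ≠ 0)
    (hq : p.k₁ ^ 2 - 3 * p.κ₁ ^ 2 ≠ p.k₂ ^ 2 - 3 * p.κ₂ ^ 2) (hκ₁ : p.κ₁ ≠ 0) (hκ₂ : p.κ₂ ≠ 0)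
    (hD : p.k₁ * p.w₂ - p.k₂ * p.w₁ ≠ 0) (φ₁ φ₂ θ₁ θ₂ : ℝ) : p.Y φ₁ φ₂ θ₁ θ₂ ≠ 0 := by
  obtain ⟨t, x, rfl, rfl⟩ := exists_envelope_variables_eq hD θ₁ θ₂
  rw [← Complex.ofReal_ne_zero, ← denominatorScale_mul_ssF hk₁ hk₂ hq hκ₁ hκ₂ hD]
  exact mul_ne_zero (denominatorScale_ne_zero hq hκ₁ hκ₂ _ _)
    (ssF_ne_zero hk₁ hk₂ hq hκ₂ (coshAmplitude₂_ne_zero hk₂ hq hκ₂ _) t x)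

/-- The rational cosh form is a 2-soliton. -/
theorem coshForm_eq_ssTwoSoliton (hk₁ : p.k₁ ≠ 0) (hk₂ : p.k₂ ≠ 0)
    (hq : p.k₁ ^ 2 - 3 * p.κ₁ ^ 2 ≠ p.k₂ ^ 2 - 3 * p.κ₂ ^ 2) (hκ₁ : p.κ₁ ≠ 0) (hκ₂ : p.κ₂ ≠ 0)
    (hD : p.k₁ * p.w₂ - p.k₂ * p.w₁ ≠ 0) (φ₁ φ₂ : ℝ) :
    p.coshForm φ₁ φ₂
      = ssTwoSoliton p.z₁ p.z₂ (coshAmplitude₁ p φ₁) (coshAmplitude₂ p φ₂) := by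
  funext t x
  have e (a b c : ℝ) : Complex.exp ((a + (b * x + c * t) : ℝ) * Complex.I)
      = Complex.exp (a * Complex.I) * Complex.exp ((b * x + c * t) * Complex.I) := by
    rw [← Complex.exp_add]
    congr 1
    push_cast
    ring
  rw [ssTwoSoliton, ← mul_div_mul_left _ _ (denominatorScale_ne_zero hq hκ₁ hκ₂
      (p.k₁ * x + p.w₁ * t) (p.k₂ * x + p.w₂ * t)), denominatorScale_mul_ssF hk₁ hk₂ hq hκ₁ hκ₂ hD,
    denominatorScale_mul_ssG hk₁ hk₂ hq hκ₁ hκ₂ hD, e, e, ModParams.coshForm, ModParams.modulated,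
    ModParams.f₁, ModParams.f₂]
  ring

/-- A translation of space-time acts on the amplitudes by the factors exp(zx₀ - z³t₀). -/
theorem hirotaExp_translate (z A : ℂ) (t₀ x₀ t x : ℝ) :
    hirotaExp z (A * Complex.exp (z * x₀ - z ^ 3 * t₀)) (t - t₀) (x - x₀) = hirotaExp z A t x := by
  rw [hirotaExp, hirotaExp, mul_assoc, ← Complex.exp_add]
  congr 2
  push_cast
  ring

theorem ssTwoSoliton_translate (z₁ z₂ A₁ A₂ : ℂ) (t₀ x₀ t x : ℝ) :
    ssTwoSoliton z₁ z₂ (A₁ * Complex.exp (z₁ * x₀ - z₁ ^ 3 * t₀))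
        (A₂ * Complex.exp (z₂ * x₀ - z₂ ^ 3 * t₀)) (t - t₀) (x - x₀)
      = ssTwoSoliton z₁ z₂ A₁ A₂ t x := by
  simp only [ssTwoSoliton, ssG, ssF, hirotaExp_translate]

theorem norm_mul_exp_eq {A B : ℂ} (hA : A ≠ 0) (hB : B ≠ 0) {k κ t x : ℝ}
    (h : k * x + -k * (k ^ 2 - 3 * κ ^ 2) * t = Real.log (‖B‖ / ‖A‖)) :
    ‖A * Complex.exp ((⟨k, κ⟩ : ℂ) * x - (⟨k, κ⟩ : ℂ) ^ 3 * t)‖ = ‖B‖ := by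
  have e : ((⟨k, κ⟩ : ℂ) * x - (⟨k, κ⟩ : ℂ) ^ 3 * t).re
      = k * x + -k * (k ^ 2 - 3 * κ ^ 2) * t := by
    simp [pow_succ]
    ring
  have hA' := norm_pos_iff.2 hA
  have hB' := norm_pos_iff.2 hB
  rw [norm_mul, Complex.norm_exp, e, h, Real.exp_log (by positivity), mul_div_cancel₀ _ hA'.ne']

/-- Every 2-soliton is a translate of a rational cosh form. -/
theorem exists_ssTwoSoliton_eq_coshForm (hk₁ : p.k₁ ≠ 0) (hk₂ : p.k₂ ≠ 0)
    (hq : p.k₁ ^ 2 - 3 * p.κ₁ ^ 2 ≠ p.k₂ ^ 2 - 3 * p.κ₂ ^ 2) (hκ₁ : p.κ₁ ≠ 0) (hκ₂ : p.κ₂ ≠ 0)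
    (hD : p.k₁ * p.w₂ - p.k₂ * p.w₁ ≠ 0) {A₁ A₂ : ℂ} (hA₁ : A₁ ≠ 0) (hA₂ : A₂ ≠ 0) :
    ∃ t₀ x₀ φ₁ φ₂ : ℝ, ∀ t x : ℝ,
      ssTwoSoliton p.z₁ p.z₂ A₁ A₂ t x = p.coshForm φ₁ φ₂ (t - t₀) (x - x₀) := by
  -- The moduli of the translation factors are exp(kⱼx₀ + wⱼt₀). These two exponents can be
  -- prescribed freely and are chosen to match the moduli of the cosh amplitudes, which do not
  -- depend on φ.
  obtain ⟨t₀, x₀, h₁, h₂⟩ := exists_envelope_variables_eq hD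
    (Real.log (‖coshAmplitude₁ p 0‖ / ‖A₁‖)) (Real.log (‖coshAmplitude₂ p 0‖ / ‖A₂‖))
  obtain ⟨φ₁, h₁⟩ := exists_coshAmplitude₁_eq
    (norm_mul_exp_eq hA₁ (coshAmplitude₁_ne_zero hk₁ hq hκ₁ 0) h₁)
  obtain ⟨φ₂, h₂⟩ := exists_coshAmplitude₂_eq
    (norm_mul_exp_eq hA₂ (coshAmplitude₂_ne_zero hk₂ hq hκ₂ 0) h₂)
  refine ⟨t₀, x₀, φ₁, φ₂, fun t x => ?_⟩
  rw [coshForm_eq_ssTwoSoliton hk₁ hk₂ hq hκ₁ hκ₂ hD, h₁, h₂]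
  exact (ssTwoSoliton_translate _ _ _ _ _ _ _ _).symm

end RationalCoshForm

end

end SasaSatsuma

theorem proposition4 (p : ModParams)
    (hk₁ : p.k₁ ≠ 0) (hk₂ : p.k₂ ≠ 0)
    (hw : p.w₁ / p.k₁ ≠ p.w₂ / p.k₂)
    (hκ₁ : p.κ₁ ≠ 0) (hκ₂ : p.κ₂ ≠ 0) :
    (∀ φ₁ φ₂ : ℝ,
      (∀ θ₁ θ₂ : ℝ, p.Y φ₁ φ₂ θ₁ θ₂ ≠ 0) ∧
      IsSasaSatsumaSolution (p.coshForm φ₁ φ₂)) ∧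
    (∀ A₁ A₂ : ℂ, A₁ ≠ 0 → A₂ ≠ 0 →
      (∀ t x : ℝ, ssF p.z₁ p.z₂ A₁ A₂ t x ≠ 0) ∧
      (∃ H : ℝ → ℝ → ℂ,
        IsSasaSatsumaBilinear (ssG p.z₁ p.z₂ A₁ A₂) (ssF p.z₁ p.z₂ A₁ A₂) H) ∧
      IsSasaSatsumaSolution (ssTwoSoliton p.z₁ p.z₂ A₁ A₂) ∧
      ∃ t₀ x₀ φ₁ φ₂ : ℝ, ∀ t x : ℝ,
        ssTwoSoliton p.z₁ p.z₂ A₁ A₂ t x = p.coshForm φ₁ φ₂ (t - t₀) (x - x₀)) ∧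
    (∀ φ₁ φ₂ : ℝ, ∃ A₁ A₂ : ℂ, A₁ ≠ 0 ∧ A₂ ≠ 0 ∧ ∀ t x : ℝ,
      p.coshForm φ₁ φ₂ t x = ssTwoSoliton p.z₁ p.z₂ A₁ A₂ t x) := by
  have hq := SasaSatsuma.sq_ne_of_speeds_ne hk₁ hk₂ hw
  have hD := SasaSatsuma.sub_ne_zero_of_speeds_ne hk₁ hk₂ hw
  have hcosh := SasaSatsuma.coshForm_eq_ssTwoSoliton hk₁ hk₂ hq hκ₁ hκ₂ hD
  have hsol (A₁ : ℂ) {A₂ : ℂ} (hA₂ : A₂ ≠ 0) :=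
    SasaSatsuma.isSasaSatsumaSolution_ssTwoSoliton (A₁ := A₁) hk₁ hk₂ hq hκ₂ hA₂
  have h₁ := SasaSatsuma.coshAmplitude₁_ne_zero hk₁ hq hκ₁
  have h₂ := SasaSatsuma.coshAmplitude₂_ne_zero hk₂ hq hκ₂
  refine ⟨fun φ₁ φ₂ => ⟨SasaSatsuma.Y_ne_zero hk₁ hk₂ hq hκ₁ hκ₂ hD φ₁ φ₂, ?_⟩,
    fun A₁ A₂ hA₁ hA₂ => ⟨SasaSatsuma.ssF_ne_zero hk₁ hk₂ hq hκ₂ hA₂,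
      SasaSatsuma.exists_isSasaSatsumaBilinear hk₁ hk₂ hq hκ₂ hA₂, hsol A₁ hA₂,
      SasaSatsuma.exists_ssTwoSoliton_eq_coshForm hk₁ hk₂ hq hκ₁ hκ₂ hD hA₁ hA₂⟩,
    fun φ₁ φ₂ => ⟨_, _, h₁ φ₁, h₂ φ₂, fun t x => ?_⟩⟩
  · rw [hcosh]
    exact hsol _ (h₂ φ₂)
  · rw [hcosh]
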